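/- **Theorem 12.** All graphs are finite and simple. For graphs $G,H$ write $H\subseteq_I G$ if $G$ has an induced subgraph isomorphic to $H$. A graph $G$ is *$H$-induced-saturated* if $H\not\subseteq_I G$, but deleting any edge of $G$, or adding to $G$ any edge of its complement, results in a graph that contains an induced copy of $H$. Let $\square^n K_k$ be the graph whose vertices are the $n$-tuples over a $k$-element set, two of them adjacent iff they differ in exactly one coordinate; $K_k\square K_k$ is $\square^2K_k$. The *dimension* $\dim(G)$ is the smallest $n$ with $G\subseteq_I \square^n K_k$ for some $k$ ($\infty$ if there is none). *2-Hamming graphs.* $H$ is *2-Hamming* if $H\subseteq_I K_k\square K_k$ for some $k$. A *2-Hamming decomposition* of $H$ is a pair $\{F_1,F_2\}$ of graphs on the vertex set $V(H)$, each a vertex-disjoint union of cliques (single vertices allowed), whose edge sets are disjoint and have union $E(H)$. Let $\mathcal C(G)$ be the number of connected components of $G$. The decomposition is *optimal* if $\max\{\mathcal C(F_1),\mathcal C(F_2)\}=\min\{k: H\subseteq_I K_k\square K_k\}$. A 2-Hamming graph is *balanced* if it has an optimal 2-Hamming decomposition with $\mathcal C(F_1)=\mathcal C(F_2)$, and *unbalanced*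 otherwise. For a subgraph $H'$ of $H$, let $F_i|H'$ be the union of those components of $F_i$ whose vertex sets are contained in $V(H')$. *Chipped graphs.* $H$ is *chipped* if $H=H'-e$, where $H'$ is a connected 2-Hamming graph with a 2-Hamming decomposition $\{F_1,F_2\}$ such that $F_1$ has a component $K$ of order 3 or 4 containing both endpoints $u,v$ of the edge $e$ of $H'$, and one of the following holds: - (ch1) $V(K)=\{u,v,w\}$ and $\deg_{H'}(w)\ge 3$; - (ch2) $V(K)=\{u,v,w\}$ and $H'-E(K)$ has exactly two components, one of which is the single vertex $w$; - (ch3) $V(K)=\{u,v,w,x\}$, $\deg_{H'}(w)=3$, and $H'-E(K)$ has a component $\widetilde H$ with $V(K)\cap V(\widetilde H)=\{u\}$. *The class $\mathcal A$* consists of the connected, unbalanced 2-Hamming graphs $H$ that have an optimal 2-Hamming decomposition $\{F_1,F_2\}$ with $\mathcal C(F_1)>\mathcal C(F_2)$ and two distinct nonadjacent vertices $u,v$ such that one of the following holds: - (a1) $\deg_{F_1}(u)=\deg_{F_1}(v)=0$; - (a2) there is a common neighbour $w$ of $u$ and $v$ such that $H-\{uw,wv\}$ has exactly three components $H_1,H_2,H_3$,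 where $\mathcal C(F_1|H_j)>\mathcal C(F_2|H_j)$ for $j=1,2$ and $H_3$ is the single vertex $w$. *The class $\mathcal B$* consists of the connected, unbalanced 2-Hamming graphs $H$ that have an optimal 2-Hamming decomposition $\{F_1,F_2\}$ with $\mathcal C(F_1)>\mathcal C(F_2)$ and two adjacent vertices $u,v$ such that one of the following holds: - (b1) the edge $e=uv$ is a bridge of $H$ and, with $i\in\{1,2\}$ such that $e\in E(F_i)$, both components $H_1,H_2$ of $H-e$ satisfy $\mathcal C(F_1|H_j)\ge\mathcal C(F_2|H_j)+i$; - (b2) there is a common neighbour $w$ of $u$ and $v$ such that, with $T$ the triangle on $\{u,v,w\}$, $H-E(T)$ has exactly three components $H_1,H_2,H_3$, where $\mathcal C(F_1|H_j)>\mathcal C(F_2|H_j)$ for $j=1,2$ and $H_3$ is the single vertex $w$. **Claim.** Let $H$ be a connected graph. There is an integer $k\ge 2$ such that $K_k\square K_k$ is $H$-induced-saturated if and only if $H$ is chipped or $H\in\mathcal A\cap\mathcal B$. More precisely: if $\dim(H)>2$, such a $k$ exists if and only if $H$ is chipped; if $\dim(H)\le 2$, such a $k$ exists if and only if $H\in\mathcal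 A\cap\mathcal B$. -/

import Mathlib

namespace InducedSaturation

/-- `G` is `H`-induced-saturated: `G` has no induced copy of `H`, but deleting any edge of `G`, or
adding to `G` any edge of its complement, creates an induced copy of `H`. -/
def InducedSaturated {W V : Type*} (G : SimpleGraph W) (H : SimpleGraph V) : Prop :=
  ¬ H.IsIndContained G ∧
  (∀ x y : W, G.Adj x y → H.IsIndContained (G.deleteEdges {s(x, y)})) ∧
  (∀ x y : W, x ≠ y → ¬ G.Adj x y → H.IsIndContained (G ⊔ SimpleGraph.edge x y))

/-- The Cartesian product `K_k □ K_k` of two cliques of order `k`. -/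
def cliqueSquare (k : ℕ) : SimpleGraph (Fin k × Fin k) :=
  SimpleGraph.boxProd (SimpleGraph.completeGraph (Fin k)) (SimpleGraph.completeGraph (Fin k))

/-- The Cartesian product of `n` cliques of order `k`: the vertices are the `n`-tuples over a
`k`-element set, adjacent iff they differ in exactly one coordinate. -/
def hammingGraph (n k : ℕ) : SimpleGraph (Fin n → Fin k) where
  Adj x y := ∃! i, x i ≠ y i
  symm := ⟨fun x y h => by simpa only [ne_comm] using h⟩
  loopless := ⟨fun x h => by obtain ⟨i, hi, -⟩ := h; exact hi rfl⟩

/-- The dimension of `G`: the least `n` such that `G` is an induced subgraph of a product of `n`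
cliques of some common order `k`, and `⊤` if there is no such `n`. -/
noncomputable def dim {V : Type*} (G : SimpleGraph V) : ℕ∞ :=
  sInf {d : ℕ∞ | ∃ n k : ℕ, d = (n : ℕ∞) ∧ G.IsIndContained (hammingGraph n k)}

/-- `H` is 2-Hamming: it is an induced subgraph of some `K_k □ K_k`. -/
def TwoHamming {V : Type*} (H : SimpleGraph V) : Prop :=
  ∃ k : ℕ, H.IsIndContained (cliqueSquare k)

/-- `F` is a pairwise vertex-disjoint union of cliques: every component of `F` is complete. -/
def IsCliqueUnion {V : Type*} (F : SimpleGraph V) : Prop :=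
  ∀ x y : V, F.Reachable x y → x ≠ y → F.Adj x y

/-- `{F₁, F₂}` is a 2-Hamming decomposition of `H`: the `Fᵢ` are spanning disjoint unions of
cliques, and their edge sets partition the edge set of `H`. -/
structure IsTwoHammingDecomp {V : Type*} (H F₁ F₂ : SimpleGraph V) : Prop where
  union_eq : F₁ ⊔ F₂ = H
  disjoint : Disjoint F₁ F₂
  left : IsCliqueUnion F₁
  right : IsCliqueUnion F₂

/-- The number of connected components of `G`. -/
noncomputable def numComp {V : Type*} (G : SimpleGraph V) : ℕ :=
  Nat.card G.ConnectedComponent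

/-- The number of connected components of the subgraph of `F` that is the union of those components
of `F` whose vertex sets are contained in `S`. -/
noncomputable def numCompIn {V : Type*} (F : SimpleGraph V) (S : Set V) : ℕ :=
  Set.ncard {c : F.ConnectedComponent | c.supp ⊆ S}

/-- The degree of `v` in `G` (used for finite graphs). -/
noncomputable def deg {V : Type*} (G : SimpleGraph V) (v : V) : ℕ :=
  (G.neighborSet v).ncard

/-- A 2-Hamming decomposition `{F₁, F₂}` of `H` is optimal if the larger of the numbers of
components of `F₁` and `F₂` is the least `k` such that `H` is an induced subgraph of
`K_k □ K_k`. -/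
def IsOptimalDecomp {V : Type*} (H F₁ F₂ : SimpleGraph V) : Prop :=
  IsTwoHammingDecomp H F₁ F₂ ∧
  IsLeast {k : ℕ | H.IsIndContained (cliqueSquare k)} (max (numComp F₁) (numComp F₂))

/-- `H` has an optimal 2-Hamming decomposition both parts of which have equally many components. -/
def Balanced {V : Type*} (H : SimpleGraph V) : Prop :=
  ∃ F₁ F₂ : SimpleGraph V, IsOptimalDecomp H F₁ F₂ ∧ numComp F₁ = numComp F₂

/-- `H` is chipped: `H = H' - uv` for a suitable connected 2-Hamming graph `H'`. Here `K` is a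
component of `F₁` containing `u` and `v`, and `H'.deleteEdges K.supp.sym2` is `H' - E(K)`. -/
def Chipped {V : Type*} (H : SimpleGraph V) : Prop :=
  ∃ (H' F₁ F₂ : SimpleGraph V) (u v : V) (K : F₁.ConnectedComponent),
    H'.Connected ∧ TwoHamming H' ∧ IsTwoHammingDecomp H' F₁ F₂ ∧
    H'.Adj u v ∧ H = H'.deleteEdges {s(u, v)} ∧ u ∈ K.supp ∧ v ∈ K.supp ∧
    -- type 1
    ((∃ w : V, w ≠ u ∧ w ≠ v ∧ K.supp = {u, v, w} ∧ 3 ≤ deg H' w) ∨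
    -- type 2
     (∃ w : V, w ≠ u ∧ w ≠ v ∧ K.supp = {u, v, w} ∧
        numComp (H'.deleteEdges K.supp.sym2) = 2 ∧
        ∃ C : (H'.deleteEdges K.supp.sym2).ConnectedComponent, C.supp = {w}) ∨
    -- type 3
     (∃ w x : V, w ≠ u ∧ w ≠ v ∧ x ≠ u ∧ x ≠ v ∧ x ≠ w ∧ K.supp = {u, v, w, x} ∧
        deg H' w = 3 ∧
        ∃ C : (H'.deleteEdges K.supp.sym2).ConnectedComponent, K.supp ∩ C.supp = {u}))

/-- `G` has exactly three components, one of them is the single vertex `w`, and each of the two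
others contains more components of `F₁` than of `F₂`. -/
def SplitsAt {V : Type*} (G F₁ F₂ : SimpleGraph V) (w : V) : Prop :=
  ∃ C₁ C₂ C₃ : G.ConnectedComponent,
    C₁ ≠ C₂ ∧ C₁ ≠ C₃ ∧ C₂ ≠ C₃ ∧ (∀ C, C = C₁ ∨ C = C₂ ∨ C = C₃) ∧
    numCompIn F₂ C₁.supp < numCompIn F₁ C₁.supp ∧
    numCompIn F₂ C₂.supp < numCompIn F₁ C₂.supp ∧
    C₃.supp = {w}

/-- The class `𝒜`. -/
def ClassA {V : Type*} (H : SimpleGraph V) : Prop :=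
  H.Connected ∧ TwoHamming H ∧ ¬ Balanced H ∧
  ∃ F₁ F₂ : SimpleGraph V, IsOptimalDecomp H F₁ F₂ ∧ numComp F₂ < numComp F₁ ∧
    ∃ u v : V, u ≠ v ∧ ¬ H.Adj u v ∧
      ((deg F₁ u = 0 ∧ deg F₁ v = 0) ∨
       ∃ w : V, H.Adj u w ∧ H.Adj v w ∧
         SplitsAt (H.deleteEdges {s(u, w), s(w, v)}) F₁ F₂ w)

/-- The class `ℬ`. In the first alternative, the components of `H - uv` are the two sides of the
bridge `uv`; `i` is the index of the part of the decomposition containing `uv`. -/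
def ClassB {V : Type*} (H : SimpleGraph V) : Prop :=
  H.Connected ∧ TwoHamming H ∧ ¬ Balanced H ∧
  ∃ F₁ F₂ : SimpleGraph V, IsOptimalDecomp H F₁ F₂ ∧ numComp F₂ < numComp F₁ ∧
    ∃ u v : V, H.Adj u v ∧
      ((H.IsBridge s(u, v) ∧
         ∃ i : ℕ, ((i = 1 ∧ F₁.Adj u v) ∨ (i = 2 ∧ F₂.Adj u v)) ∧
           ∀ C : (H.deleteEdges {s(u, v)}).ConnectedComponent,
             numCompIn F₂ C.supp + i ≤ numCompIn F₁ C.supp) ∨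
       ∃ w : V, H.Adj u w ∧ H.Adj v w ∧
         SplitsAt (H.deleteEdges {s(u, v), s(u, w), s(v, w)}) F₁ F₂ w)

end InducedSaturation

namespace InducedSaturation

variable {V : Type*}

/-! ### Clique unions and decompositions -/

/-! Rows and columns of `cliqueSquare k` correspond to the components of the two parts of a
decomposition, so `H` embeds as an induced subgraph exactly when it has a decomposition whose parts
have at most `k` components each (`isIndContained_cliqueSquare_iff`, `DecompLE`). The automorphisms
of `cliqueSquare k` act transitively on adjacent pairs and on nonadjacent pairs of distinct
vertices. Saturation therefore says: `H` does not fit, `H + uv` fits for some nonedge, and `H - pq`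
fits for some edge (`inducedSaturated_cliqueSquare_iff`).

Call the parts colours. Two edges at a common vertex have the same colour iff their other ends are
adjacent. Hence colours spread along walks, and a connected graph has at most one decomposition up
to exchanging the parts (`colour_transfer`, `unique`); moreover claws and diamonds cannot occur as
induced subgraphs.

The central fact is `pendant_or_hinge`. Suppose `H` is connected, `uv` is an edge of `F₁`, and both
`H` and `H - uv` are 2-Hamming. Then either `uv` is a whole component of `F₁`, or that component is
a triangle `u, v, w` with `w` of degree two whose removal separates `u` from `v` (a `Hinge`). In a
hinge, write `a₁, a₂` and `b₁, b₂` for the numbers of components of `E₁, E₂` on the sides `A` and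
`B`. With the triangle the two parts have `a₁ + b₁ - 1` and `a₂ + b₂ + 1` components. Without `uv`
the colours on `B` are exchanged relative to `A`, and the counts are `a₁ + b₂` and `a₂ + b₁`.

If `H` is not 2-Hamming, put `H' = H + uv`. The component of `uv` in `F₁` has order at least 3,
since a two-vertex component could be deleted. It has order at most 4, since with five vertices no
single edge `pq` lies in all the diamonds left by deleting `uv`. Order 3 gives the first two chipped
types, which are the ways a triangle can fail to be a hinge; order 4 gives the third. Conversely
chipped graphs violate the central fact, one further deletion makes them 2-Hamming, and any large
`k` works.

If `H` is 2-Hamming, apply the central fact to `H + uv` and to `H - pq`. The isolated edge and the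
hinge become the two alternatives of `ClassA` and of `ClassB`; in `ClassB` an isolated edge has to
be a bridge, because otherwise its deletion only increases the counts. All inequalities are linear
arithmetic in the four side counts. In the converse direction `k` is one less than the larger number
of components. -/

theorem isCliqueUnion_iff {F : SimpleGraph V} :
    IsCliqueUnion F ↔ ∀ x y z, F.Adj x y → F.Adj y z → x ≠ z → F.Adj x z := by
  constructor
  · intro h x y z hxy hyz hne
    exact h x z (hxy.reachable.trans hyz.reachable) hne
  · rintro h x y ⟨p⟩
    induction p with
    | nil => intro h; exact absurd rfl h
    | @cons a b c hab q ih =>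
      intro hne
      by_cases hbc : b = c
      · exact hbc ▸ hab
      · exact h _ _ _ hab (ih hbc) hne

theorem IsCliqueUnion.reachable_iff {F : SimpleGraph V} (h : IsCliqueUnion F) {x y : V} :
    F.Reachable x y ↔ x = y ∨ F.Adj x y := by
  constructor
  · intro hr
    by_cases hxy : x = y
    · exact Or.inl hxy
    · exact Or.inr (h x y hr hxy)
  · rintro (rfl | h)
    · rfl
    · exact h.reachable

theorem isTwoHammingDecomp_iff {H F₁ F₂ : SimpleGraph V} :
    IsTwoHammingDecomp H F₁ F₂ ↔
      (∀ x y, H.Adj x y ↔ F₁.Adj x y ∨ F₂.Adj x y) ∧ (∀ x y, F₁.Adj x y → ¬ F₂.Adj x y) ∧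
      (∀ x y z, F₁.Adj x y → F₁.Adj y z → x ≠ z → F₁.Adj x z) ∧
      (∀ x y z, F₂.Adj x y → F₂.Adj y z → x ≠ z → F₂.Adj x z) := by
  constructor
  · rintro ⟨h1, h2, h3, h4⟩
    refine ⟨fun x y => by rw [← h1]; rfl, fun x y hx hy => ?_, isCliqueUnion_iff.1 h3,
      isCliqueUnion_iff.1 h4⟩
    have : (F₁ ⊓ F₂).Adj x y := ⟨hx, hy⟩
    rw [h2.eq_bot] at this
    exact this
  · rintro ⟨h1, h2, h3, h4⟩
    refine ⟨?_, ?_, isCliqueUnion_iff.2 h3, isCliqueUnion_iff.2 h4⟩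
    · ext x y
      rw [h1]; rfl
    · rw [disjoint_iff]
      ext x y
      constructor
      · rintro ⟨hx, hy⟩
        exact h2 x y hx hy
      · exact False.elim

/-! ### Rigidity of the two colours; excluded claws and diamonds. -/

namespace IsTwoHammingDecomp

variable {H F₁ F₂ : SimpleGraph V}

theorem adj_iff (h : IsTwoHammingDecomp H F₁ F₂) (x y : V) :
    H.Adj x y ↔ F₁.Adj x y ∨ F₂.Adj x y := (isTwoHammingDecomp_iff.1 h).1 x y

theorem not_both (h : IsTwoHammingDecomp H F₁ F₂) {x y : V} (h1 : F₁.Adj x y) :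
    ¬ F₂.Adj x y := (isTwoHammingDecomp_iff.1 h).2.1 x y h1

theorem trans₁ (h : IsTwoHammingDecomp H F₁ F₂) {x y z : V} (h1 : F₁.Adj x y) (h2 : F₁.Adj y z)
    (hne : x ≠ z) : F₁.Adj x z := (isTwoHammingDecomp_iff.1 h).2.2.1 x y z h1 h2 hne

theorem trans₂ (h : IsTwoHammingDecomp H F₁ F₂) {x y z : V} (h1 : F₂.Adj x y) (h2 : F₂.Adj y z)
    (hne : x ≠ z) : F₂.Adj x z := (isTwoHammingDecomp_iff.1 h).2.2.2 x y z h1 h2 hne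

theorem swap (h : IsTwoHammingDecomp H F₁ F₂) : IsTwoHammingDecomp H F₂ F₁ :=
  ⟨by rw [sup_comm]; exact h.1, h.2.symm, h.4, h.3⟩

/-- Two edges at a common vertex have the same colour iff they span a triangle. -/
theorem adj_iff_same (h : IsTwoHammingDecomp H F₁ F₂) {a b c : V} (hab : H.Adj a b)
    (hbc : H.Adj b c) (hne : a ≠ c) : H.Adj a c ↔ (F₁.Adj a b ↔ F₁.Adj b c) := by
  have hF1 : ∀ x y, F₁.Adj x y → F₁.Adj y x := fun _ _ h => h.symm
  have hF2 : ∀ x y, F₂.Adj x y → F₂.Adj y x := fun _ _ h => h.symm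
  have hn : ∀ x y, F₁.Adj x y → ¬ F₂.Adj x y := fun _ _ => h.not_both
  constructor
  · intro hac
    rcases (h.adj_iff _ _).1 hac with hac | hac
    · constructor
      · intro h1
        exact h.trans₁ (hF1 _ _ h1) hac hbc.ne
      · intro h1
        exact h.trans₁ hac (hF1 _ _ h1) hab.ne
    · constructor
      · intro h1
        rcases (h.adj_iff _ _).1 hbc with h2 | h2
        · exact h2
        · exact absurd (h.trans₂ hac (hF2 _ _ h2) hab.ne) (hn _ _ h1)
      · intro h1
        rcases (h.adj_iff _ _).1 hab with h2 | h2
        · exact h2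
        · exact absurd (h.trans₂ (hF2 _ _ h2) hac hbc.ne) (hn _ _ h1)
  · intro hs
    rcases (h.adj_iff _ _).1 hab with h1 | h1
    · exact (h.adj_iff _ _).2 (Or.inl (h.trans₁ h1 (hs.1 h1) hne))
    · rcases (h.adj_iff _ _).1 hbc with h2 | h2
      · exact absurd h1 (hn _ _ (hs.2 h2))
      · exact (h.adj_iff _ _).2 (Or.inr (h.trans₂ h1 h2 hne))

/-- Colours propagate along walks of a common subgraph of two decomposed graphs. -/
theorem colour_transfer {H' D₁ D₂ J : SimpleGraph V} (hF : IsTwoHammingDecomp H F₁ F₂)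
    (hD : IsTwoHammingDecomp H' D₁ D₂) (hJ : J ≤ H) (hJ' : J ≤ H')
    (hc : ∀ a b c, J.Adj a b → J.Adj b c → a ≠ c → (H.Adj a c ↔ H'.Adj a c)) {x y : V}
    (hxy : J.Reachable x y) : ∀ {x' y' : V}, J.Adj x x' → J.Adj y y' →
      ((F₁.Adj x x' ↔ D₁.Adj x x') ↔ (F₁.Adj y y' ↔ D₁.Adj y y')) := by
  -- What travels along the walk is whether `F₁` and `D₁` agree on an edge. Two consecutive edges
  -- have equal colours in `H` iff they do in `H'`, since both conditions amount to adjacency of `a`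
  -- and `c`; if `a = c` the edge is the same.
  have key : ∀ a b c, J.Adj a b → J.Adj b c →
      ((F₁.Adj a b ↔ D₁.Adj a b) ↔ (F₁.Adj b c ↔ D₁.Adj b c)) := by
    intro a b c hab hbc
    by_cases hne : a = c
    · subst hne
      rw [F₁.adj_comm, D₁.adj_comm]
    · have e1 := hF.adj_iff_same (hJ hab) (hJ hbc) hne
      have e2 := hD.adj_iff_same (hJ' hab) (hJ' hbc) hne
      have e3 := hc a b c hab hbc hne
      tauto
  obtain ⟨p⟩ := hxy
  induction p with
  | nil =>
    intro x' y' hx hy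
    rw [F₁.adj_comm, D₁.adj_comm]
    exact key _ _ _ hx.symm hy
  | @cons a b c hab q ih =>
    intro x' y' hx hy
    rw [← ih hab.symm hy, F₁.adj_comm b, D₁.adj_comm b, F₁.adj_comm, D₁.adj_comm]
    exact key _ _ _ hx.symm hab

/-- On a connected piece, two decompositions of one graph agree up to exchanging the parts. -/
theorem eq_or_flip {D₁ D₂ : SimpleGraph V} (hF : IsTwoHammingDecomp H F₁ F₂)
    (hD : IsTwoHammingDecomp H D₁ D₂) (a : V) :
    (∀ x y, H.Reachable a x → (F₁.Adj x y ↔ D₁.Adj x y) ∧ (F₂.Adj x y ↔ D₂.Adj x y)) ∨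
    (∀ x y, H.Reachable a x → (F₁.Adj x y ↔ D₂.Adj x y) ∧ (F₂.Adj x y ↔ D₁.Adj x y)) := by
  have key : ∀ x x' y y', H.Reachable a x → H.Reachable a y → H.Adj x x' → H.Adj y y' →
      ((F₁.Adj x x' ↔ D₁.Adj x x') ↔ (F₁.Adj y y' ↔ D₁.Adj y y')) := by
    intro x x' y y' hx hy h1 h2
    exact colour_transfer hF hD le_rfl le_rfl (fun _ _ _ _ _ _ => Iff.rfl) (hx.symm.trans hy) h1 h2
  by_cases hex : ∃ x x', H.Reachable a x ∧ H.Adj x x' ∧ (F₁.Adj x x' ↔ D₁.Adj x x')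
  · obtain ⟨x, x', hx, h1, h2⟩ := hex
    left
    intro z y hz
    have f1 := hF.adj_iff z y
    have d1 := hD.adj_iff z y
    have f2 := hF.not_both (x := z) (y := y)
    have d2 := hD.not_both (x := z) (y := y)
    by_cases hzy : H.Adj z y
    · have := key x x' z y hx hz h1 hzy
      tauto
    · tauto
  · push Not at hex
    right
    intro z y hz
    have f1 := hF.adj_iff z y
    have d1 := hD.adj_iff z y
    have f2 := hF.not_both (x := z) (y := y)
    have d2 := hD.not_both (x := z) (y := y)
    by_cases hzy : H.Adj z y
    · have := hex z y hz hzy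
      tauto
    · tauto

theorem unique (hH : H.Connected) {D₁ D₂ : SimpleGraph V} (hF : IsTwoHammingDecomp H F₁ F₂)
    (hD : IsTwoHammingDecomp H D₁ D₂) : (D₁ = F₁ ∧ D₂ = F₂) ∨ (D₁ = F₂ ∧ D₂ = F₁) := by
  obtain ⟨a⟩ := hH.nonempty
  rcases hF.eq_or_flip hD a with h | h
  · left
    constructor <;> ext x y
    · exact (h x y (hH.preconnected a x)).1.symm
    · exact (h x y (hH.preconnected a x)).2.symm
  · right
    constructor <;> ext x y
    · exact (h x y (hH.preconnected a x)).2.symm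
    · exact (h x y (hH.preconnected a x)).1.symm

/-- Two colours on three edges at `w`: some two coincide, and then their ends are adjacent. -/
theorem no_claw (h : IsTwoHammingDecomp H F₁ F₂) {w a b c : V} (ha : H.Adj w a) (hb : H.Adj w b)
    (hc : H.Adj w c) (hab : a ≠ b) (hac : a ≠ c) (hbc : b ≠ c) (nab : ¬ H.Adj a b)
    (nac : ¬ H.Adj a c) (nbc : ¬ H.Adj b c) : False := by
  have e1 := h.adj_iff_same ha.symm hb hab
  have e2 := h.adj_iff_same ha.symm hc hac
  have e3 := h.adj_iff_same hb.symm hc hbc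
  rw [F₁.adj_comm a w] at *
  rw [F₁.adj_comm b w] at *
  tauto

/-- Both triangles take the colour of their common edge `wx`, so `uw` and `wv` have equal colours
and force `uv`. -/
theorem no_diamond (h : IsTwoHammingDecomp H F₁ F₂) {u v w x : V} (huw : H.Adj u w)
    (hux : H.Adj u x) (hvw : H.Adj v w) (hvx : H.Adj v x) (hwx : H.Adj w x) (huv : u ≠ v)
    (nuv : ¬ H.Adj u v) : False := by
  have e1 := h.adj_iff_same huw hwx hux.ne
  have e2 := h.adj_iff_same hvw hwx hvx.ne
  have e3 := h.adj_iff_same huw hvw.symm huv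
  rw [F₁.adj_comm w v] at e3
  tauto

end IsTwoHammingDecomp

/-! ### Embeddings into products of two cliques -/

theorem cliqueSquare_adj {k : ℕ} {p q : Fin k × Fin k} :
    (cliqueSquare k).Adj p q ↔ (p.1 = q.1 ∧ p.2 ≠ q.2) ∨ (p.1 ≠ q.1 ∧ p.2 = q.2) := by
  simp only [cliqueSquare, SimpleGraph.boxProd_adj, SimpleGraph.completeGraph_eq_top,
    SimpleGraph.top_adj]
  tauto

/-- `H` has a 2-Hamming decomposition whose parts have at most `k` components each. -/
def DecompLE (k : ℕ) (H : SimpleGraph V) : Prop :=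
  ∃ F₁ F₂ : SimpleGraph V, IsTwoHammingDecomp H F₁ F₂ ∧ numComp F₁ ≤ k ∧ numComp F₂ ≤ k

/-- The graph joining distinct vertices with the same value of `f`. -/
def fibreGraph {α : Type*} (f : V → α) : SimpleGraph V where
  Adj x y := x ≠ y ∧ f x = f y
  symm := ⟨fun _ _ h => ⟨h.1.symm, h.2.symm⟩⟩
  loopless := ⟨fun _ h => h.1 rfl⟩

theorem numComp_fibreGraph_le {k : ℕ} (f : V → Fin k) : numComp (fibreGraph f) ≤ k := by
  have hr : ∀ x y, (fibreGraph f).Reachable x y → f x = f y := by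
    rintro x y ⟨p⟩
    induction p with
    | nil => rfl
    | cons h _ ih => exact h.2.trans ih
  let g : (fibreGraph f).ConnectedComponent → Fin k :=
    SimpleGraph.ConnectedComponent.lift f (fun x y p _ => hr x y p.reachable)
  have hg : Function.Injective g := by
    intro c d
    refine SimpleGraph.ConnectedComponent.ind₂ (fun x y h => ?_) c d
    by_cases hxy : x = y
    · rw [hxy]
    · exact SimpleGraph.ConnectedComponent.sound
        (SimpleGraph.Adj.reachable (G := fibreGraph f) ⟨hxy, h⟩)
  simpa [numComp] using Nat.card_le_card_of_injective g hg

/-- Given an embedding, the fibres of the two coordinates form the parts. Given a decomposition,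
injective numberings of the components serve as coordinates, and disjointness of the parts makes the
resulting map injective. -/
theorem isIndContained_cliqueSquare_iff [Finite V] {H : SimpleGraph V} {k : ℕ} :
    H.IsIndContained (cliqueSquare k) ↔ DecompLE k H := by
  constructor
  · rintro ⟨f⟩
    refine ⟨fibreGraph fun x => (f x).1, fibreGraph fun x => (f x).2, ?_,
      numComp_fibreGraph_le _, numComp_fibreGraph_le _⟩
    rw [isTwoHammingDecomp_iff]
    have hinj : ∀ x y, (f x).1 = (f y).1 → (f x).2 = (f y).2 → x = y :=
      fun x y h1 h2 => f.injective (Prod.ext h1 h2)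
    refine ⟨fun x y => ?_, fun x y h1 h2 => h1.1 (hinj x y h1.2 h2.2), ?_, ?_⟩
    · rw [← f.map_adj_iff, cliqueSquare_adj]
      constructor
      · rintro (⟨h1, h2⟩ | ⟨h1, h2⟩)
        · exact Or.inl ⟨fun h => h2 (by rw [h]), h1⟩
        · exact Or.inr ⟨fun h => h1 (by rw [h]), h2⟩
      · rintro (⟨h1, h2⟩ | ⟨h1, h2⟩)
        · exact Or.inl ⟨h2, fun h => h1 (hinj x y h2 h)⟩
        · exact Or.inr ⟨fun h => h1 (hinj x y h h2), h2⟩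
    · exact fun x y z h1 h2 h => ⟨h, h1.2.trans h2.2⟩
    · exact fun x y z h1 h2 h => ⟨h, h1.2.trans h2.2⟩
  · rintro ⟨F₁, F₂, h, hk1, hk2⟩
    have emb : ∀ F : SimpleGraph V, numComp F ≤ k →
        ∃ g : F.ConnectedComponent → Fin k, Function.Injective g := by
      intro F hF
      have := Fintype.ofFinite F.ConnectedComponent
      have : Fintype.card F.ConnectedComponent ≤ Fintype.card (Fin k) := by
        simpa [numComp, Nat.card_eq_fintype_card] using hF
      obtain ⟨e⟩ := Function.Embedding.nonempty_of_card_le this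
      exact ⟨e, e.injective⟩
    obtain ⟨g1, hg1⟩ := emb F₁ hk1
    obtain ⟨g2, hg2⟩ := emb F₂ hk2
    have e1 : ∀ x y, g1 (F₁.connectedComponentMk x) = g1 (F₁.connectedComponentMk y) ↔
        x = y ∨ F₁.Adj x y := by
      intro x y
      rw [hg1.eq_iff, SimpleGraph.ConnectedComponent.eq, h.left.reachable_iff]
    have e2 : ∀ x y, g2 (F₂.connectedComponentMk x) = g2 (F₂.connectedComponentMk y) ↔
        x = y ∨ F₂.Adj x y := by
      intro x y
      rw [hg2.eq_iff, SimpleGraph.ConnectedComponent.eq, h.right.reachable_iff]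
    refine ⟨⟨⟨fun x => (g1 (F₁.connectedComponentMk x), g2 (F₂.connectedComponentMk x)), ?_⟩, ?_⟩⟩
    · intro x y hxy
      have h1 := (e1 x y).1 (congrArg Prod.fst hxy)
      have h2 := (e2 x y).1 (congrArg Prod.snd hxy)
      have := h.not_both (x := x) (y := y)
      tauto
    · intro x y
      change (cliqueSquare k).Adj (g1 _, g2 _) (g1 _, g2 _) ↔ _
      simp only [cliqueSquare_adj, ne_eq, e1, e2]
      have h3 := h.not_both (x := x) (y := y)
      have h4 := h.adj_iff x y
      have h5 : F₁.Adj x y → x ≠ y := fun h => h.ne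
      have h6 : F₂.Adj x y → x ≠ y := fun h => h.ne
      tauto

theorem numComp_le_card [Finite V] (F : SimpleGraph V) : numComp F ≤ Nat.card V :=
  Nat.card_le_card_of_surjective F.connectedComponentMk Quot.mk_surjective

theorem IsTwoHammingDecomp.decompLE [Finite V] {H F₁ F₂ : SimpleGraph V}
    (h : IsTwoHammingDecomp H F₁ F₂) {k : ℕ} (hk : Nat.card V ≤ k) : DecompLE k H :=
  ⟨F₁, F₂, h, (numComp_le_card _).trans hk, (numComp_le_card _).trans hk⟩

theorem twoHamming_iff [Finite V] {H : SimpleGraph V} :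
    TwoHamming H ↔ ∃ F₁ F₂, IsTwoHammingDecomp H F₁ F₂ := by
  simp only [TwoHamming, isIndContained_cliqueSquare_iff]
  constructor
  · rintro ⟨k, F₁, F₂, h, -⟩
    exact ⟨F₁, F₂, h⟩
  · rintro ⟨F₁, F₂, h⟩
    exact ⟨_, h.decompLE le_rfl⟩

theorem IsTwoHammingDecomp.twoHamming [Finite V] {H F₁ F₂ : SimpleGraph V}
    (h : IsTwoHammingDecomp H F₁ F₂) : TwoHamming H := twoHamming_iff.2 ⟨F₁, F₂, h⟩

/-! ### Symmetries of the product of two cliques -/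

theorem exists_perm_pair {k : ℕ} {a b c d : Fin k} (h : a = b ↔ c = d) :
    ∃ σ : Equiv.Perm (Fin k), σ a = c ∧ σ b = d := by
  -- The first swap sends `a` to `c`; the second corrects the image of `b` to `d` and does not
  -- disturb `c` when `a ≠ b`.
  refine ⟨Equiv.swap (Equiv.swap a c b) d * Equiv.swap a c, ?_, ?_⟩
  · simp only [Equiv.Perm.coe_mul, Function.comp_apply, Equiv.swap_apply_left]
    by_cases hab : a = b
    · rw [← hab, Equiv.swap_apply_left, Equiv.swap_apply_left, h.1 hab]
    · refine Equiv.swap_apply_of_ne_of_ne ?_ (fun hcd => hab (h.2 hcd))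
      intro hc
      apply hab
      have := congrArg (Equiv.swap a c) hc
      simpa using this
  · simp

/-- The automorphism of `cliqueSquare k` given by permutations of the two coordinates. -/
def cliqueSquareIso {k : ℕ} (σ τ : Equiv.Perm (Fin k)) : cliqueSquare k ≃g cliqueSquare k where
  toEquiv := Equiv.prodCongr σ τ
  map_rel_iff' := by
    intro p q
    simp [cliqueSquare_adj]

/-- Exchanging the coordinates, as an automorphism of `cliqueSquare k`. -/
def cliqueSquareSwap (k : ℕ) : cliqueSquare k ≃g cliqueSquare k where
  toEquiv := Equiv.prodComm _ _
  map_rel_iff' := by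
    intro p q
    simp [cliqueSquare_adj]
    tauto

theorem exists_iso_of_coords {k : ℕ} {p q p' q' : Fin k × Fin k} (h1 : p.1 = q.1 ↔ p'.1 = q'.1)
    (h2 : p.2 = q.2 ↔ p'.2 = q'.2) :
    ∃ e : cliqueSquare k ≃g cliqueSquare k, e p = p' ∧ e q = q' := by
  obtain ⟨σ, s1, s2⟩ := exists_perm_pair h1
  obtain ⟨τ, t1, t2⟩ := exists_perm_pair h2
  exact ⟨cliqueSquareIso σ τ, Prod.ext s1 t1, Prod.ext s2 t2⟩

/-- Pairs with the same pattern of equal coordinates are related by coordinatewise permutations; a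
row edge and a column edge need the coordinate exchange as well. -/
theorem exists_iso_of_adj {k : ℕ} {p q p' q' : Fin k × Fin k} (h : (cliqueSquare k).Adj p q)
    (h' : (cliqueSquare k).Adj p' q') :
    ∃ e : cliqueSquare k ≃g cliqueSquare k, e p = p' ∧ e q = q' := by
  rw [cliqueSquare_adj] at h h'
  have swapped : ∀ (_ : p.2 = q.2 ↔ p'.1 = q'.1) (_ : p.1 = q.1 ↔ p'.2 = q'.2),
      ∃ e : cliqueSquare k ≃g cliqueSquare k, e p = p' ∧ e q = q' := by
    intro h1 h2
    obtain ⟨e, e1, e2⟩ := exists_iso_of_coords (p := p.swap) (q := q.swap) (p' := p') (q' := q')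
      h1 h2
    exact ⟨(cliqueSquareSwap k).trans e, e1, e2⟩
  rcases h with h | h <;> rcases h' with h' | h'
  · exact exists_iso_of_coords (by tauto) (by tauto)
  · exact swapped (by tauto) (by tauto)
  · exact swapped (by tauto) (by tauto)
  · exact exists_iso_of_coords (by tauto) (by tauto)

theorem exists_iso_of_not_adj {k : ℕ} {p q p' q' : Fin k × Fin k} (hne : p ≠ q) (hne' : p' ≠ q')
    (h : ¬ (cliqueSquare k).Adj p q) (h' : ¬ (cliqueSquare k).Adj p' q') :
    ∃ e : cliqueSquare k ≃g cliqueSquare k, e p = p' ∧ e q = q' := by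
  rw [cliqueSquare_adj] at h h'
  rw [ne_eq, Prod.ext_iff] at hne hne'
  exact exists_iso_of_coords (by tauto) (by tauto)

/-! ### Saturation in terms of decompositions -/

theorem deleteEdges_pair_adj {G : SimpleGraph V} {u v x y : V} :
    (G.deleteEdges {s(u, v)}).Adj x y ↔ G.Adj x y ∧ ¬ (x = u ∧ y = v ∨ x = v ∧ y = u) := by
  simp [SimpleGraph.deleteEdges_adj]

theorem sup_edge_adj {G : SimpleGraph V} {u v x y : V} :
    (G ⊔ SimpleGraph.edge u v).Adj x y ↔
      G.Adj x y ∨ (x = u ∧ y = v ∨ x = v ∧ y = u) ∧ x ≠ y := by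
  rw [SimpleGraph.sup_adj, SimpleGraph.edge_adj]

theorem deleteEdges_sup_edge {G : SimpleGraph V} {u v : V} (h : ¬ G.Adj u v) :
    (G ⊔ SimpleGraph.edge u v).deleteEdges {s(u, v)} = G := by
  ext x y
  rw [deleteEdges_pair_adj, sup_edge_adj]
  constructor
  · tauto
  · intro hxy
    refine ⟨Or.inl hxy, ?_⟩
    rintro (⟨rfl, rfl⟩ | ⟨rfl, rfl⟩)
    · exact h hxy
    · exact h hxy.symm

theorem sup_edge_deleteEdges {G : SimpleGraph V} {u v : V} (h : G.Adj u v) :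
    G.deleteEdges {s(u, v)} ⊔ SimpleGraph.edge u v = G := by
  ext x y
  rw [sup_edge_adj, deleteEdges_pair_adj]
  constructor
  · rintro (h1 | ⟨⟨rfl, rfl⟩ | ⟨rfl, rfl⟩, -⟩)
    · exact h1.1
    · exact h
    · exact h.symm
  · intro h1
    have := h1.ne
    tauto

theorem IsIndContained.deleteEdges_of_map {W : Type*} {G : SimpleGraph W} {H : SimpleGraph V}
    (f : H ↪g G) (u v : V) :
    (H.deleteEdges {s(u, v)}).IsIndContained (G.deleteEdges {s(f u, f v)}) := by
  refine ⟨⟨f.toEmbedding, ?_⟩⟩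
  intro x y
  rw [deleteEdges_pair_adj, deleteEdges_pair_adj]
  simp [f.injective.eq_iff]

theorem IsIndContained.sup_edge_of_map {W : Type*} {G : SimpleGraph W} {H : SimpleGraph V}
    (f : H ↪g G) (u v : V) :
    (H ⊔ SimpleGraph.edge u v).IsIndContained (G ⊔ SimpleGraph.edge (f u) (f v)) := by
  refine ⟨⟨f.toEmbedding, ?_⟩⟩
  intro x y
  rw [sup_edge_adj, sup_edge_adj]
  simp [f.injective.eq_iff]

/-- A copy of `H` in `G - pq` that misses `p` or `q` would already be an induced copy in `G`. So it
uses both, and their preimages are the new edge. -/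
theorem exists_sup_edge_of_deleteEdges {W : Type*} {G : SimpleGraph W} {H : SimpleGraph V}
    {p q : W} (hpq : G.Adj p q) (hH : ¬ H.IsIndContained G)
    (h : H.IsIndContained (G.deleteEdges {s(p, q)})) :
    ∃ u v, u ≠ v ∧ ¬ H.Adj u v ∧ (H ⊔ SimpleGraph.edge u v).IsIndContained G := by
  obtain ⟨f⟩ := h
  have hf : ∀ x y, H.Adj x y ↔ G.Adj (f x) (f y) ∧ ¬ (f x = p ∧ f y = q ∨ f x = q ∧ f y = p) := by
    intro x y
    rw [← deleteEdges_pair_adj, f.map_adj_iff]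
  by_cases hu : ∃ u v, f u = p ∧ f v = q
  · obtain ⟨u, v, hp, hq⟩ := hu
    refine ⟨u, v, fun h => hpq.ne (hp.symm.trans ((congrArg f h).trans hq)), by rw [hf]; simp [hp, hq], ?_⟩
    have := IsIndContained.sup_edge_of_map f u v
    rwa [hp, hq, sup_edge_deleteEdges hpq] at this
  · refine absurd ⟨⟨f.toEmbedding, ?_⟩⟩ hH
    intro x y
    rw [hf]
    have h1 : ¬ (f x = p ∧ f y = q) := fun h => hu ⟨x, y, h⟩
    have h2 : ¬ (f x = q ∧ f y = p) := fun h => hu ⟨y, x, h.2, h.1⟩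
    change G.Adj (f x) (f y) ↔ _
    tauto

theorem exists_deleteEdges_of_sup_edge {W : Type*} {G : SimpleGraph W} {H : SimpleGraph V}
    {p q : W} (hpq : ¬ G.Adj p q) (hne : p ≠ q) (hH : ¬ H.IsIndContained G)
    (h : H.IsIndContained (G ⊔ SimpleGraph.edge p q)) :
    ∃ u v, H.Adj u v ∧ (H.deleteEdges {s(u, v)}).IsIndContained G := by
  obtain ⟨f⟩ := h
  have hf : ∀ x y, H.Adj x y ↔
      G.Adj (f x) (f y) ∨ (f x = p ∧ f y = q ∨ f x = q ∧ f y = p) ∧ f x ≠ f y := by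
    intro x y
    rw [← sup_edge_adj, f.map_adj_iff]
  by_cases hu : ∃ u v, f u = p ∧ f v = q
  · obtain ⟨u, v, hp, hq⟩ := hu
    refine ⟨u, v, by rw [hf]; simp [hp, hq, hne], ?_⟩
    have := IsIndContained.deleteEdges_of_map f u v
    rwa [hp, hq, deleteEdges_sup_edge hpq] at this
  · refine absurd ⟨⟨f.toEmbedding, ?_⟩⟩ hH
    intro x y
    rw [hf]
    have h1 : ¬ (f x = p ∧ f y = q) := fun h => hu ⟨x, y, h⟩
    have h2 : ¬ (f x = q ∧ f y = p) := fun h => hu ⟨y, x, h.2, h.1⟩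
    change G.Adj (f x) (f y) ↔ _
    tauto

theorem inducedSaturated_cliqueSquare_iff [Finite V] {H : SimpleGraph V} {k : ℕ} (hk : 2 ≤ k) :
    InducedSaturated (cliqueSquare k) H ↔
      ¬ DecompLE k H ∧
      (∃ u v, u ≠ v ∧ ¬ H.Adj u v ∧ DecompLE k (H ⊔ SimpleGraph.edge u v)) ∧
      ∃ u v, H.Adj u v ∧ DecompLE k (H.deleteEdges {s(u, v)}) := by
  simp only [← isIndContained_cliqueSquare_iff]
  let a : Fin k := ⟨0, by omega⟩
  let b : Fin k := ⟨1, by omega⟩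
  have hab : a ≠ b := by simp [a, b]
  constructor
  · rintro ⟨h1, h2, h3⟩
    have e1 : (cliqueSquare k).Adj (a, a) (a, b) := by simp [cliqueSquare_adj, hab]
    have e2 : ¬ (cliqueSquare k).Adj (a, a) (b, b) := by simp [cliqueSquare_adj, hab]
    have e3 : (a, a) ≠ (b, b) := by simp [hab]
    exact ⟨h1, exists_sup_edge_of_deleteEdges e1 h1 (h2 _ _ e1),
      exists_deleteEdges_of_sup_edge e2 e3 h1 (h3 _ _ e3 e2)⟩
  · rintro ⟨h1, ⟨u, v, huv, nuv, ⟨f⟩⟩, ⟨s, t, hst, ⟨g⟩⟩⟩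
    refine ⟨h1, fun p q hpq => ?_, fun p q hpq npq => ?_⟩
    · have hadj : (cliqueSquare k).Adj (f u) (f v) := by
        rw [f.map_adj_iff, sup_edge_adj]
        simp [huv]
      obtain ⟨e, rfl, rfl⟩ := exists_iso_of_adj hadj hpq
      have := IsIndContained.deleteEdges_of_map (f.trans e.toEmbedding) u v
      rwa [deleteEdges_sup_edge nuv] at this
    · have hadj : ¬ (cliqueSquare k).Adj (g s) (g t) := by
        rw [g.map_adj_iff, deleteEdges_pair_adj]
        simp
      obtain ⟨e, rfl, rfl⟩ := exists_iso_of_not_adj (g.injective.ne hst.ne) hpq hadj npq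
      have := IsIndContained.sup_edge_of_map (g.trans e.toEmbedding) s t
      rwa [sup_edge_deleteEdges hst] at this

/-! ### Dimension at most two -/

theorem hammingGraph_adj_two {k : ℕ} {x y : Fin 2 → Fin k} :
    (hammingGraph 2 k).Adj x y ↔ (x 0 = y 0 ∧ x 1 ≠ y 1) ∨ (x 0 ≠ y 0 ∧ x 1 = y 1) := by
  simp only [hammingGraph, ExistsUnique, Fin.exists_fin_two, Fin.forall_fin_two]
  simp
  tauto

theorem twoHamming_of_hammingGraph {n k : ℕ} (hn : n ≤ 2) : TwoHamming (hammingGraph n k) := by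
  interval_cases n
  · refine ⟨1, ⟨⟨⟨fun _ => (0, 0), fun x y _ => Subsingleton.elim x y⟩, ?_⟩⟩⟩
    intro x y
    simp [Subsingleton.elim x y]
  -- The second coordinate is constantly 0; a vertex `x` itself witnesses that `Fin k` is nonempty.
  · refine ⟨k, ⟨⟨⟨fun x => (x 0, ⟨0, Fin.pos (x 0)⟩), ?_⟩, ?_⟩⟩⟩
    · intro x y h
      have := congrArg Prod.fst h
      ext i
      rw [Subsingleton.elim i 0]
      exact congrArg Fin.val this
    · intro x y
      change (cliqueSquare k).Adj (_, _) (_, _) ↔ _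
      simp [cliqueSquare_adj, hammingGraph, ExistsUnique]
  · refine ⟨k, ⟨⟨⟨fun x => (x 0, x 1), ?_⟩, ?_⟩⟩⟩
    · intro x y h
      rw [Prod.ext_iff] at h
      funext i
      fin_cases i
      · exact h.1
      · exact h.2
    · intro x y
      change (cliqueSquare k).Adj (_, _) (_, _) ↔ _
      simp [cliqueSquare_adj, hammingGraph_adj_two]

theorem cliqueSquare_isIndContained_hammingGraph (k : ℕ) :
    (cliqueSquare k).IsIndContained (hammingGraph 2 k) := by
  refine ⟨⟨⟨fun p => ![p.1, p.2], ?_⟩, ?_⟩⟩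
  · intro p q h
    exact Prod.ext (by simpa using congrFun h 0) (by simpa using congrFun h 1)
  · intro p q
    change (hammingGraph 2 k).Adj ![_, _] ![_, _] ↔ _
    simp [cliqueSquare_adj, hammingGraph_adj_two]

theorem dim_le_two_iff {H : SimpleGraph V} : dim H ≤ 2 ↔ TwoHamming H := by
  constructor
  · intro h
    have hne : {d : ℕ∞ | ∃ n k : ℕ, d = (n : ℕ∞) ∧
        H.IsIndContained (hammingGraph n k)}.Nonempty := by
      by_contra hne
      rw [Set.not_nonempty_iff_eq_empty] at hne
      rw [dim, hne, sInf_empty] at h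
      exact absurd h (by decide)
    obtain ⟨n, k, hd, hc⟩ := csInf_mem hne
    change dim H = n at hd
    rw [hd] at h
    obtain ⟨m, hm⟩ := twoHamming_of_hammingGraph (n := n) (k := k) (by exact_mod_cast h)
    exact ⟨m, hc.trans hm⟩
  · rintro ⟨k, hk⟩
    exact sInf_le ⟨2, k, rfl, hk.trans (cliqueSquare_isIndContained_hammingGraph k)⟩

/-! ### Counting components -/

/-- The type of components depends on the graph. Counting closed neighbourhoods as plain vertex sets
makes the counts of different graphs comparable. -/
theorem IsCliqueUnion.numCompIn_eq {F : SimpleGraph V} (h : IsCliqueUnion F) (S : Set V) :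
    numCompIn F S = {s : Set V | s ⊆ S ∧ ∃ x, s = {y | x = y ∨ F.Adj x y}}.ncard := by
  have hinj : Function.Injective (SimpleGraph.ConnectedComponent.supp (G := F)) :=
    SimpleGraph.ConnectedComponent.supp_injective
  rw [numCompIn, ← Set.ncard_image_of_injective _ hinj]
  congr 1
  have hs : ∀ x, (F.connectedComponentMk x).supp = {y | x = y ∨ F.Adj x y} := by
    intro x
    ext y
    rw [SimpleGraph.ConnectedComponent.mem_supp_iff, SimpleGraph.ConnectedComponent.eq,
      SimpleGraph.reachable_comm, h.reachable_iff]
    rfl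
  ext s
  constructor
  · rintro ⟨c, hc, rfl⟩
    refine ⟨hc, ?_⟩
    obtain ⟨x, rfl⟩ : ∃ x, F.connectedComponentMk x = c := c.exists_rep
    exact ⟨x, hs x⟩
  · rintro ⟨h1, x, rfl⟩
    rw [← hs] at h1 ⊢
    exact ⟨_, h1, rfl⟩

theorem numComp_eq_numCompIn_univ (F : SimpleGraph V) : numComp F = numCompIn F Set.univ := by
  simp [numComp, numCompIn, Set.ncard_univ]

theorem numCompIn_union [Finite V] (F : SimpleGraph V) {S T : Set V} (hd : Disjoint S T)
    (hc : ∀ x y, F.Adj x y → x ∈ S ∪ T → (x ∈ S ↔ y ∈ S)) :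
    numCompIn F (S ∪ T) = numCompIn F S + numCompIn F T := by
  classical
  rw [numCompIn, numCompIn, numCompIn, ← Set.ncard_union_eq]
  · congr 1
    ext c
    simp only [Set.mem_ofPred_eq, Set.mem_union]
    constructor
    · intro h
      obtain ⟨x, rfl⟩ : ∃ x, F.connectedComponentMk x = c := c.exists_rep
      have hx : x ∈ S ∪ T := h (SimpleGraph.ConnectedComponent.mem_supp_iff _ _ |>.2 rfl)
      have key : ∀ y, F.Reachable x y → (x ∈ S ↔ y ∈ S) := by
        rintro y hy
        obtain ⟨p⟩ := hy
        -- The hypothesis `hc` controls only edges starting in `S ∪ T`, so the walk must first be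
        -- kept inside that set.
        have hall : ∀ z ∈ p.support, z ∈ S ∪ T := by
          intro z hz
          apply h
          rw [SimpleGraph.ConnectedComponent.mem_supp_iff]
          exact SimpleGraph.ConnectedComponent.sound (p.takeUntil z hz).reachable.symm
        clear h hx
        induction p with
        | nil => rfl
        | cons hab q ih =>
          rw [hc _ _ hab (hall _ (by simp))]
          exact ih (fun z hz => hall z (by simp [hz]))
      have hmem : ∀ y ∈ SimpleGraph.ConnectedComponent.supp (F.connectedComponentMk x),
          (x ∈ S ↔ y ∈ S) := by
        intro y hy
        rw [SimpleGraph.ConnectedComponent.mem_supp_iff, SimpleGraph.ConnectedComponent.eq] at hy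
        exact key y hy.symm
      by_cases hxS : x ∈ S
      · exact Or.inl fun y hy => (hmem y hy).1 hxS
      · refine Or.inr fun y hy => (h hy).resolve_left fun hyS => hxS ((hmem y hy).2 hyS)
    · rintro (h | h)
      · exact h.trans Set.subset_union_left
      · exact h.trans Set.subset_union_right
  · rw [Set.disjoint_left]
    intro c h1 h2
    obtain ⟨x, hx⟩ := c.nonempty_supp
    exact Set.disjoint_left.1 hd (h1 hx) (h2 hx)

/-- In a union of cliques the component of `x` is its closed neighbourhood, so agreement at the
vertices of `S` determines every component inside `S`. -/
theorem IsCliqueUnion.numCompIn_congr {F F' : SimpleGraph V} (h : IsCliqueUnion F)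
    (h' : IsCliqueUnion F') {S : Set V} (hS : ∀ x ∈ S, ∀ y, F.Adj x y ↔ F'.Adj x y) :
    numCompIn F S = numCompIn F' S := by
  rw [h.numCompIn_eq, h'.numCompIn_eq]
  congr 1
  ext s
  have key : ∀ x ∈ S, {y | x = y ∨ F.Adj x y} = {y | x = y ∨ F'.Adj x y} := by
    intro x hx
    ext y
    simp [hS x hx y]
  constructor
  · rintro ⟨h1, x, rfl⟩
    exact ⟨h1, x, key x (h1 (Or.inl rfl))⟩
  · rintro ⟨h1, x, rfl⟩
    exact ⟨h1, x, (key x (h1 (Or.inl rfl))).symm⟩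

theorem IsCliqueUnion.numCompIn_singleton {F : SimpleGraph V} (h : IsCliqueUnion F) {w : V}
    (hw : ∀ y, ¬ F.Adj w y) : numCompIn F {w} = 1 := by
  rw [h.numCompIn_eq, Set.ncard_eq_one]
  refine ⟨{w}, ?_⟩
  have e : {y | w = y ∨ F.Adj w y} = {w} := by
    ext y
    simp [hw, eq_comm]
  ext s
  constructor
  · rintro ⟨h1, x, rfl⟩
    obtain rfl : x = w := h1 (Or.inl rfl)
    exact e
  · rintro rfl
    exact ⟨le_rfl, w, e.symm⟩

/-- An isolated vertex which gains neighbours outside `S` lowers the count inside `S` by one. -/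
theorem IsCliqueUnion.numCompIn_attach [Finite V] {F F' : SimpleGraph V} (h : IsCliqueUnion F)
    (h' : IsCliqueUnion F') {S : Set V} {u v : V} (hu : u ∈ S) (hiso : ∀ y, ¬ F.Adj u y)
    (hv : v ∉ S) (huv : F'.Adj u v) (hS : ∀ x ∈ S, x ≠ u → ∀ y, F.Adj x y ↔ F'.Adj x y) :
    numCompIn F S = numCompIn F' S + 1 := by
  have hc : ∀ x y, F.Adj x y → (x ∈ ({u} : Set V) ↔ y ∈ ({u} : Set V)) := by
    intro x y hxy
    have h1 : x ≠ u := by rintro rfl; exact hiso _ hxy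
    have h2 : y ≠ u := by rintro rfl; exact hiso _ hxy.symm
    simp [h1, h2]
  have e : S = {u} ∪ S \ {u} := by simp [hu]
  have e1 : numCompIn F S = 1 + numCompIn F (S \ {u}) := by
    conv_lhs => rw [e]
    rw [numCompIn_union F Set.disjoint_sdiff_right fun x y hxy _ => hc x y hxy,
      h.numCompIn_singleton hiso]
  have e2 : numCompIn F (S \ {u}) = numCompIn F' (S \ {u}) :=
    h.numCompIn_congr h' fun x hx y => hS x hx.1 hx.2 y
  have e3 : numCompIn F' (S \ {u}) = numCompIn F' S := by
    rw [h'.numCompIn_eq, h'.numCompIn_eq]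
    congr 1
    ext s
    constructor
    · rintro ⟨h1, x, rfl⟩
      exact ⟨h1.trans Set.sdiff_subset, x, rfl⟩
    · rintro ⟨h1, x, rfl⟩
      refine ⟨fun y hy => ⟨h1 hy, ?_⟩, x, rfl⟩
      rintro rfl
      apply hv
      apply h1
      rcases hy with rfl | hy
      · exact Or.inr huv
      · by_cases hxv : x = v
        · exact Or.inl hxv
        · exact Or.inr (isCliqueUnion_iff.1 h' _ _ _ hy huv hxv)
  omega

/-! ### Adding cliques and flipping the parts of a decomposition -/

/-- The complete graph on the vertex set `T`, other vertices being isolated. -/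
def cliqueOn (T : Set V) : SimpleGraph V where
  Adj x y := x ≠ y ∧ x ∈ T ∧ y ∈ T
  symm := ⟨fun _ _ h => ⟨h.1.symm, h.2.2, h.2.1⟩⟩
  loopless := ⟨fun _ h => h.1 rfl⟩

theorem sup_cliqueOn_adj {G : SimpleGraph V} {T : Set V} {x y : V} :
    (G ⊔ cliqueOn T).Adj x y ↔ G.Adj x y ∨ x ≠ y ∧ x ∈ T ∧ y ∈ T := Iff.rfl

theorem sup_cliqueOn_adj_of_notMem {G : SimpleGraph V} {T : Set V} {x y : V} (hx : x ∉ T) :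
    (G ⊔ cliqueOn T).Adj x y ↔ G.Adj x y :=
  ⟨fun h => h.resolve_right fun h => hx h.2.1, Or.inl⟩

theorem sdiff_cliqueOn_adj {G : SimpleGraph V} {T : Set V} {x y : V} :
    (G \ cliqueOn T).Adj x y ↔ G.Adj x y ∧ ¬ (x ∈ T ∧ y ∈ T) := by
  rw [SimpleGraph.sdiff_adj]
  change G.Adj x y ∧ ¬ (x ≠ y ∧ x ∈ T ∧ y ∈ T) ↔ _
  have : G.Adj x y → x ≠ y := fun h => h.ne
  tauto

theorem sdiff_cliqueOn_sup {G : SimpleGraph V} {T : Set V}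
    (h : ∀ x ∈ T, ∀ y ∈ T, x ≠ y → G.Adj x y) : G \ cliqueOn T ⊔ cliqueOn T = G := by
  ext x y
  rw [sup_cliqueOn_adj, sdiff_cliqueOn_adj]
  have := h x
  have : G.Adj x y → x ≠ y := fun h => h.ne
  constructor
  · rintro (h1 | ⟨h1, h2, h3⟩)
    · exact h1.1
    · exact h x h2 y h3 h1
  · tauto

/-- The graph equal to `F₂` inside `S` and to `F₁` outside `S`. -/
def flip (F₁ F₂ : SimpleGraph V) (S : Set V) : SimpleGraph V where
  Adj x y := (x ∉ S ∧ y ∉ S ∧ F₁.Adj x y) ∨ (x ∈ S ∧ y ∈ S ∧ F₂.Adj x y)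
  symm := ⟨fun x y h => by rwa [F₁.adj_comm y, F₂.adj_comm y, and_left_comm,
    and_left_comm (a := y ∈ S)]⟩
  loopless := ⟨fun x h => by simp at h⟩

theorem flip_adj {F₁ F₂ : SimpleGraph V} {S : Set V} {x y : V} : (flip F₁ F₂ S).Adj x y ↔
    (x ∉ S ∧ y ∉ S ∧ F₁.Adj x y) ∨ (x ∈ S ∧ y ∈ S ∧ F₂.Adj x y) := Iff.rfl

theorem flip_adj_of_mem {F₁ F₂ : SimpleGraph V} {S : Set V}
    (hc : ∀ x y, F₂.Adj x y → (x ∈ S ↔ y ∈ S)) {x y : V} (hx : x ∈ S) :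
    (flip F₁ F₂ S).Adj x y ↔ F₂.Adj x y := by
  rw [flip_adj]
  have := hc x y
  tauto

theorem flip_adj_of_notMem {F₁ F₂ : SimpleGraph V} {S : Set V}
    (hc : ∀ x y, F₁.Adj x y → (x ∈ S ↔ y ∈ S)) {x y : V} (hx : x ∉ S) :
    (flip F₁ F₂ S).Adj x y ↔ F₁.Adj x y := by
  rw [flip_adj]
  have := hc x y
  tauto

namespace IsTwoHammingDecomp

variable {J E₁ E₂ : SimpleGraph V}

theorem flip (h : IsTwoHammingDecomp J E₁ E₂) {S : Set V}
    (hc : ∀ x y, J.Adj x y → (x ∈ S ↔ y ∈ S)) :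
    IsTwoHammingDecomp J (flip E₁ E₂ S) (InducedSaturation.flip E₂ E₁ S) := by
  rw [isTwoHammingDecomp_iff]
  refine ⟨fun x y => ?_, fun x y => ?_, fun x y z => ?_, fun x y z => ?_⟩ <;>
    simp only [flip_adj]
  · have := hc x y
    have := h.adj_iff x y
    tauto
  · have := h.not_both (x := x) (y := y)
    tauto
  · have h1 := h.trans₁ (x := x) (y := y) (z := z)
    have h2 := h.trans₂ (x := x) (y := y) (z := z)
    tauto
  · have h1 := h.trans₁ (x := x) (y := y) (z := z)
    have h2 := h.trans₂ (x := x) (y := y) (z := z)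
    tauto

/-- Since the vertices of `T` are isolated in `E₁`, the new clique is a component of the first part
and no transitivity is lost. -/
theorem sup_cliqueOn (h : IsTwoHammingDecomp J E₁ E₂) {T : Set V}
    (hT : ∀ x ∈ T, ∀ y, ¬ E₁.Adj x y) (hT' : ∀ x ∈ T, ∀ y ∈ T, ¬ E₂.Adj x y) :
    IsTwoHammingDecomp (J ⊔ cliqueOn T) (E₁ ⊔ cliqueOn T) E₂ := by
  rw [isTwoHammingDecomp_iff]
  refine ⟨fun x y => ?_, fun x y => ?_, fun x y z => ?_, fun _ _ _ => h.trans₂⟩ <;>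
    simp only [sup_cliqueOn_adj]
  · rw [h.adj_iff]
    tauto
  · rintro (h1 | ⟨-, hx, hy⟩)
    · exact h.not_both h1
    · exact hT' x hx y hy
  · rintro (h1 | ⟨-, hx, hy⟩) (h2 | ⟨-, hy', hz⟩) hne
    · exact Or.inl (h.trans₁ h1 h2 hne)
    · exact absurd h1.symm (hT _ hy' _)
    · exact absurd h2 (hT _ hy _)
    · exact Or.inr ⟨hne, hx, hz⟩

theorem sdiff_cliqueOn (h : IsTwoHammingDecomp J E₁ E₂) {T : Set V}
    (hT : ∀ x ∈ T, ∀ y, E₁.Adj x y → y ∈ T) (hT' : ∀ x ∈ T, ∀ y ∈ T, ¬ E₂.Adj x y) :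
    IsTwoHammingDecomp (J \ cliqueOn T) (E₁ \ cliqueOn T) E₂ := by
  rw [isTwoHammingDecomp_iff]
  refine ⟨fun x y => ?_, fun x y => ?_, fun x y z => ?_, fun _ _ _ => h.trans₂⟩ <;>
    simp only [sdiff_cliqueOn_adj]
  · rw [h.adj_iff]
    have := hT' x
    constructor
    · tauto
    · rintro (h1 | h1)
      · tauto
      · exact ⟨Or.inr h1, fun h2 => hT' x h2.1 y h2.2 h1⟩
  · rintro ⟨h1, -⟩
    exact h.not_both h1
  · rintro ⟨h1, n1⟩ ⟨h2, n2⟩ hne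
    exact ⟨h.trans₁ h1 h2 hne, fun h3 => n1 ⟨h3.1, hT _ h3.1 _ h1⟩⟩

end IsTwoHammingDecomp

/-- The singletons of `T` merge into one component and nothing else changes. The additive form
avoids subtraction of natural numbers. -/
theorem IsCliqueUnion.numComp_sup_cliqueOn [Finite V] {E : SimpleGraph V} {T : Set V}
    (h : IsCliqueUnion E) (h' : IsCliqueUnion (E ⊔ cliqueOn T)) (hT : ∀ x ∈ T, ∀ y, ¬ E.Adj x y)
    (hne : T.Nonempty) : numComp (E ⊔ cliqueOn T) + T.ncard = numComp E + 1 := by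
  have hc : ∀ x y, E.Adj x y → (x ∈ T ↔ y ∈ T) := by
    intro x y hxy
    have h1 : x ∉ T := fun hx => hT x hx y hxy
    have h2 : y ∉ T := fun hy => hT y hy x hxy.symm
    tauto
  have hc' : ∀ x y, (E ⊔ cliqueOn T).Adj x y → (x ∈ T ↔ y ∈ T) := by
    rintro x y (hxy | ⟨-, hx, hy⟩)
    · exact hc x y hxy
    · tauto
  have e1 : numCompIn E T = T.ncard := by
    rw [h.numCompIn_eq, ← Set.ncard_image_of_injective T Set.singleton_injective]
    congr 1
    have hb : ∀ x ∈ T, {y | x = y ∨ E.Adj x y} = {x} := by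
      intro x hx
      ext y
      simp [hT x hx, eq_comm]
    ext s
    constructor
    · rintro ⟨h1, x, rfl⟩
      have hx : x ∈ T := h1 (Or.inl rfl)
      exact ⟨x, hx, (hb x hx).symm⟩
    · rintro ⟨x, hx, rfl⟩
      exact ⟨Set.singleton_subset_iff.2 hx, x, (hb x hx).symm⟩
  have e2 : numCompIn (E ⊔ cliqueOn T) T = 1 := by
    rw [h'.numCompIn_eq, Set.ncard_eq_one]
    refine ⟨T, ?_⟩
    have hb : ∀ x ∈ T, {y | x = y ∨ (E ⊔ cliqueOn T).Adj x y} = T := by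
      intro x hx
      ext y
      have := hT x hx y
      simp only [sup_cliqueOn_adj, Set.mem_ofPred_eq]
      constructor
      · rintro (rfl | h1 | h1)
        · exact hx
        · exact absurd h1 this
        · exact h1.2.2
      · tauto
    ext s
    constructor
    · rintro ⟨h1, x, rfl⟩
      exact hb x (h1 (Or.inl rfl))
    · rintro rfl
      obtain ⟨x, hx⟩ := hne
      exact ⟨le_rfl, x, (hb x hx).symm⟩
  have e3 : numCompIn E Tᶜ = numCompIn (E ⊔ cliqueOn T) Tᶜ := by
    refine h.numCompIn_congr h' fun x hx y => ?_
    rw [sup_cliqueOn_adj]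
    have : x ∉ T := hx
    tauto
  rw [numComp_eq_numCompIn_univ, numComp_eq_numCompIn_univ, ← Set.union_compl_self T,
    numCompIn_union _ disjoint_compl_right fun x y hxy _ => hc x y hxy,
    numCompIn_union _ disjoint_compl_right fun x y hxy _ => hc' x y hxy]
  omega

/-! ### Graphs hinged at a vertex of degree two -/

/-- `J` has a decomposition `{E₁, E₂}`, its vertex set is the disjoint union of the sets `A ∋ u`,
`B ∋ v` and `{w}`, without edges between them, and `u`, `v` are isolated in `E₁`. -/
structure Hinge (J E₁ E₂ : SimpleGraph V) (A B : Set V) (u v w : V) : Prop where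
  decomp : IsTwoHammingDecomp J E₁ E₂
  cover : ∀ x, x ∈ A ∨ x ∈ B ∨ x = w
  disj : ∀ x, x ∈ A → x ∉ B
  notMem_left : w ∉ A
  notMem_right : w ∉ B
  mem_left : u ∈ A
  mem_right : v ∈ B
  closed : ∀ x y, J.Adj x y → (x ∈ A ∧ y ∈ A) ∨ (x ∈ B ∧ y ∈ B)
  isolated_left : ∀ y, ¬ E₁.Adj u y
  isolated_right : ∀ y, ¬ E₁.Adj v y

namespace Hinge

variable {J E₁ E₂ : SimpleGraph V} {A B : Set V} {u v w : V}

theorem closed_left (h : Hinge J E₁ E₂ A B u v w) (x y : V) (hxy : J.Adj x y) :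
    x ∈ A ↔ y ∈ A := by
  have h1 := h.closed x y hxy
  have h2 := h.disj x
  have h3 := h.disj y
  tauto

theorem closed_right (h : Hinge J E₁ E₂ A B u v w) (x y : V) (hxy : J.Adj x y) :
    x ∈ B ↔ y ∈ B := by
  have h1 := h.closed x y hxy
  have h2 := h.disj x
  have h3 := h.disj y
  tauto

theorem isolated (h : Hinge J E₁ E₂ A B u v w) (y : V) : ¬ J.Adj w y := by
  intro hw
  have h1 := h.closed w y hw
  have := h.notMem_left
  have := h.notMem_right
  tauto

theorem closed₁ (h : Hinge J E₁ E₂ A B u v w) (x y : V) (hxy : E₁.Adj x y) :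
    x ∈ B ↔ y ∈ B := h.closed_right x y ((h.decomp.adj_iff x y).2 (Or.inl hxy))

theorem closed₂ (h : Hinge J E₁ E₂ A B u v w) (x y : V) (hxy : E₂.Adj x y) :
    x ∈ B ↔ y ∈ B := h.closed_right x y ((h.decomp.adj_iff x y).2 (Or.inr hxy))

theorem left_ne (h : Hinge J E₁ E₂ A B u v w) : u ≠ w := by
  rintro rfl; exact h.notMem_left h.mem_left

theorem right_ne (h : Hinge J E₁ E₂ A B u v w) : v ≠ w := by
  rintro rfl; exact h.notMem_right h.mem_right

theorem ends_ne (h : Hinge J E₁ E₂ A B u v w) : u ≠ v := by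
  rintro rfl; exact h.disj _ h.mem_left h.mem_right

theorem flip_decomp (h : Hinge J E₁ E₂ A B u v w) :
    IsTwoHammingDecomp J (flip E₁ E₂ B) (flip E₂ E₁ B) := h.decomp.flip h.closed_right

theorem not_adj (h : Hinge J E₁ E₂ A B u v w) {x y : V} (hx : x ∈ ({u, v, w} : Set V))
    (hy : y ∈ ({u, v, w} : Set V)) : ¬ J.Adj x y := by
  have h1 : ¬ J.Adj u v := fun hJ => h.disj v ((h.closed_left _ _ hJ).1 h.mem_left) h.mem_right
  have h2 := h.isolated
  have h3 : ∀ y, ¬ J.Adj y w := fun y hy => h2 y hy.symm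
  have h4 : ¬ J.Adj v u := fun hJ => h1 hJ.symm
  rcases hx with rfl | rfl | rfl <;> rcases hy with rfl | rfl | rfl <;>
    first | exact SimpleGraph.irrefl _ | exact h1 | exact h4 | exact h3 _ | exact h2 _

theorem triangle (h : Hinge J E₁ E₂ A B u v w) :
    IsTwoHammingDecomp (J ⊔ cliqueOn {u, v, w}) (E₁ ⊔ cliqueOn {u, v, w}) E₂ := by
  refine h.decomp.sup_cliqueOn ?_ fun x hx y hy h2 =>
    h.not_adj hx hy ((h.decomp.adj_iff x y).2 (Or.inr h2))
  rintro x (rfl | rfl | rfl) y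
  · exact h.isolated_left y
  · exact h.isolated_right y
  · exact fun h1 => h.isolated y ((h.decomp.adj_iff _ y).2 (Or.inl h1))

theorem flip₁_left (h : Hinge J E₁ E₂ A B u v w) (y : V) : ¬ (flip E₁ E₂ B).Adj u y := by
  rw [flip_adj_of_notMem h.closed₁ (h.disj u h.mem_left)]
  exact h.isolated_left y

theorem flip₂_right (h : Hinge J E₁ E₂ A B u v w) (y : V) : ¬ (flip E₂ E₁ B).Adj v y := by
  rw [flip_adj_of_mem h.closed₁ h.mem_right]
  exact h.isolated_right y

/-- Exchanging the colours on `B` leaves `u` isolated in the first part and `v` isolated in the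
second, while `w` is isolated in both. Thus `uw` and `vw` can be added as components of different
parts. -/
theorem path (h : Hinge J E₁ E₂ A B u v w) :
    IsTwoHammingDecomp (J ⊔ cliqueOn {u, w} ⊔ cliqueOn {v, w})
      (flip E₁ E₂ B ⊔ cliqueOn {u, w}) (flip E₂ E₁ B ⊔ cliqueOn {v, w}) := by
  have hD := h.flip_decomp
  have hsub : ∀ x, x ∈ ({u, w} : Set V) → x ∈ ({u, v, w} : Set V) := by
    rintro x (rfl | rfl) <;> simp
  have h1 : IsTwoHammingDecomp (J ⊔ cliqueOn {u, w}) (flip E₁ E₂ B ⊔ cliqueOn {u, w})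
      (flip E₂ E₁ B) := by
    refine hD.sup_cliqueOn ?_ fun x hx y hy h2 =>
      h.not_adj (hsub x hx) (hsub y hy) ((hD.adj_iff x y).2 (Or.inr h2))
    rintro x (rfl | rfl) y h2
    · exact h.flip₁_left y h2
    · exact h.isolated y ((hD.adj_iff _ y).2 (Or.inl h2))
  refine (h1.swap.sup_cliqueOn ?_ ?_).swap
  · rintro x (rfl | rfl) y h2
    · exact h.flip₂_right y h2
    · exact h.isolated y ((hD.adj_iff _ y).2 (Or.inr h2))
  · have hv : ∀ y, y ∈ ({v, w} : Set V) → ¬ (flip E₁ E₂ B ⊔ cliqueOn {u, w}).Adj v y := by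
      intro y hy
      rw [sup_cliqueOn_adj]
      rintro (h2 | ⟨-, h2 | h2, -⟩)
      · refine h.not_adj (x := v) (y := y) (by simp) ?_ ((hD.adj_iff _ y).2 (Or.inl h2))
        rcases hy with rfl | rfl <;> simp
      · exact h.ends_ne h2.symm
      · exact h.right_ne h2
    rintro x (rfl | rfl) y hy h2
    · exact hv y hy h2
    · rcases hy with rfl | rfl
      · exact hv _ (by simp) h2.symm
      · exact SimpleGraph.irrefl _ h2

theorem numComp_eq [Finite V] (h : Hinge J E₁ E₂ A B u v w) {G : SimpleGraph V}
    (hG : IsCliqueUnion G) (hGJ : G ≤ J) : numComp G = numCompIn G A + numCompIn G B + 1 := by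
  have e : (Set.univ : Set V) = A ∪ (B ∪ {w}) := by
    ext x
    have := h.cover x
    simp only [Set.mem_univ, Set.mem_union, Set.mem_singleton_iff, this]
  have d1 : Disjoint A (B ∪ {w}) := by
    rw [Set.disjoint_left]
    rintro x hx (h1 | rfl)
    · exact h.disj x hx h1
    · exact h.notMem_left hx
  have d2 : Disjoint B {w} := by
    rw [Set.disjoint_singleton_right]
    exact h.notMem_right
  rw [numComp_eq_numCompIn_univ, e,
    numCompIn_union G d1 fun x y hxy _ => h.closed_left x y (hGJ hxy),
    numCompIn_union G d2 fun x y hxy _ => h.closed_right x y (hGJ hxy),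
    hG.numCompIn_singleton fun y hy => h.isolated y (hGJ hy)]
  ring

theorem numCompIn_flip₁_left (h : Hinge J E₁ E₂ A B u v w) :
    numCompIn (flip E₁ E₂ B) A = numCompIn E₁ A :=
  h.flip_decomp.left.numCompIn_congr h.decomp.left fun x hx _ =>
    flip_adj_of_notMem h.closed₁ (h.disj x hx)

theorem numCompIn_flip₁_right (h : Hinge J E₁ E₂ A B u v w) :
    numCompIn (flip E₁ E₂ B) B = numCompIn E₂ B :=
  h.flip_decomp.left.numCompIn_congr h.decomp.right fun _ hx _ => flip_adj_of_mem h.closed₂ hx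

theorem numCompIn_flip₂_left (h : Hinge J E₁ E₂ A B u v w) :
    numCompIn (flip E₂ E₁ B) A = numCompIn E₂ A :=
  h.flip_decomp.right.numCompIn_congr h.decomp.right fun x hx _ =>
    flip_adj_of_notMem h.closed₂ (h.disj x hx)

theorem numCompIn_flip₂_right (h : Hinge J E₁ E₂ A B u v w) :
    numCompIn (flip E₂ E₁ B) B = numCompIn E₁ B :=
  h.flip_decomp.right.numCompIn_congr h.decomp.left fun _ hx _ => flip_adj_of_mem h.closed₁ hx

/-! ### Component counts of the two graphs carried by a hinge. -/

section Count

variable [Finite V]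

theorem numComp_triangle₁ (h : Hinge J E₁ E₂ A B u v w) :
    numComp (E₁ ⊔ cliqueOn {u, v, w}) + 1 = numCompIn E₁ A + numCompIn E₁ B := by
  have h1 := h.decomp.left.numComp_sup_cliqueOn h.triangle.left ?_ ⟨u, by simp⟩
  · have h2 := h.numComp_eq h.decomp.left fun x y hxy => (h.decomp.adj_iff x y).2 (Or.inl hxy)
    have h3 : ({u, v, w} : Set V).ncard = 3 :=
      Set.ncard_eq_three.2 ⟨u, v, w, h.ends_ne, h.left_ne, h.right_ne, rfl⟩
    omega
  · rintro x (rfl | rfl | rfl) y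
    · exact h.isolated_left y
    · exact h.isolated_right y
    · exact fun h1 => h.isolated y ((h.decomp.adj_iff _ y).2 (Or.inl h1))

theorem numComp_triangle₂ (h : Hinge J E₁ E₂ A B u v w) :
    numComp E₂ = numCompIn E₂ A + numCompIn E₂ B + 1 :=
  h.numComp_eq h.decomp.right fun x y hxy => (h.decomp.adj_iff x y).2 (Or.inr hxy)

theorem numComp_path₁ (h : Hinge J E₁ E₂ A B u v w) :
    numComp (flip E₁ E₂ B ⊔ cliqueOn {u, w}) = numCompIn E₁ A + numCompIn E₂ B := by
  have hD := h.flip_decomp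
  have h1 := hD.left.numComp_sup_cliqueOn h.path.left ?_ ⟨u, by simp⟩
  · have h2 := h.numComp_eq hD.left fun x y hxy => (hD.adj_iff x y).2 (Or.inl hxy)
    rw [h.numCompIn_flip₁_left, h.numCompIn_flip₁_right] at h2
    have h3 : ({u, w} : Set V).ncard = 2 := Set.ncard_pair h.left_ne
    omega
  · rintro x (rfl | rfl) y h2
    · exact h.flip₁_left y h2
    · exact h.isolated y ((hD.adj_iff _ y).2 (Or.inl h2))

theorem numComp_path₂ (h : Hinge J E₁ E₂ A B u v w) :
    numComp (flip E₂ E₁ B ⊔ cliqueOn {v, w}) = numCompIn E₂ A + numCompIn E₁ B := by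
  have hD := h.flip_decomp
  have h1 := hD.right.numComp_sup_cliqueOn h.path.right ?_ ⟨v, by simp⟩
  · have h2 := h.numComp_eq hD.right fun x y hxy => (hD.adj_iff x y).2 (Or.inr hxy)
    rw [h.numCompIn_flip₂_left, h.numCompIn_flip₂_right] at h2
    have h3 : ({v, w} : Set V).ncard = 2 := Set.ncard_pair h.right_ne
    omega
  · rintro x (rfl | rfl) y h2
    · exact h.flip₂_right y h2
    · exact h.isolated y ((hD.adj_iff _ y).2 (Or.inr h2))

theorem numCompIn_triangle_left (h : Hinge J E₁ E₂ A B u v w) :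
    numCompIn E₁ A = numCompIn (E₁ ⊔ cliqueOn {u, v, w}) A + 1 := by
  refine h.decomp.left.numCompIn_attach h.triangle.left h.mem_left h.isolated_left h.notMem_left
    (Or.inr ⟨h.left_ne, by simp, by simp⟩) fun x hx hxu y => ?_
  have h1 : x ∉ ({u, v, w} : Set V) := by
    rintro (rfl | rfl | rfl)
    · exact hxu rfl
    · exact h.disj _ hx h.mem_right
    · exact h.notMem_left hx
  rw [sup_cliqueOn_adj_of_notMem h1]

theorem numCompIn_triangle_right (h : Hinge J E₁ E₂ A B u v w) :
    numCompIn E₁ B = numCompIn (E₁ ⊔ cliqueOn {u, v, w}) B + 1 := by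
  refine h.decomp.left.numCompIn_attach h.triangle.left h.mem_right h.isolated_right
    h.notMem_right (Or.inr ⟨h.right_ne, by simp, by simp⟩) fun x hx hxu y => ?_
  have h1 : x ∉ ({u, v, w} : Set V) := by
    rintro (rfl | rfl | rfl)
    · exact h.disj _ h.mem_left hx
    · exact hxu rfl
    · exact h.notMem_right hx
  rw [sup_cliqueOn_adj_of_notMem h1]

theorem numCompIn_path₁_left (h : Hinge J E₁ E₂ A B u v w) :
    numCompIn E₁ A = numCompIn (flip E₁ E₂ B ⊔ cliqueOn {u, w}) A + 1 := by
  rw [← h.numCompIn_flip₁_left]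
  refine h.flip_decomp.left.numCompIn_attach h.path.left h.mem_left h.flip₁_left h.notMem_left
    (Or.inr ⟨h.left_ne, by simp, by simp⟩) fun x hx hxu y => ?_
  have h1 : x ∉ ({u, w} : Set V) := by
    rintro (rfl | rfl)
    · exact hxu rfl
    · exact h.notMem_left hx
  rw [sup_cliqueOn_adj_of_notMem h1]

theorem numCompIn_path₂_right (h : Hinge J E₁ E₂ A B u v w) :
    numCompIn E₁ B = numCompIn (flip E₂ E₁ B ⊔ cliqueOn {v, w}) B + 1 := by
  rw [← h.numCompIn_flip₂_right]
  refine h.flip_decomp.right.numCompIn_attach h.path.right h.mem_right h.flip₂_right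
    h.notMem_right (Or.inr ⟨h.right_ne, by simp, by simp⟩) fun x hx hxu y => ?_
  have h1 : x ∉ ({v, w} : Set V) := by
    rintro (rfl | rfl)
    · exact hxu rfl
    · exact h.notMem_right hx
  rw [sup_cliqueOn_adj_of_notMem h1]

end Count

theorem numCompIn_path₁_right (h : Hinge J E₁ E₂ A B u v w) :
    numCompIn (flip E₁ E₂ B ⊔ cliqueOn {u, w}) B = numCompIn E₂ B := by
  rw [← h.numCompIn_flip₁_right]
  refine h.path.left.numCompIn_congr h.flip_decomp.left fun x hx y => ?_
  have h1 : x ∉ ({u, w} : Set V) := by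
    rintro (rfl | rfl)
    · exact h.disj _ h.mem_left hx
    · exact h.notMem_right hx
  rw [sup_cliqueOn_adj_of_notMem h1]

theorem numCompIn_path₂_left (h : Hinge J E₁ E₂ A B u v w) :
    numCompIn (flip E₂ E₁ B ⊔ cliqueOn {v, w}) A = numCompIn E₂ A := by
  rw [← h.numCompIn_flip₂_left]
  refine h.path.right.numCompIn_congr h.flip_decomp.right fun x hx y => ?_
  have h1 : x ∉ ({v, w} : Set V) := by
    rintro (rfl | rfl)
    · exact h.disj _ hx h.mem_right
    · exact h.notMem_left hx
  rw [sup_cliqueOn_adj_of_notMem h1]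

/-- A triangle with a vertex `w` of degree two whose removal separates the other two vertices
arises from a hinge. -/
theorem of_triangle {H F₁ F₂ : SimpleGraph V} (hF : IsTwoHammingDecomp H F₁ F₂)
    (huv : F₁.Adj u v) (huw : F₁.Adj u w) (hw : ∀ y, H.Adj w y → y = u ∨ y = v)
    (cover : ∀ x, x ∈ A ∨ x ∈ B ∨ x = w) (disj : ∀ x, x ∈ A → x ∉ B) (hwA : w ∉ A) (hwB : w ∉ B)
    (hu : u ∈ A) (hv : v ∈ B)
    (cA : ∀ x y, (H \ cliqueOn {u, v, w}).Adj x y → (x ∈ A ↔ y ∈ A))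
    (cB : ∀ x y, (H \ cliqueOn {u, v, w}).Adj x y → (x ∈ B ↔ y ∈ B)) :
    Hinge (H \ cliqueOn {u, v, w}) (F₁ \ cliqueOn {u, v, w}) F₂ A B u v w ∧
      F₁ \ cliqueOn {u, v, w} ⊔ cliqueOn {u, v, w} = F₁ ∧
      H \ cliqueOn {u, v, w} ⊔ cliqueOn {u, v, w} = H := by
  have hvw : F₁.Adj v w := hF.trans₁ huv.symm huw (fun h => hwB (h ▸ hv))
  have hle : F₁ ≤ H := fun x y h => (hF.adj_iff x y).2 (Or.inl h)
  have hcl : ∀ x ∈ ({u, v, w} : Set V), ∀ y ∈ ({u, v, w} : Set V), x ≠ y → F₁.Adj x y := by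
    rintro x (rfl | rfl | rfl) y (rfl | rfl | rfl) hne <;>
      first | exact absurd rfl hne | assumption | (apply SimpleGraph.Adj.symm; assumption)
  -- The triangle is a full component of `F₁`: any further vertex of the clique would be a third
  -- neighbour of `w`.
  have hblock : ∀ x ∈ ({u, v, w} : Set V), ∀ y, F₁.Adj x y → y ∈ ({u, v, w} : Set V) := by
    intro x hx y hxy
    by_cases hyw : y = w
    · simp [hyw]
    · have hwy : F₁.Adj w y := by
        by_cases hxw : x = w
        · exact hxw ▸ hxy
        · exact hF.trans₁ (hcl w (by simp) x hx (Ne.symm hxw)) hxy (Ne.symm hyw)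
      rcases hw y (hle hwy) with rfl | rfl <;> simp
  have hdec := hF.sdiff_cliqueOn hblock fun x hx y hy h2 => by
    by_cases hxy : x = y
    · exact h2.ne hxy
    · exact hF.not_both (hcl x hx y hy hxy) h2
  have hiso : ∀ y, ¬ (H \ cliqueOn {u, v, w}).Adj w y := by
    intro y hy
    rw [sdiff_cliqueOn_adj] at hy
    rcases hw y hy.1 with rfl | rfl <;> simp at hy
  refine ⟨⟨hdec, cover, disj, hwA, hwB, hu, hv, ?_, ?_, ?_⟩,
    sdiff_cliqueOn_sup hcl, sdiff_cliqueOn_sup fun x hx y hy hne => hle (hcl x hx y hy hne)⟩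
  · intro x y hxy
    have h1 : x ≠ w := by rintro rfl; exact hiso _ hxy
    have := cA x y hxy
    have := cB x y hxy
    have := cover x
    tauto
  · intro y hy
    rw [sdiff_cliqueOn_adj] at hy
    exact hy.2 ⟨by simp, hblock u (by simp) y hy.1⟩
  · intro y hy
    rw [sdiff_cliqueOn_adj] at hy
    exact hy.2 ⟨by simp, hblock v (by simp) y hy.1⟩

/-- An induced path `u w v` with middle vertex `w` of degree two whose removal separates its ends
arises from a hinge. -/
theorem of_path {H F₁ F₂ : SimpleGraph V} (hF : IsTwoHammingDecomp H F₁ F₂)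
    (huv : ¬ H.Adj u v) (huw : F₁.Adj u w) (hvw : F₂.Adj v w)
    (hw : ∀ y, H.Adj w y → y = u ∨ y = v)
    (cover : ∀ x, x ∈ A ∨ x ∈ B ∨ x = w) (disj : ∀ x, x ∈ A → x ∉ B) (hwA : w ∉ A) (hwB : w ∉ B)
    (hu : u ∈ A) (hv : v ∈ B)
    (cA : ∀ x y, (H \ cliqueOn {u, v, w}).Adj x y → (x ∈ A ↔ y ∈ A))
    (cB : ∀ x y, (H \ cliqueOn {u, v, w}).Adj x y → (x ∈ B ↔ y ∈ B)) :
    ∃ E₁ E₂, Hinge (H \ cliqueOn {u, v, w}) E₁ E₂ A B u v w ∧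
      flip E₁ E₂ B ⊔ cliqueOn {u, w} = F₁ ∧ flip E₂ E₁ B ⊔ cliqueOn {v, w} = F₂ := by
  have hle₁ : F₁ ≤ H := fun x y h => (hF.adj_iff x y).2 (Or.inl h)
  have hle₂ : F₂ ≤ H := fun x y h => (hF.adj_iff x y).2 (Or.inr h)
  have hne : u ≠ v := by rintro rfl; exact disj _ hu hv
  have hvu : ¬ H.Adj v u := fun h => huv h.symm
  have hw₁ : ∀ y, F₁.Adj w y → y = u := fun y hy => (hw y (hle₁ hy)).resolve_right
    (fun h => hF.not_both hy (h ▸ hvw.symm))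
  have hw₂ : ∀ y, F₂.Adj w y → y = v := fun y hy => (hw y (hle₂ hy)).resolve_left
    (fun h => hF.not_both huw.symm (h ▸ hy))
  have hw₁' : ∀ y, F₁.Adj y w → y = u := fun y hy => hw₁ y hy.symm
  have hw₂' : ∀ y, F₂.Adj y w → y = v := fun y hy => hw₂ y hy.symm
  have hpath : IsTwoHammingDecomp (H \ cliqueOn {u, v, w}) (F₁ \ cliqueOn {u, v, w})
      (F₂ \ cliqueOn {u, v, w}) := by
    -- Removing the path keeps both parts transitive: adjacent members of the triple include `w`, so
    -- a common neighbour of theirs is a neighbour of `w` and lies in the triple too.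
    have hS : ∀ x ∈ ({u, v, w} : Set V), ∀ z ∈ ({u, v, w} : Set V), H.Adj x z →
        ∀ y, H.Adj x y → H.Adj y z → y ∈ ({u, v, w} : Set V) := by
      have : ∀ y, H.Adj w y → y ∈ ({u, v, w} : Set V) := by
        intro y hy
        rcases hw y hy with rfl | rfl <;> simp
      rintro x (rfl | rfl | rfl) z (rfl | rfl | rfl) hxz y hxy hyz <;>
        first
        | exact absurd rfl hxz.ne
        | exact absurd hxz huv
        | exact absurd hxz hvu
        | exact this y hyz.symm
        | exact this y hxy
    rw [isTwoHammingDecomp_iff]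
    simp only [sdiff_cliqueOn_adj]
    refine ⟨fun x y => ?_, ?_, ?_, ?_⟩
    · rw [hF.adj_iff]
      tauto
    · exact fun x y h1 h2 => hF.not_both h1.1 h2.1
    · rintro x y z ⟨h1, n1⟩ ⟨h2, n2⟩ hxz
      have h3 := hF.trans₁ h1 h2 hxz
      refine ⟨h3, fun ⟨hx, hz⟩ => n1 ⟨hx, ?_⟩⟩
      exact hS x hx z hz (hle₁ h3) y (hle₁ h1) (hle₁ h2)
    · rintro x y z ⟨h1, n1⟩ ⟨h2, n2⟩ hxz
      have h3 := hF.trans₂ h1 h2 hxz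
      refine ⟨h3, fun ⟨hx, hz⟩ => n1 ⟨hx, ?_⟩⟩
      exact hS x hx z hz (hle₂ h3) y (hle₂ h1) (hle₂ h2)
  have hiso : ∀ y, ¬ (H \ cliqueOn {u, v, w}).Adj w y := by
    intro y hy
    rw [sdiff_cliqueOn_adj] at hy
    rcases hw y hy.1 with rfl | rfl <;> simp at hy
  have cB₁ : ∀ x y, (F₁ \ cliqueOn {u, v, w}).Adj x y → (x ∈ B ↔ y ∈ B) := fun x y h =>
    cB x y ((hpath.adj_iff x y).2 (Or.inl h))
  have cB₂ : ∀ x y, (F₂ \ cliqueOn {u, v, w}).Adj x y → (x ∈ B ↔ y ∈ B) := fun x y h =>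
    cB x y ((hpath.adj_iff x y).2 (Or.inr h))
  -- The hinge carries the colouring with `B` exchanged; exchanging `B` a second time recovers `F₁`
  -- and `F₂` off the path.
  refine ⟨_, _, ⟨hpath.flip cB, cover, disj, hwA, hwB, hu, hv, ?_, ?_, ?_⟩, ?_, ?_⟩
  · intro x y hxy
    have h1 : x ≠ w := by rintro rfl; exact hiso _ hxy
    have := cA x y hxy
    have := cB x y hxy
    have := cover x
    tauto
  · intro y
    rw [flip_adj_of_notMem cB₁ (disj u hu), sdiff_cliqueOn_adj]
    rintro ⟨h1, h2⟩
    by_cases hyw : y = w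
    · exact h2 (by simp [hyw])
    · exact h1.ne (hw₁' y (hF.trans₁ h1.symm huw hyw)).symm
  · intro y
    rw [flip_adj_of_mem cB₂ hv, sdiff_cliqueOn_adj]
    rintro ⟨h1, h2⟩
    by_cases hyw : y = w
    · exact h2 (by simp [hyw])
    · exact h1.ne (hw₂' y (hF.trans₂ h1.symm hvw hyw)).symm
  · ext x y
    rw [sup_cliqueOn_adj]
    have e : (flip (flip (F₁ \ cliqueOn {u, v, w}) (F₂ \ cliqueOn {u, v, w}) B)
        (flip (F₂ \ cliqueOn {u, v, w}) (F₁ \ cliqueOn {u, v, w}) B) B).Adj x y ↔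
        (F₁ \ cliqueOn {u, v, w}).Adj x y := by
      have := cB₁ x y
      simp only [flip_adj]
      tauto
    rw [e, sdiff_cliqueOn_adj]
    constructor
    · rintro (h1 | ⟨hxy, rfl | rfl, rfl | rfl⟩)
      · exact h1.1
      · exact absurd rfl hxy
      · exact huw
      · exact huw.symm
      · exact absurd rfl hxy
    · intro h1
      by_cases h2 : x ∈ ({u, v, w} : Set V) ∧ y ∈ ({u, v, w} : Set V)
      · right
        refine ⟨h1.ne, ?_⟩
        obtain ⟨rfl | rfl | rfl, rfl | rfl | rfl⟩ := h2 <;>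
          first
          | exact absurd rfl h1.ne
          | exact absurd (hle₁ h1) huv
          | exact absurd (hle₁ h1) hvu
          | exact absurd (hw₁ _ h1).symm hne
          | exact absurd (hw₁' _ h1).symm hne
          | simp
      · exact Or.inl ⟨h1, h2⟩
  · ext x y
    rw [sup_cliqueOn_adj]
    have e : (flip (flip (F₂ \ cliqueOn {u, v, w}) (F₁ \ cliqueOn {u, v, w}) B)
        (flip (F₁ \ cliqueOn {u, v, w}) (F₂ \ cliqueOn {u, v, w}) B) B).Adj x y ↔
        (F₂ \ cliqueOn {u, v, w}).Adj x y := by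
      have := cB₂ x y
      simp only [flip_adj]
      tauto
    rw [e, sdiff_cliqueOn_adj]
    constructor
    · rintro (h1 | ⟨hxy, rfl | rfl, rfl | rfl⟩)
      · exact h1.1
      · exact absurd rfl hxy
      · exact hvw
      · exact hvw.symm
      · exact absurd rfl hxy
    · intro h1
      by_cases h2 : x ∈ ({u, v, w} : Set V) ∧ y ∈ ({u, v, w} : Set V)
      · right
        refine ⟨h1.ne, ?_⟩
        obtain ⟨rfl | rfl | rfl, rfl | rfl | rfl⟩ := h2 <;>
          first
          | exact absurd rfl h1.ne
          | exact absurd (hle₂ h1) huv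
          | exact absurd (hle₂ h1) hvu
          | exact absurd (hw₂ _ h1) hne
          | exact absurd (hw₂' _ h1) hne
          | simp
      · exact Or.inl ⟨h1, h2⟩

end Hinge

/-! ### Blocks of a decomposition -/

/-- `S` is complete in `F` and no edge of `F` leaves `S`. -/
def IsBlock (F : SimpleGraph V) (S : Set V) : Prop :=
  ∀ x ∈ S, ∀ y, F.Adj x y ↔ y ∈ S ∧ x ≠ y

theorem IsBlock.supp_eq {F : SimpleGraph V} {S : Set V} (h : IsBlock F S) {u : V} (hu : u ∈ S) :
    (F.connectedComponentMk u).supp = S := by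
  ext x
  rw [SimpleGraph.ConnectedComponent.mem_supp_iff, SimpleGraph.ConnectedComponent.eq]
  constructor
  · intro hr
    obtain ⟨p⟩ := hr.symm
    induction p with
    | nil => exact hu
    | cons hab q ih => exact ih ((h _ hu _).1 hab).1 q.reachable.symm
  · intro hx
    by_cases hxu : x = u
    · rw [hxu]
    · exact ((h x hx u).2 ⟨hu, hxu⟩).reachable

theorem IsCliqueUnion.isBlock_supp {F : SimpleGraph V} (h : IsCliqueUnion F)
    (K : F.ConnectedComponent) : IsBlock F K.supp := by
  intro x hx y
  rw [SimpleGraph.ConnectedComponent.mem_supp_iff] at hx ⊢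
  subst hx
  rw [SimpleGraph.ConnectedComponent.eq, SimpleGraph.reachable_comm, h.reachable_iff]
  constructor
  · exact fun hxy => ⟨Or.inr hxy, hxy.ne⟩
  · tauto

theorem deleteEdges_sym2 {G : SimpleGraph V} {S : Set V} :
    G.deleteEdges S.sym2 = G \ cliqueOn S := by
  ext x y
  rw [SimpleGraph.deleteEdges_adj, sdiff_cliqueOn_adj, Set.mk_mem_sym2_iff]

/-- A walk into `S`, cut at its first vertex in `S`, uses no edge inside `S`. -/
theorem exists_reachable_sdiff_cliqueOn {H : SimpleGraph V} (hH : H.Connected) {S : Set V}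
    (hS : S.Nonempty) (x : V) : ∃ t ∈ S, (H \ cliqueOn S).Reachable x t := by
  obtain ⟨s, hs⟩ := hS
  obtain ⟨p⟩ := hH.preconnected x s
  induction p with
  | nil => exact ⟨_, hs, SimpleGraph.Reachable.refl _⟩
  | @cons a b c hab q ih =>
    by_cases ha : a ∈ S
    · exact ⟨a, ha, SimpleGraph.Reachable.refl _⟩
    · obtain ⟨t, ht, hbt⟩ := ih hs
      have : (H \ cliqueOn S).Adj a b := sdiff_cliqueOn_adj.2 ⟨hab, fun h => ha h.1⟩
      exact ⟨t, ht, this.reachable.trans hbt⟩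

theorem exists_adj_of_reachable_ne {G : SimpleGraph V} {u v : V} (h : G.Reachable u v)
    (hne : u ≠ v) : ∃ x, G.Adj u x := by
  obtain ⟨p⟩ := h
  cases p with
  | nil => exact absurd rfl hne
  | cons h _ => exact ⟨_, h⟩

theorem eq_of_reachable_of_isolated {G : SimpleGraph V} {w x : V} (h : G.Reachable w x)
    (hw : ∀ y, ¬ G.Adj w y) : x = w := by
  by_contra hne
  obtain ⟨y, hy⟩ := exists_adj_of_reachable_ne h (Ne.symm hne)
  exact hw y hy

namespace IsTwoHammingDecomp

variable {H F₁ F₂ : SimpleGraph V}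

theorem le₁ (h : IsTwoHammingDecomp H F₁ F₂) : F₁ ≤ H :=
  fun x y hxy => (h.adj_iff x y).2 (Or.inl hxy)

theorem le₂ (h : IsTwoHammingDecomp H F₁ F₂) : F₂ ≤ H :=
  fun x y hxy => (h.adj_iff x y).2 (Or.inr hxy)

theorem adj₂_of_sdiff (h : IsTwoHammingDecomp H F₁ F₂) {S : Set V} (hS : IsBlock F₁ S) {x y : V}
    (hx : x ∈ S) (hxy : (H \ cliqueOn S).Adj x y) : F₂.Adj x y ∧ y ∉ S := by
  rw [sdiff_cliqueOn_adj] at hxy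
  have hy : y ∉ S := fun hy => hxy.2 ⟨hx, hy⟩
  exact ⟨((h.adj_iff x y).1 hxy.1).resolve_left fun h1 => hy ((hS x hx y).1 h1).1, hy⟩

/-- Two vertices of a block have no common neighbour outside it. -/
theorem not_ends_mem (h : IsTwoHammingDecomp H F₁ F₂) {S : Set V} (hS : IsBlock F₁ S) {a b c : V}
    (hab : (H \ cliqueOn S).Adj a b) (hbc : (H \ cliqueOn S).Adj b c) (hne : a ≠ c) :
    ¬ (a ∈ S ∧ c ∈ S) := by
  rintro ⟨ha, hc⟩
  have h1 := (h.adj₂_of_sdiff hS ha hab).1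
  have h2 := (h.adj₂_of_sdiff hS hc hbc.symm).1
  exact h.not_both ((hS a ha c).2 ⟨hc, hne⟩) (h.trans₂ h1 h2.symm hne)

theorem isBlock_triple (h : IsTwoHammingDecomp H F₁ F₂) {u v w : V} (huv : F₁.Adj u v)
    (huw : F₁.Adj u w) (hvw : v ≠ w) (hu : ∀ y, F₁.Adj u y → y = v ∨ y = w) :
    IsBlock F₁ {u, v, w} := by
  have h1 := h.trans₁ huv.symm huw hvw
  have hv : ∀ y, F₁.Adj v y → y = u ∨ y = w := fun y hy => by
    by_cases hyu : y = u
    · exact Or.inl hyu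
    · exact Or.inr ((hu y (h.trans₁ huv hy (Ne.symm hyu))).resolve_left hy.ne')
  have hw : ∀ y, F₁.Adj w y → y = u ∨ y = v := fun y hy => by
    by_cases hyu : y = u
    · exact Or.inl hyu
    · exact Or.inr ((hu y (h.trans₁ huw hy (Ne.symm hyu))).resolve_right hy.ne')
  rintro x hx y
  constructor
  · intro hxy
    refine ⟨?_, hxy.ne⟩
    rcases hx with rfl | rfl | rfl
    · rcases hu y hxy with rfl | rfl <;> simp
    · rcases hv y hxy with rfl | rfl <;> simp
    · rcases hw y hxy with rfl | rfl <;> simp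
  · rintro ⟨hy, hne⟩
    rcases hx with rfl | rfl | rfl <;> rcases hy with rfl | rfl | rfl <;>
      first | exact absurd rfl hne | assumption | (apply SimpleGraph.Adj.symm; assumption)

/-- If a triangle is a component of `F₁`, its vertex `w` has degree two, and `u`, `v` remain
connected without the triangle, then deleting `uv` leaves the class of 2-Hamming graphs. -/
theorem false_of_triangle_reachable (h : IsTwoHammingDecomp H F₁ F₂) {u v w : V}
    (hS : IsBlock F₁ {u, v, w}) (huv : u ≠ v) (huw : w ≠ u) (hvw : w ≠ v)
    (hw : ∀ y, H.Adj w y → y = u ∨ y = v) (hr : (H \ cliqueOn {u, v, w}).Reachable u v)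
    {D₁ D₂ : SimpleGraph V} (hD : IsTwoHammingDecomp (H.deleteEdges {s(u, v)}) D₁ D₂) : False := by
  have hu1 : u ∈ ({u, v, w} : Set V) := by simp
  have hv1 : v ∈ ({u, v, w} : Set V) := by simp
  have hw1 : w ∈ ({u, v, w} : Set V) := by simp
  have hJ0 : H \ cliqueOn {u, v, w} ≤ H.deleteEdges {s(u, v)} := by
    intro x y hxy
    rw [sdiff_cliqueOn_adj] at hxy
    rw [deleteEdges_pair_adj]
    refine ⟨hxy.1, ?_⟩
    rintro (⟨rfl, rfl⟩ | ⟨rfl, rfl⟩)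
    · exact hxy.2 ⟨hu1, hv1⟩
    · exact hxy.2 ⟨hv1, hu1⟩
  obtain ⟨x, hx⟩ := exists_adj_of_reachable_ne hr huv
  obtain ⟨y, hy⟩ := exists_adj_of_reachable_ne hr.symm huv.symm
  -- Off the triangle, `H` and `H - uv` agree on the ends of every path of length two: these ends
  -- are never `u` and `v`, by `not_ends_mem`.
  have key := h.colour_transfer hD sdiff_le hJ0 (fun a b c hab hbc hac => by
    have := h.not_ends_mem hS hab hbc hac
    rw [deleteEdges_pair_adj]
    constructor
    · intro h1
      refine ⟨h1, ?_⟩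
      rintro (⟨rfl, rfl⟩ | ⟨rfl, rfl⟩)
      · exact this ⟨hu1, hv1⟩
      · exact this ⟨hv1, hu1⟩
    · exact fun h1 => h1.1) hr hx hy
  have fx := h.adj₂_of_sdiff hS hu1 hx
  have fy := h.adj₂_of_sdiff hS hv1 hy
  have fx' : ¬ F₁.Adj u x := fun h1 => h.not_both h1 fx.1
  have fy' : ¬ F₁.Adj v y := fun h1 => h.not_both h1 fy.1
  have huw' : (H.deleteEdges {s(u, v)}).Adj u w := by
    rw [deleteEdges_pair_adj]
    exact ⟨h.le₁ ((hS u hu1 w).2 ⟨hw1, huw.symm⟩), by tauto⟩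
  have hvw' : (H.deleteEdges {s(u, v)}).Adj v w := by
    rw [deleteEdges_pair_adj]
    exact ⟨h.le₁ ((hS v hv1 w).2 ⟨hw1, hvw.symm⟩), by tauto⟩
  have hxw : ¬ (H.deleteEdges {s(u, v)}).Adj w x := by
    rw [deleteEdges_pair_adj]
    rintro ⟨h1, -⟩
    rcases hw x h1 with rfl | rfl
    · exact fx.2 (by simp)
    · exact fx.2 (by simp)
  have hyw : ¬ (H.deleteEdges {s(u, v)}).Adj w y := by
    rw [deleteEdges_pair_adj]
    rintro ⟨h1, -⟩
    rcases hw y h1 with rfl | rfl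
    · exact fy.2 (by simp)
    · exact fy.2 (by simp)
  have nuv : ¬ (H.deleteEdges {s(u, v)}).Adj u v := by simp
  -- In the decomposition `D` the colour changes from `xu` to `uw`, from `uw` to `wv`, and from `wv`
  -- to `vy`. Three changes give `ux` and `vy` different colours, but both lie in `F₂`, so `key`
  -- makes their colours equal.
  have e1 := hD.adj_iff_same huw'.symm (hJ0 hx) (fun h => fx.2 (by simp [← h]))
  have e2 := hD.adj_iff_same hvw'.symm (hJ0 hy) (fun h => fy.2 (by simp [← h]))
  have e3 := hD.adj_iff_same huw' hvw'.symm huv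
  rw [D₁.adj_comm w u] at e1
  tauto

/-- A triangle with a vertex `w` of degree two whose removal disconnects the other two vertices
is a hinge triangle. -/
theorem exists_hinge (hH : H.Connected) (h : IsTwoHammingDecomp H F₁ F₂) {u v w : V}
    (huv : F₁.Adj u v) (huw : F₁.Adj u w) (hwv : w ≠ v) (hw : ∀ y, H.Adj w y → y = u ∨ y = v)
    (hnr : ¬ (H \ cliqueOn {u, v, w}).Reachable u v) : ∃ A B,
      Hinge (H \ cliqueOn {u, v, w}) (F₁ \ cliqueOn {u, v, w}) F₂ A B u v w ∧
      F₁ \ cliqueOn {u, v, w} ⊔ cliqueOn {u, v, w} = F₁ ∧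
      H \ cliqueOn {u, v, w} ⊔ cliqueOn {u, v, w} = H := by
  have hiso : ∀ y, ¬ (H \ cliqueOn {u, v, w}).Adj w y := by
    intro y hy
    rw [sdiff_cliqueOn_adj] at hy
    rcases hw y hy.1 with rfl | rfl <;> simp at hy
  refine ⟨{x | (H \ cliqueOn {u, v, w}).Reachable u x},
    {x | (H \ cliqueOn {u, v, w}).Reachable v x}, Hinge.of_triangle h huv huw hw ?_ ?_ ?_ ?_
    (SimpleGraph.Reachable.refl _) (SimpleGraph.Reachable.refl _) ?_ ?_⟩
  · intro x
    obtain ⟨t, rfl | rfl | rfl, ht⟩ :=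
      exists_reachable_sdiff_cliqueOn hH (S := {u, v, w}) ⟨u, by simp⟩ x
    · exact Or.inl ht.symm
    · exact Or.inr (Or.inl ht.symm)
    · exact Or.inr (Or.inr (eq_of_reachable_of_isolated ht.symm hiso))
  · exact fun x hx hx' => hnr (SimpleGraph.Reachable.trans hx (SimpleGraph.Reachable.symm hx'))
  · exact fun hx => huw.ne (eq_of_reachable_of_isolated (SimpleGraph.Reachable.symm hx) hiso)
  · exact fun hx => (h.trans₁ huv.symm huw hwv.symm).ne (eq_of_reachable_of_isolated (SimpleGraph.Reachable.symm hx) hiso)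
  · exact fun x y hxy => ⟨fun hx => SimpleGraph.Reachable.trans hx hxy.reachable,
      fun hx => SimpleGraph.Reachable.trans hx hxy.symm.reachable⟩
  · exact fun x y hxy => ⟨fun hx => SimpleGraph.Reachable.trans hx hxy.reachable,
      fun hx => SimpleGraph.Reachable.trans hx hxy.symm.reachable⟩

/-- If deleting an edge of `F₁` from a connected 2-Hamming graph gives a 2-Hamming graph, then
the edge is a component of `F₁` or lies in a hinge triangle. -/
theorem pendant_or_hinge (hH : H.Connected) (h : IsTwoHammingDecomp H F₁ F₂) {u v : V}
    (huv : F₁.Adj u v) {D₁ D₂ : SimpleGraph V}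
    (hD : IsTwoHammingDecomp (H.deleteEdges {s(u, v)}) D₁ D₂) :
    (∀ y, F₁.Adj u y → y = v) ∨ ∃ w A B,
      (∀ y, H.Adj w y → y = u ∨ y = v) ∧
      Hinge (H \ cliqueOn {u, v, w}) (F₁ \ cliqueOn {u, v, w}) F₂ A B u v w ∧
      F₁ \ cliqueOn {u, v, w} ⊔ cliqueOn {u, v, w} = F₁ ∧
      H \ cliqueOn {u, v, w} ⊔ cliqueOn {u, v, w} = H := by
  by_cases hy : ∀ y, F₁.Adj u y → y = v
  · exact Or.inl hy
  push Not at hy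
  obtain ⟨w, huw, hwv⟩ := hy
  right
  have hvw := h.trans₁ huv.symm huw hwv.symm
  have nuv : ¬ (H.deleteEdges {s(u, v)}).Adj u v := by simp
  have hadj : ∀ {x y}, H.Adj x y → x ≠ u → x ≠ v → (H.deleteEdges {s(u, v)}).Adj x y := by
    intro x y hxy h1 h2
    rw [deleteEdges_pair_adj]
    exact ⟨hxy, by tauto⟩
  -- A fourth vertex of the clique would leave an induced diamond after deleting `uv`.
  have hu : ∀ y, F₁.Adj u y → y = v ∨ y = w := by
    intro y hy
    by_contra hne
    push Not at hne
    exact hD.no_diamond (hadj (h.le₁ huw).symm huw.ne' hwv).symm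
      (hadj (h.le₁ hy).symm hy.ne' hne.1).symm (hadj (h.le₁ hvw).symm huw.ne' hwv).symm
      (hadj (h.le₁ (h.trans₁ huv.symm hy hne.1.symm)).symm hy.ne' hne.1).symm
      (hadj (h.le₁ (h.trans₁ huw.symm hy hne.2.symm)) huw.ne' hwv) huv.ne nuv
  have hS := h.isBlock_triple huv huw hwv.symm hu
  have hw1 : w ∈ ({u, v, w} : Set V) := by simp
  -- A further neighbour of `w` would lie in `F₂` and form an induced claw at `w` with `u` and `v`.
  have hw : ∀ y, H.Adj w y → y = u ∨ y = v := by
    intro y hy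
    by_contra hne
    push Not at hne
    have hyS : y ∉ ({u, v, w} : Set V) := by
      rintro (rfl | rfl | rfl)
      · exact hne.1 rfl
      · exact hne.2 rfl
      · exact hy.ne rfl
    have h2 : F₂.Adj w y := ((h.adj_iff w y).1 hy).resolve_left fun h1 => hyS ((hS w hw1 y).1 h1).1
    have key : ∀ z, F₁.Adj z w → ¬ H.Adj z y := by
      intro z hz hzy
      have hzS : z ∈ ({u, v, w} : Set V) := ((hS w hw1 z).1 hz.symm).1
      rcases (h.adj_iff z y).1 hzy with h3 | h3
      · exact hyS ((hS z hzS y).1 h3).1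
      · exact h.not_both hz (h.trans₂ h3 h2.symm hz.ne)
    refine hD.no_claw (hadj (h.le₁ huw).symm huw.ne' hwv) (hadj (h.le₁ hvw).symm huw.ne' hwv)
      (hadj hy huw.ne' hwv) huv.ne hne.1.symm hne.2.symm nuv ?_ ?_
    · rw [deleteEdges_pair_adj]
      exact fun h3 => key u huw h3.1
    · rw [deleteEdges_pair_adj]
      exact fun h3 => key v hvw h3.1
  have hnr : ¬ (H \ cliqueOn {u, v, w}).Reachable u v := fun hr =>
    h.false_of_triangle_reachable hS huv.ne huw.ne' hwv hw hr hD
  obtain ⟨A, B, hAB⟩ := h.exists_hinge hH huv huw hwv hw hnr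
  exact ⟨w, A, B, hw, hAB⟩

end IsTwoHammingDecomp

/-- The two graphs carried by a hinge differ in the edge joining its ends. -/
theorem sdiff_cliqueOn_sup_path {H : SimpleGraph V} {u v w : V} (huw : H.Adj u w)
    (hvw : H.Adj v w) :
    H \ cliqueOn {u, v, w} ⊔ cliqueOn {u, w} ⊔ cliqueOn {v, w} = H.deleteEdges {s(u, v)} := by
  ext x y
  rw [sup_cliqueOn_adj, sup_cliqueOn_adj, sdiff_cliqueOn_adj, deleteEdges_pair_adj]
  simp only [Set.mem_insert_iff, Set.mem_singleton_iff]
  have h1 := huw.ne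
  have h2 := hvw.ne
  constructor
  · rintro ((h | ⟨hne, rfl | rfl, rfl | rfl⟩) | ⟨hne, rfl | rfl, rfl | rfl⟩)
    · tauto
    · exact absurd rfl hne
    · exact ⟨huw, by tauto⟩
    · exact ⟨huw.symm, by tauto⟩
    · exact absurd rfl hne
    · exact absurd rfl hne
    · exact ⟨hvw, by tauto⟩
    · exact ⟨hvw.symm, by tauto⟩
    · exact absurd rfl hne
  · rintro ⟨h, hn⟩
    have := h.ne
    by_cases hS : (x = u ∨ x = v ∨ x = w) ∧ (y = u ∨ y = v ∨ y = w)
    · obtain ⟨rfl | rfl | rfl, rfl | rfl | rfl⟩ := hS <;> simp_all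
    · exact Or.inl (Or.inl ⟨h, hS⟩)

/-! ### Chipped graphs -/

theorem three_le_deg_iff [Finite V] {H F₁ F₂ : SimpleGraph V} (h : IsTwoHammingDecomp H F₁ F₂)
    {u v w : V} (hS : IsBlock F₁ {u, v, w}) (huv : u ≠ v) (huw : w ≠ u) (hvw : w ≠ v) :
    3 ≤ deg H w ↔ ∃ y, F₂.Adj w y := by
  have hw1 : w ∈ ({u, v, w} : Set V) := by simp
  constructor
  · intro h3
    by_contra hne
    push Not at hne
    have hsub : H.neighborSet w ⊆ {u, v} := by
      intro y hy
      have := ((h.adj_iff w y).1 hy).resolve_right (hne y)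
      obtain ⟨rfl | rfl | rfl, h2⟩ := (hS w hw1 y).1 this
      · simp
      · simp
      · exact absurd rfl h2
    have := Set.ncard_le_ncard hsub
    rw [Set.ncard_pair huv] at this
    have h3' : 3 ≤ (H.neighborSet w).ncard := h3
    omega
  · rintro ⟨y, hy⟩
    have hyS : y ∉ ({u, v, w} : Set V) := fun hyS =>
      h.not_both ((hS w hw1 y).2 ⟨hyS, hy.ne⟩) hy
    simp only [Set.mem_insert_iff, Set.mem_singleton_iff, not_or] at hyS
    have e : ({u, v, y} : Set V).ncard = 3 :=
      Set.ncard_eq_three.2 ⟨u, v, y, huv, Ne.symm hyS.1, Ne.symm hyS.2.1, rfl⟩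
    rw [deg, ← e]
    refine Set.ncard_le_ncard ?_
    rintro z (rfl | rfl | rfl)
    · exact h.le₁ ((hS w hw1 z).2 ⟨by simp, huw⟩)
    · exact h.le₁ ((hS w hw1 z).2 ⟨by simp, hvw⟩)
    · exact h.le₂ hy

/-- The three types of chipped graphs, in terms of adjacency and reachability. -/
theorem chipped_iff_exists_block [Finite V] {H : SimpleGraph V} : Chipped H ↔
    ∃ (H' F₁ F₂ : SimpleGraph V) (u v : V) (S : Set V), H'.Connected ∧
      IsTwoHammingDecomp H' F₁ F₂ ∧ F₁.Adj u v ∧ H = H'.deleteEdges {s(u, v)} ∧ u ∈ S ∧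
      IsBlock F₁ S ∧
      ((∃ w, w ≠ u ∧ w ≠ v ∧ S = {u, v, w} ∧ ∃ y, F₂.Adj w y) ∨
       (∃ w, w ≠ u ∧ w ≠ v ∧ S = {u, v, w} ∧ (∀ y, H'.Adj w y → y = u ∨ y = v) ∧
          (H' \ cliqueOn S).Reachable u v) ∨
       (∃ w x, w ≠ u ∧ w ≠ v ∧ x ≠ u ∧ x ≠ v ∧ x ≠ w ∧ S = {u, v, w, x} ∧
          (∀ y, H'.Adj w y → y ∈ S) ∧ ∀ t ∈ S, (H' \ cliqueOn S).Reachable u t → t = u)) := by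
  constructor
  · rintro ⟨H', F₁, F₂, u, v, K, hc, -, hd, huv, rfl, hu, hv, ht⟩
    have hS := hd.left.isBlock_supp K
    have huv1 : F₁.Adj u v := (hS u hu v).2 ⟨hv, huv.ne⟩
    refine ⟨H', F₁, F₂, u, v, K.supp, hc, hd, huv1, rfl, hu, hS, ?_⟩
    rw [deleteEdges_sym2] at ht
    generalize K.supp = S at *
    rcases ht with ⟨w, hwu, hwv, rfl, hdeg⟩ | ⟨w, hwu, hwv, rfl, hn, C, hC⟩ |
      ⟨w, x, hwu, hwv, hxu, hxv, hxw, rfl, hdeg, C, hC⟩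
    · exact Or.inl ⟨w, hwu, hwv, rfl, (three_le_deg_iff hd hS huv.ne hwu hwv).1 hdeg⟩
    · refine Or.inr (Or.inl ⟨w, hwu, hwv, rfl, ?_, ?_⟩)
      · intro y hy
        by_contra hne
        have hne' := not_or.1 hne
        have hJ : (H' \ cliqueOn {u, v, w}).Adj w y := by
          rw [sdiff_cliqueOn_adj]
          refine ⟨hy, fun h => ?_⟩
          rcases h.2 with rfl | rfl | rfl
          · exact hne (Or.inl rfl)
          · exact hne (Or.inr rfl)
          · exact hy.ne rfl
        have hw : w ∈ C.supp := by rw [hC]; rfl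
        have hy' : y ∈ C.supp := by
          rw [SimpleGraph.ConnectedComponent.mem_supp_iff] at hw ⊢
          rw [← hw]
          exact SimpleGraph.ConnectedComponent.sound hJ.symm.reachable
        rw [hC] at hy'
        exact hy.ne hy'.symm
      -- With only one component besides `{w}`, both `u` and `v` must lie in it.
      · obtain ⟨D, -, hD⟩ := (Nat.card_eq_two_iff' C).1 hn
        have hne : ∀ z, z ≠ w → (H' \ cliqueOn {u, v, w}).connectedComponentMk z = D := by
          intro z hz
          apply hD
          intro hzC
          have : z ∈ C.supp := hzC
          rw [hC] at this
          exact hz this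
        exact SimpleGraph.ConnectedComponent.exact ((hne u hwu.symm).trans (hne v hwv.symm).symm)
    · refine Or.inr (Or.inr ⟨w, x, hwu, hwv, hxu, hxv, hxw, rfl, ?_, ?_⟩)
      · have e : ({u, v, x} : Set V).ncard = 3 :=
          Set.ncard_eq_three.2 ⟨u, v, x, huv.ne, hxu.symm, hxv.symm, rfl⟩
        have hsub : ({u, v, x} : Set V) ⊆ H'.neighborSet w := by
          rintro z (rfl | rfl | rfl)
          · exact hd.le₁ ((hS w (by simp) z).2 ⟨by simp, hwu⟩)
          · exact hd.le₁ ((hS w (by simp) z).2 ⟨by simp, hwv⟩)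
          · exact hd.le₁ ((hS w (by simp) z).2 ⟨by simp, hxw.symm⟩)
        have heq := Set.eq_of_subset_of_ncard_le hsub (by rw [e]; exact hdeg.le)
        intro y hy
        have : y ∈ ({u, v, x} : Set V) := by
          rw [heq]
          exact hy
        rcases this with rfl | rfl | rfl <;> simp
      · intro t ht hr
        have huC : u ∈ C.supp := (hC.symm ▸ rfl : u ∈ ({u, v, w, x} : Set V) ∩ C.supp).2
        have htC : t ∈ ({u, v, w, x} : Set V) ∩ C.supp := by
          refine ⟨ht, ?_⟩
          rw [SimpleGraph.ConnectedComponent.mem_supp_iff] at huC ⊢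
          rw [← huC]
          exact SimpleGraph.ConnectedComponent.sound hr.symm
        rw [hC] at htC
        exact htC
  · rintro ⟨H', F₁, F₂, u, v, S, hc, hd, huv, rfl, hu, hS, ht⟩
    have hv : v ∈ S := ((hS u hu v).1 huv).1
    refine ⟨H', F₁, F₂, u, v, F₁.connectedComponentMk u, hc, hd.twoHamming, hd, hd.le₁ huv, rfl,
      ?_⟩
    rw [hS.supp_eq hu, deleteEdges_sym2]
    refine ⟨hu, hv, ?_⟩
    rcases ht with ⟨w, hwu, hwv, rfl, hy⟩ | ⟨w, hwu, hwv, rfl, hw, hr⟩ |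
      ⟨w, x, hwu, hwv, hxu, hxv, hxw, rfl, hw, hr⟩
    · exact Or.inl ⟨w, hwu, hwv, rfl, (three_le_deg_iff hd hS huv.ne hwu hwv).2 hy⟩
    · refine Or.inr (Or.inl ⟨w, hwu, hwv, rfl, ?_, ?_⟩)
      all_goals
        have hiso : ∀ y, ¬ (H' \ cliqueOn {u, v, w}).Adj w y := by
          intro y hy
          rw [sdiff_cliqueOn_adj] at hy
          rcases hw y hy.1 with rfl | rfl <;> simp at hy
      · rw [numComp,
          Nat.card_eq_two_iff' ((H' \ cliqueOn {u, v, w}).connectedComponentMk w)]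
        refine ⟨(H' \ cliqueOn {u, v, w}).connectedComponentMk u, ?_, ?_⟩
        · intro h
          exact hwu.symm (eq_of_reachable_of_isolated (SimpleGraph.ConnectedComponent.exact h).symm
            hiso)
        · intro D hD
          obtain ⟨z, rfl⟩ : ∃ z, (H' \ cliqueOn {u, v, w}).connectedComponentMk z = D :=
            D.exists_rep
          obtain ⟨t, rfl | rfl | rfl, ht⟩ := exists_reachable_sdiff_cliqueOn hc ⟨u, hu⟩ z
          · exact SimpleGraph.ConnectedComponent.sound ht
          · exact SimpleGraph.ConnectedComponent.sound (ht.trans hr.symm)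
          · exact absurd (SimpleGraph.ConnectedComponent.sound ht) hD
      · refine ⟨(H' \ cliqueOn {u, v, w}).connectedComponentMk w, ?_⟩
        ext y
        rw [SimpleGraph.ConnectedComponent.mem_supp_iff, SimpleGraph.ConnectedComponent.eq]
        constructor
        · exact fun h => eq_of_reachable_of_isolated h.symm hiso
        · rintro rfl
          rfl
    · refine Or.inr (Or.inr ⟨w, x, hwu, hwv, hxu, hxv, hxw, rfl, ?_,
        (H' \ cliqueOn {u, v, w, x}).connectedComponentMk u, ?_⟩)
      · have e : ({u, v, x} : Set V).ncard = 3 :=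
          Set.ncard_eq_three.2 ⟨u, v, x, huv.ne, hxu.symm, hxv.symm, rfl⟩
        rw [deg, ← e]
        congr 1
        ext y
        constructor
        · intro hy
          rcases hw y hy with rfl | rfl | rfl | rfl
          · simp
          · simp
          · exact absurd rfl hy.ne
          · simp
        · rintro (rfl | rfl | rfl)
          · exact hd.le₁ ((hS w (by simp) y).2 ⟨by simp, hwu⟩)
          · exact hd.le₁ ((hS w (by simp) y).2 ⟨by simp, hwv⟩)
          · exact hd.le₁ ((hS w (by simp) y).2 ⟨by simp, hxw.symm⟩)
      · ext t
        constructor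
        · rintro ⟨ht, htC⟩
          exact hr t ht (SimpleGraph.ConnectedComponent.exact htC).symm
        · rintro rfl
          exact ⟨hu, rfl⟩

/-- Each type contradicts `pendant_or_hinge` or `false_of_triangle_reachable`: the apex has an
`F₂`-neighbour, or the other two vertices stay connected without the triangle, or the component has
a fourth vertex. -/
theorem not_twoHamming_of_chipped [Finite V] {H : SimpleGraph V} (h : Chipped H) :
    ¬ TwoHamming H := by
  rw [twoHamming_iff]
  rintro ⟨D₁, D₂, hD⟩
  obtain ⟨H', F₁, F₂, u, v, S, hc, hd, huv, rfl, hu, hS, ht⟩ := chipped_iff_exists_block.1 h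
  rcases ht with ⟨w, hwu, hwv, rfl, y, hy⟩ | ⟨w, hwu, hwv, rfl, hw, hr⟩ |
      ⟨w, x, hwu, hwv, hxu, hxv, hxw, rfl, hw, hr⟩
  · rcases hd.pendant_or_hinge hc huv hD with h1 | ⟨w', A, B, hw', h1, -, -⟩
    · exact hwv (h1 w ((hS u hu w).2 ⟨by simp, hwu.symm⟩))
    · have huw : F₁.Adj u w := (hS u hu w).2 ⟨by simp, hwu.symm⟩
      -- In a hinge `u` has no `F₁`-neighbour outside the triangle, which identifies its apex.
      have hww : w' = w := by
        by_contra hne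
        have : ¬ (F₁ \ cliqueOn {u, v, w'}).Adj u w := h1.isolated_left w
        rw [sdiff_cliqueOn_adj] at this
        exact this ⟨huw, by
          simp only [Set.mem_insert_iff, Set.mem_singleton_iff, not_and]
          tauto⟩
      subst hww
      rcases hw' y (hd.le₂ hy) with rfl | rfl
      · exact hd.not_both huw.symm hy
      · exact hd.not_both ((hS w' (by simp) y).2 ⟨by simp, hwv⟩) hy
  · exact hd.false_of_triangle_reachable hS huv.ne hwu hwv hw hr hD
  · rcases hd.pendant_or_hinge hc huv hD with h1 | ⟨w', A, B, hw', h1, -, -⟩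
    · exact hwv (h1 w ((hS u hu w).2 ⟨by simp, hwu.symm⟩))
    · have e : ∀ z ∈ ({u, v, w, x} : Set V), z ≠ u → z ≠ v → z = w' := by
        intro z hz hzu hzv
        by_contra hne
        have : ¬ (F₁ \ cliqueOn {u, v, w'}).Adj u z := h1.isolated_left z
        rw [sdiff_cliqueOn_adj] at this
        exact this ⟨(hS u hu z).2 ⟨hz, hzu.symm⟩, by
          simp only [Set.mem_insert_iff, Set.mem_singleton_iff, not_and]
          tauto⟩
      exact hxw ((e x (by simp) hxu hxv).trans (e w (by simp) hwu hwv).symm)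

/-- Isolating a vertex in `F₁` turns a decomposition into a decomposition of a smaller graph. -/
theorem IsTwoHammingDecomp.deleteIncidenceSet {H F₁ F₂ : SimpleGraph V}
    (h : IsTwoHammingDecomp H F₁ F₂) (u : V) :
    IsTwoHammingDecomp (F₁.deleteIncidenceSet u ⊔ F₂) (F₁.deleteIncidenceSet u) F₂ := by
  rw [isTwoHammingDecomp_iff]
  refine ⟨fun x y => Iff.rfl, fun x y => ?_, fun x y z => ?_, fun _ _ _ => h.trans₂⟩
  · rw [SimpleGraph.deleteIncidenceSet_adj]
    exact fun h1 => h.not_both h1.1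
  · simp only [SimpleGraph.deleteIncidenceSet_adj]
    exact fun h1 h2 hne => ⟨h.trans₁ h1.1 h2.1 hne, h1.2.1, h2.2.2⟩

/-- For a triangle, deleting `uw` after `uv` isolates `u` in `F₁`. For a component of order four,
`ux` is deleted, and the surviving edge `uw` is moved to the other colour. -/
theorem exists_deleteEdges_of_chipped [Finite V] {H : SimpleGraph V} (h : Chipped H) :
    ∃ p q, H.Adj p q ∧ TwoHamming (H.deleteEdges {s(p, q)}) := by
  obtain ⟨H', F₁, F₂, u, v, S, hc, hd, huv, rfl, hu, hS, ht⟩ := chipped_iff_exists_block.1 h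
  have hI := hd.deleteIncidenceSet u
  have hstar : ∀ x y, ∀ z ∈ S, (x = u ∧ y = z ∨ x = z ∧ y = u) → ¬ F₂.Adj x y := by
    rintro x y z hz (⟨rfl, rfl⟩ | ⟨rfl, rfl⟩) h2
    · exact hd.not_both ((hS _ hu _).2 ⟨hz, h2.ne⟩) h2
    · exact hd.not_both ((hS _ hu _).2 ⟨hz, h2.ne'⟩) h2.symm
  have triangle : ∀ w, w ≠ u → w ≠ v → S = {u, v, w} → ∃ p q,
      (H'.deleteEdges {s(u, v)}).Adj p q ∧
      TwoHamming ((H'.deleteEdges {s(u, v)}).deleteEdges {s(p, q)}) := by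
    rintro w hwu hwv rfl
    refine ⟨u, w, ?_, ?_⟩
    · rw [deleteEdges_pair_adj]
      exact ⟨hd.le₁ ((hS u hu w).2 ⟨by simp, hwu.symm⟩), by tauto⟩
    · convert hI.twoHamming using 1
      ext x y
      rw [deleteEdges_pair_adj, deleteEdges_pair_adj, SimpleGraph.sup_adj,
        SimpleGraph.deleteIncidenceSet_adj, hd.adj_iff]
      constructor
      · rintro ⟨⟨h1 | h1, n1⟩, n2⟩
        · refine Or.inl ⟨h1, ?_, ?_⟩
          · rintro rfl
            obtain ⟨rfl | rfl | rfl, h2⟩ := (hS x hu y).1 h1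
            · exact h2 rfl
            · exact n1 (Or.inl ⟨rfl, rfl⟩)
            · exact n2 (Or.inl ⟨rfl, rfl⟩)
          · rintro rfl
            obtain ⟨rfl | rfl | rfl, h2⟩ := (hS y hu x).1 h1.symm
            · exact h2 rfl
            · exact n1 (Or.inr ⟨rfl, rfl⟩)
            · exact n2 (Or.inr ⟨rfl, rfl⟩)
        · exact Or.inr h1
      · have hn := hstar x y
        rintro (⟨h1, h2, h3⟩ | h1)
        · exact ⟨⟨Or.inl h1, by tauto⟩, by tauto⟩
        · exact ⟨⟨Or.inr h1, fun h => hn v (by simp) h h1⟩, fun h => hn w (by simp) h h1⟩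
  rcases ht with ⟨w, hwu, hwv, hw, -⟩ | ⟨w, hwu, hwv, hw, -⟩ |
      ⟨w, x, hwu, hwv, hxu, hxv, hxw, rfl, hw, hr⟩
  · exact triangle w hwu hwv hw
  · exact triangle w hwu hwv hw
  · refine ⟨u, x, ?_, ?_⟩
    · rw [deleteEdges_pair_adj]
      exact ⟨hd.le₁ ((hS u hu x).2 ⟨by simp, hxu.symm⟩), by tauto⟩
    · have huC : (H' \ cliqueOn {u, v, w, x}).Reachable u u := SimpleGraph.Reachable.refl _
      have hclosed : ∀ a b, (F₁.deleteIncidenceSet u ⊔ F₂).Adj a b →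
          (a ∈ {y | (H' \ cliqueOn {u, v, w, x}).Reachable u y} ↔
            b ∈ {y | (H' \ cliqueOn {u, v, w, x}).Reachable u y}) := by
        have main : ∀ a b, (F₁.deleteIncidenceSet u ⊔ F₂).Adj a b →
            (H' \ cliqueOn {u, v, w, x}).Reachable u a →
            (H' \ cliqueOn {u, v, w, x}).Reachable u b := by
          intro a b hab ha
          have hJ : (H' \ cliqueOn {u, v, w, x}).Adj a b := by
            rw [sdiff_cliqueOn_adj]
            rcases hab with hab | hab
            · rw [SimpleGraph.deleteIncidenceSet_adj] at hab
              exact ⟨hd.le₁ hab.1, fun hm => hab.2.1 (hr a hm.1 ha)⟩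
            · refine ⟨hd.le₂ hab, fun hm => ?_⟩
              exact hd.not_both ((hS a hm.1 b).2 ⟨hm.2, hab.ne⟩) hab
          exact ha.trans hJ.reachable
        exact fun a b hab => ⟨main a b hab, main b a hab.symm⟩
      -- Exchanging colours on the component of `u` off the block makes `u` isolated in the second
      -- part. There `w` is isolated as well, as all its neighbours lie in the block, so `uw` can be
      -- added to that part.
      have hfl := hI.flip hclosed
      have c1 : ∀ a b, (F₁.deleteIncidenceSet u).Adj a b →
          (a ∈ {y | (H' \ cliqueOn {u, v, w, x}).Reachable u y} ↔
            b ∈ {y | (H' \ cliqueOn {u, v, w, x}).Reachable u y}) :=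
        fun a b hab => hclosed a b (Or.inl hab)
      have c2 : ∀ a b, F₂.Adj a b →
          (a ∈ {y | (H' \ cliqueOn {u, v, w, x}).Reachable u y} ↔
            b ∈ {y | (H' \ cliqueOn {u, v, w, x}).Reachable u y}) :=
        fun a b hab => hclosed a b (Or.inr hab)
      have hw1 : w ∈ ({u, v, w, x} : Set V) := by simp
      have hwC : w ∉ {y | (H' \ cliqueOn {u, v, w, x}).Reachable u y} :=
        fun hwC => hwu (hr w hw1 hwC)
      have nuw : ∀ G, G ≤ F₁.deleteIncidenceSet u ⊔ F₂ → ∀ a ∈ ({u, w} : Set V),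
          ∀ b ∈ ({u, w} : Set V), ¬ G.Adj a b := by
        intro G hG a ha b hb hab
        have hcl := hclosed a b (hG hab)
        rcases ha with rfl | rfl <;> rcases hb with rfl | rfl
        · exact hab.ne rfl
        · exact hwC (hcl.1 huC)
        · exact hwC (hcl.2 huC)
        · exact hab.ne rfl
      have hfin := (hfl.swap.sup_cliqueOn (T := {u, w}) ?_ (nuw _ hfl.le₁)).twoHamming
      · convert hfin using 1
        ext a b
        rw [deleteEdges_pair_adj, deleteEdges_pair_adj, sup_cliqueOn_adj, SimpleGraph.sup_adj,
          SimpleGraph.deleteIncidenceSet_adj, hd.adj_iff]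
        constructor
        · rintro ⟨⟨h1 | h1, n1⟩, n2⟩
          · by_cases hau : a = u
            · subst hau
              obtain ⟨rfl | rfl | rfl | rfl, h2⟩ := (hS a hu b).1 h1
              · exact absurd rfl h2
              · exact absurd (Or.inl ⟨rfl, rfl⟩) n1
              · exact Or.inr ⟨h2, by simp, by simp⟩
              · exact absurd (Or.inl ⟨rfl, rfl⟩) n2
            · by_cases hbu : b = u
              · subst hbu
                obtain ⟨rfl | rfl | rfl | rfl, h2⟩ := (hS b hu a).1 h1.symm
                · exact absurd rfl h2
                · exact absurd (Or.inr ⟨rfl, rfl⟩) n1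
                · exact Or.inr ⟨h2.symm, by simp, by simp⟩
                · exact absurd (Or.inr ⟨rfl, rfl⟩) n2
              · exact Or.inl (Or.inl ⟨h1, hau, hbu⟩)
          · exact Or.inl (Or.inr h1)
        · have hn := hstar a b
          rintro ((⟨h1, h2, h3⟩ | h1) | ⟨hne, rfl | rfl, rfl | rfl⟩)
          · exact ⟨⟨Or.inl h1, by tauto⟩, by tauto⟩
          · exact ⟨⟨Or.inr h1, fun h => hn v (by simp) h h1⟩, fun h => hn x (by simp) h h1⟩
          · exact absurd rfl hne
          · exact ⟨⟨Or.inl ((hS a hu b).2 ⟨hw1, hne⟩), by tauto⟩, by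
              have := hxw.symm
              tauto⟩
          · exact ⟨⟨Or.inl ((hS b hu a).2 ⟨hw1, hne.symm⟩).symm, by tauto⟩, by
              have := hxw.symm
              tauto⟩
          · exact absurd rfl hne
      · rintro a (rfl | rfl) b
        · rw [flip_adj_of_mem c1 huC, SimpleGraph.deleteIncidenceSet_adj]
          exact fun h => h.2.1 rfl
        · rw [flip_adj_of_notMem c2 hwC]
          intro h2
          exact hd.not_both ((hS a hw1 b).2 ⟨hw b (hd.le₂ h2), h2.ne⟩) h2

/-- Deleting a set of edges inside a block does not affect adjacency of vertices at distance two
outside it. -/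
theorem IsTwoHammingDecomp.colour_transfer_block {H H' F₁ F₂ D₁ D₂ : SimpleGraph V} {S : Set V}
    (h : IsTwoHammingDecomp H F₁ F₂) (hS : IsBlock F₁ S) (hD : IsTwoHammingDecomp H' D₁ D₂)
    (hH : ∀ a b, ¬ (a ∈ S ∧ b ∈ S) → (H.Adj a b ↔ H'.Adj a b)) {x y x' y' : V}
    (hr : (H \ cliqueOn S).Reachable x y) (hx : (H \ cliqueOn S).Adj x x')
    (hy : (H \ cliqueOn S).Adj y y') :
    (F₁.Adj x x' ↔ D₁.Adj x x') ↔ (F₁.Adj y y' ↔ D₁.Adj y y') := by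
  refine h.colour_transfer hD sdiff_le (fun a b hab => ?_) (fun a b c hab hbc hac => ?_) hr hx hy
  · rw [sdiff_cliqueOn_adj] at hab
    exact (hH a b hab.2).1 hab.1
  · exact hH a c (h.not_ends_mem hS hab hbc hac)

theorem not_iff_cycle {P Q R T : Prop} (h₁ : ¬ (P ↔ Q)) (h₂ : ¬ (R ↔ T)) (h₃ : ¬ (P ↔ R)) :
    ¬ (Q ↔ T) := by
  tauto

/-! ### Components of order four: which second deletion is possible. -/

section Quad

variable [Finite V] {H F₁ F₂ D₁ D₂ : SimpleGraph V} {u v w x : V}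

/-- The vertex `x` keeps all its edges in the block, so an `F₂`-neighbour would give a claw with `u`
and `v`; hence `x` plays the role of the degree-three vertex. A connection off the block from `u` to
`v` or `w` is excluded by counting colour changes, as for the triangle. -/
theorem chipped_of_delete_side (hc : H.Connected) (h : IsTwoHammingDecomp H F₁ F₂)
    (hS : IsBlock F₁ {u, v, w, x}) (huv : u ≠ v) (hwu : w ≠ u) (hwv : w ≠ v) (hxu : x ≠ u)
    (hxv : x ≠ v) (hxw : x ≠ w)
    (hD : IsTwoHammingDecomp ((H.deleteEdges {s(u, v)}).deleteEdges {s(u, w)}) D₁ D₂) :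
    Chipped (H.deleteEdges {s(u, v)}) := by
  have hu1 : u ∈ ({u, v, w, x} : Set V) := by simp
  have hv1 : v ∈ ({u, v, w, x} : Set V) := by simp
  have hw1 : w ∈ ({u, v, w, x} : Set V) := by simp
  have hx1 : x ∈ ({u, v, w, x} : Set V) := by simp
  have hadj : ∀ a b, ((H.deleteEdges {s(u, v)}).deleteEdges {s(u, w)}).Adj a b ↔
      (H.Adj a b ∧ ¬ (a = u ∧ b = v ∨ a = v ∧ b = u)) ∧ ¬ (a = u ∧ b = w ∨ a = w ∧ b = u) := by
    intro a b
    rw [deleteEdges_pair_adj, deleteEdges_pair_adj]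
  have hout : ∀ a b, ¬ (a ∈ ({u, v, w, x} : Set V) ∧ b ∈ ({u, v, w, x} : Set V)) →
      (H.Adj a b ↔ ((H.deleteEdges {s(u, v)}).deleteEdges {s(u, w)}).Adj a b) := by
    intro a b hab
    rw [hadj]
    simp only [Set.mem_insert_iff, Set.mem_singleton_iff] at hab
    tauto
  have hxu' : ((H.deleteEdges {s(u, v)}).deleteEdges {s(u, w)}).Adj x u := by
    rw [hadj]
    exact ⟨⟨h.le₁ ((hS x hx1 u).2 ⟨hu1, hxu⟩), by tauto⟩, by tauto⟩
  have hxt : ∀ t, t = v ∨ t = w →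
      ((H.deleteEdges {s(u, v)}).deleteEdges {s(u, w)}).Adj x t := by
    rintro t (rfl | rfl) <;> rw [hadj]
    · exact ⟨⟨h.le₁ ((hS x hx1 t).2 ⟨hv1, hxv⟩), by tauto⟩, by tauto⟩
    · exact ⟨⟨h.le₁ ((hS x hx1 t).2 ⟨hw1, hxw⟩), by tauto⟩, by tauto⟩
  have hut : ∀ t, t = v ∨ t = w →
      ¬ ((H.deleteEdges {s(u, v)}).deleteEdges {s(u, w)}).Adj u t := by
    intro t ht
    rw [hadj]
    tauto
  have hcommon : ∀ a z, a ∈ ({u, v, w, x} : Set V) → a ≠ x → F₂.Adj x z → ¬ H.Adj a z := by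
    intro a z ha hax hxz haz
    rcases (h.adj_iff a z).1 haz with h1 | h1
    · exact h.not_both ((hS x hx1 z).2 ⟨((hS a ha z).1 h1).1, hxz.ne⟩) hxz
    · exact h.not_both ((hS a ha x).2 ⟨hx1, hax⟩) (h.trans₂ h1 hxz.symm hax)
  have hxF : ∀ z, ¬ F₂.Adj x z := by
    intro z hz
    have hzS : z ∉ ({u, v, w, x} : Set V) := fun hzS =>
      h.not_both ((hS x hx1 z).2 ⟨hzS, hz.ne⟩) hz
    have hzu : z ≠ u := fun e => hzS (e ▸ hu1)
    have hzv : z ≠ v := fun e => hzS (e ▸ hv1)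
    refine hD.no_claw hxu' (hxt v (Or.inl rfl)) ((hout x z (fun h => hzS h.2)).1 (h.le₂ hz))
      huv hzu.symm hzv.symm (hut v (Or.inl rfl)) ?_ ?_
    · rw [← hout u z fun h => hzS h.2]
      exact hcommon u z hu1 hxu.symm hz
    · rw [← hout v z fun h => hzS h.2]
      exact hcommon v z hv1 hxv.symm hz
  have hxN : ∀ y, H.Adj x y → y ∈ ({u, v, w, x} : Set V) := fun y hy =>
    ((hS x hx1 y).1 (((h.adj_iff x y).1 hy).resolve_right (hxF y))).1
  refine chipped_iff_exists_block.2 ⟨H, F₁, F₂, u, v, _, hc, h, (hS u hu1 v).2 ⟨hv1, huv⟩, rfl, hu1,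
    hS, Or.inr (Or.inr ⟨x, w, hxu, hxv, hwu, hwv, hxw.symm, ?_, hxN, ?_⟩)⟩
  · rw [Set.pair_comm]
  · intro t ht hr
    by_contra htu
    have htx : t ≠ x := by
      rintro rfl
      refine htu (eq_of_reachable_of_isolated hr.symm fun y hy => ?_).symm
      rw [sdiff_cliqueOn_adj] at hy
      exact hy.2 ⟨hx1, hxN y hy.1⟩
    have ht' : t = v ∨ t = w := by
      rcases ht with rfl | rfl | rfl | rfl
      · exact absurd rfl htu
      · exact Or.inl rfl
      · exact Or.inr rfl
      · exact absurd rfl htx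
    obtain ⟨z, hz⟩ := exists_adj_of_reachable_ne hr (Ne.symm htu)
    obtain ⟨y, hy⟩ := exists_adj_of_reachable_ne hr.symm htu
    have key := h.colour_transfer_block hS hD hout hr hz hy
    have fz := h.adj₂_of_sdiff hS hu1 hz
    have fy := h.adj₂_of_sdiff hS ht hy
    have fz' : ¬ F₁.Adj u z := fun h1 => h.not_both h1 fz.1
    have fy' : ¬ F₁.Adj t y := fun h1 => h.not_both h1 fy.1
    have hxz : x ≠ z := fun e => fz.2 (e ▸ hx1)
    have hxy : x ≠ y := fun e => fy.2 (e ▸ hx1)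
    have nxz : ¬ ((H.deleteEdges {s(u, v)}).deleteEdges {s(u, w)}).Adj x z := fun h1 =>
      fz.2 (hxN z ((hout x z fun h => fz.2 h.2).2 h1))
    have nxy : ¬ ((H.deleteEdges {s(u, v)}).deleteEdges {s(u, w)}).Adj x y := fun h1 =>
      fy.2 (hxN y ((hout x y fun h => fy.2 h.2).2 h1))
    have e1 := hD.adj_iff_same hxu' ((hout u z fun h => fz.2 h.2).1 (h.le₂ fz.1)) hxz
    have e2 := hD.adj_iff_same (hxt t ht') ((hout t y fun h => fy.2 h.2).1 (h.le₂ fy.1)) hxy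
    have e3 := hD.adj_iff_same hxu'.symm (hxt t ht') (Ne.symm htu)
    have e4 := hut t ht'
    rw [D₁.adj_comm u x] at e3
    exact not_iff_cycle (mt e1.2 nxz) (mt e2.2 nxy) (mt e3.2 e4) 
      (not_iff_not.1 (by simpa [fz', fy'] using key))

/-- The block becomes an induced 4-cycle, so an `F₂`-neighbour of `u` or of `w` would create a claw.
In particular `u` is isolated off the block. -/
theorem chipped_of_delete_middle (hc : H.Connected) (h : IsTwoHammingDecomp H F₁ F₂)
    (hS : IsBlock F₁ {u, v, w, x}) (huv : u ≠ v) (hwu : w ≠ u) (hwv : w ≠ v) (hxu : x ≠ u)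
    (hxv : x ≠ v) (hxw : x ≠ w)
    (hD : IsTwoHammingDecomp ((H.deleteEdges {s(u, v)}).deleteEdges {s(w, x)}) D₁ D₂) :
    Chipped (H.deleteEdges {s(u, v)}) := by
  have hu1 : u ∈ ({u, v, w, x} : Set V) := by simp
  have hv1 : v ∈ ({u, v, w, x} : Set V) := by simp
  have hw1 : w ∈ ({u, v, w, x} : Set V) := by simp
  have hx1 : x ∈ ({u, v, w, x} : Set V) := by simp
  have hadj : ∀ a b, ((H.deleteEdges {s(u, v)}).deleteEdges {s(w, x)}).Adj a b ↔
      (H.Adj a b ∧ ¬ (a = u ∧ b = v ∨ a = v ∧ b = u)) ∧ ¬ (a = w ∧ b = x ∨ a = x ∧ b = w) := by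
    intro a b
    rw [deleteEdges_pair_adj, deleteEdges_pair_adj]
  have hout : ∀ a b, ¬ (a ∈ ({u, v, w, x} : Set V) ∧ b ∈ ({u, v, w, x} : Set V)) →
      (H.Adj a b ↔ ((H.deleteEdges {s(u, v)}).deleteEdges {s(w, x)}).Adj a b) := by
    intro a b hab
    rw [hadj]
    simp only [Set.mem_insert_iff, Set.mem_singleton_iff] at hab
    tauto
  have hcommon : ∀ a b z, a ∈ ({u, v, w, x} : Set V) → b ∈ ({u, v, w, x} : Set V) → a ≠ b →
      F₂.Adj b z → ¬ H.Adj a z := by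
    intro a b z ha hb hab hbz haz
    rcases (h.adj_iff a z).1 haz with h1 | h1
    · exact h.not_both ((hS b hb z).2 ⟨((hS a ha z).1 h1).1, hbz.ne⟩) hbz
    · exact h.not_both ((hS a ha b).2 ⟨hb, hab⟩) (h.trans₂ h1 hbz.symm hab)
  have claw : ∀ a b c, a ∈ ({u, v, w, x} : Set V) → b ∈ ({u, v, w, x} : Set V) →
      c ∈ ({u, v, w, x} : Set V) → b ≠ a → c ≠ a → b ≠ c →
      ((H.deleteEdges {s(u, v)}).deleteEdges {s(w, x)}).Adj a b →
      ((H.deleteEdges {s(u, v)}).deleteEdges {s(w, x)}).Adj a c →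
      ¬ ((H.deleteEdges {s(u, v)}).deleteEdges {s(w, x)}).Adj b c → ∀ z, ¬ F₂.Adj a z := by
    intro a b c ha hb hcS hba hca hbc hab hac nbc z hz
    have hzS : z ∉ ({u, v, w, x} : Set V) := fun hzS =>
      h.not_both ((hS a ha z).2 ⟨hzS, hz.ne⟩) hz
    refine hD.no_claw hab hac ((hout a z (fun h => hzS h.2)).1 (h.le₂ hz))
      hbc (fun e => hzS (e ▸ hb)) (fun e => hzS (e ▸ hcS)) nbc ?_ ?_
    · rw [← hout b z fun h => hzS h.2]
      exact hcommon b a z hb ha hba hz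
    · rw [← hout c z fun h => hzS h.2]
      exact hcommon c a z hcS ha hca hz
  have hF : ∀ {a b}, a ∈ ({u, v, w, x} : Set V) → b ∈ ({u, v, w, x} : Set V) → a ≠ b →
      H.Adj a b := fun ha hb hab => h.le₁ ((hS _ ha _).2 ⟨hb, hab⟩)
  have huF : ∀ z, ¬ F₂.Adj u z := by
    refine claw u w x hu1 hw1 hx1 hwu hxu hxw.symm ?_ ?_ ?_ <;> rw [hadj]
    · exact ⟨⟨hF hu1 hw1 hwu.symm, by tauto⟩, by tauto⟩
    · exact ⟨⟨hF hu1 hx1 hxu.symm, by tauto⟩, by tauto⟩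
    · tauto
  have hwF : ∀ z, ¬ F₂.Adj w z := by
    refine claw w u v hw1 hu1 hv1 hwu.symm hwv.symm huv ?_ ?_ ?_ <;> rw [hadj]
    · exact ⟨⟨hF hw1 hu1 hwu, by tauto⟩, by tauto⟩
    · exact ⟨⟨hF hw1 hv1 hwv, by tauto⟩, by tauto⟩
    · tauto
  refine chipped_iff_exists_block.2 ⟨H, F₁, F₂, u, v, _, hc, h, (hS u hu1 v).2 ⟨hv1, huv⟩, rfl, hu1,
    hS, Or.inr (Or.inr ⟨w, x, hwu, hwv, hxu, hxv, hxw, rfl, ?_, ?_⟩)⟩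
  · exact fun y hy => ((hS w hw1 y).1 (((h.adj_iff w y).1 hy).resolve_right (hwF y))).1
  · exact fun t _ hr => eq_of_reachable_of_isolated hr fun y hy => huF y
      (h.adj₂_of_sdiff hS hu1 hy).1

end Quad

/-- The cases are the orders 2, 3, 4 and at least 5 of the component of `uv` in `F₁`; orders 2 and
at least 5 are contradictory. -/
theorem chipped_of_decomp [Finite V] {H F₁ F₂ : SimpleGraph V} (hc : H.Connected)
    (h : IsTwoHammingDecomp H F₁ F₂) {u v : V} (huv : F₁.Adj u v)
    (hn : ¬ TwoHamming (H.deleteEdges {s(u, v)})) {p q : V}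
    (hpq : (H.deleteEdges {s(u, v)}).Adj p q) {D₁ D₂ : SimpleGraph V}
    (hD : IsTwoHammingDecomp ((H.deleteEdges {s(u, v)}).deleteEdges {s(p, q)}) D₁ D₂) :
    Chipped (H.deleteEdges {s(u, v)}) := by
  by_cases hy : ∀ y, F₁.Adj u y → y = v
  · have hy' : ∀ y, F₁.Adj v y → y = u := fun y hvy => by
      by_contra hne
      exact hvy.ne' (hy y (h.trans₁ huv hvy (Ne.symm hne)))
    refine absurd ?_ hn
    have := (h.sdiff_cliqueOn (T := {u, v}) ?_ ?_).twoHamming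
    · convert this using 1
      ext a b
      rw [deleteEdges_pair_adj, sdiff_cliqueOn_adj]
      simp only [Set.mem_insert_iff, Set.mem_singleton_iff]
      constructor
      · rintro ⟨h1, h2⟩
        refine ⟨h1, ?_⟩
        rintro ⟨rfl | rfl, rfl | rfl⟩
        · exact h1.ne rfl
        · exact h2 (Or.inl ⟨rfl, rfl⟩)
        · exact h2 (Or.inr ⟨rfl, rfl⟩)
        · exact h1.ne rfl
      · tauto
    · rintro a (rfl | rfl) b hab
      · exact Or.inr (hy b hab)
      · exact Or.inl (hy' b hab)
    · rintro a (rfl | rfl) b (rfl | rfl) hab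
      · exact hab.ne rfl
      · exact h.not_both huv hab
      · exact h.not_both huv hab.symm
      · exact hab.ne rfl
  push Not at hy
  obtain ⟨w, huw, hwv⟩ := hy
  by_cases hy : ∀ y, F₁.Adj u y → y = v ∨ y = w
  · have hS := h.isBlock_triple huv huw hwv.symm hy
    by_cases h2 : ∃ y, F₂.Adj w y
    · exact chipped_iff_exists_block.2 ⟨H, F₁, F₂, u, v, _, hc, h, huv, rfl, by simp, hS,
        Or.inl ⟨w, huw.ne', hwv, rfl, h2⟩⟩
    push Not at h2
    have hw : ∀ y, H.Adj w y → y = u ∨ y = v := by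
      intro y hy
      obtain ⟨rfl | rfl | rfl, h3⟩ :=
        (hS w (by simp) y).1 (((h.adj_iff w y).1 hy).resolve_right (h2 y))
      · exact Or.inl rfl
      · exact Or.inr rfl
      · exact absurd rfl h3
    by_cases hr : (H \ cliqueOn {u, v, w}).Reachable u v
    · exact chipped_iff_exists_block.2 ⟨H, F₁, F₂, u, v, _, hc, h, huv, rfl, by simp, hS,
        Or.inr (Or.inl ⟨w, huw.ne', hwv, rfl, hw, hr⟩)⟩
    · refine absurd ?_ hn
      obtain ⟨A, B, hh, -, -⟩ := h.exists_hinge hc huv huw hwv hw hr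
      have := hh.path.twoHamming
      rwa [sdiff_cliqueOn_sup_path (h.le₁ huw) (h.le₁ (h.trans₁ huv.symm huw hwv.symm))] at this
  push Not at hy
  obtain ⟨x, hux, hxv, hxw⟩ := hy
  have nuv : ¬ ((H.deleteEdges {s(u, v)}).deleteEdges {s(p, q)}).Adj u v := by
    simp
  have npq : ¬ (p = u ∧ q = v ∨ p = v ∧ q = u) := (deleteEdges_pair_adj.1 hpq).2
  -- every diamond on `u`, `v` contains the deleted edge `pq`
  have diamond : ∀ a b, F₁.Adj u a → F₁.Adj u b → a ≠ v → b ≠ v → a ≠ b →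
      ((p = u ∧ q = a ∨ p = a ∧ q = u) ∨ (p = u ∧ q = b ∨ p = b ∧ q = u)) ∨
      ((p = v ∧ q = a ∨ p = a ∧ q = v) ∨ (p = v ∧ q = b ∨ p = b ∧ q = v)) ∨
      (p = a ∧ q = b ∨ p = b ∧ q = a) := by
    intro a b ha hb hav hbv hab
    by_contra hne
    push Not at hne
    have hva := h.trans₁ huv.symm ha hav.symm
    have hvb := h.trans₁ huv.symm hb hbv.symm
    have hab' := h.trans₁ ha.symm hb hab
    have n1 := ha.ne'
    have n2 := hb.ne'
    refine hD.no_diamond (u := u) (v := v) (w := a) (x := b) ?_ ?_ ?_ ?_ ?_ huv.ne nuv <;>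
      rw [deleteEdges_pair_adj, deleteEdges_pair_adj]
    · exact ⟨⟨h.le₁ ha, by tauto⟩, by
        rintro (⟨rfl, rfl⟩ | ⟨rfl, rfl⟩) <;> simp_all⟩
    · exact ⟨⟨h.le₁ hb, by tauto⟩, by
        rintro (⟨rfl, rfl⟩ | ⟨rfl, rfl⟩) <;> simp_all⟩
    · exact ⟨⟨h.le₁ hva, by tauto⟩, by
        rintro (⟨rfl, rfl⟩ | ⟨rfl, rfl⟩) <;> simp_all⟩
    · exact ⟨⟨h.le₁ hvb, by tauto⟩, by
        rintro (⟨rfl, rfl⟩ | ⟨rfl, rfl⟩) <;> simp_all⟩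
    · exact ⟨⟨h.le₁ hab', by tauto⟩, by
        rintro (⟨rfl, rfl⟩ | ⟨rfl, rfl⟩) <;> simp_all⟩
  by_cases hy : ∀ y, F₁.Adj u y → y = v ∨ y = w ∨ y = x
  · have hS : IsBlock F₁ {u, v, w, x} := by
      have e : ({u, v, w, x} : Set V) = {y | u = y ∨ F₁.Adj u y} := by
        ext y
        constructor
        · rintro (rfl | rfl | rfl | rfl)
          · exact Or.inl rfl
          · exact Or.inr huv
          · exact Or.inr huw
          · exact Or.inr hux
        · rintro (rfl | hy')
          · simp
          · rcases hy y hy' with rfl | rfl | rfl <;> simp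
      have hK := h.left.isBlock_supp (F₁.connectedComponentMk u)
      convert hK using 1
      rw [e]
      ext y
      rw [SimpleGraph.ConnectedComponent.mem_supp_iff, SimpleGraph.ConnectedComponent.eq,
        SimpleGraph.reachable_comm, h.left.reachable_iff]
      rfl
    have hS' : IsBlock F₁ {v, u, w, x} := by rwa [Set.insert_comm]
    have hSx : IsBlock F₁ {u, v, x, w} := by rwa [Set.pair_comm]
    have hSx' : IsBlock F₁ {v, u, x, w} := by rwa [Set.pair_comm]
    have swap_pq : ((H.deleteEdges {s(u, v)}).deleteEdges {s(q, p)}) =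
        ((H.deleteEdges {s(u, v)}).deleteEdges {s(p, q)}) := by
      rw [Sym2.eq_swap (a := q)]
    have both : ∀ a b, (p = a ∧ q = b ∨ p = b ∧ q = a) →
        IsTwoHammingDecomp ((H.deleteEdges {s(u, v)}).deleteEdges {s(a, b)}) D₁ D₂ := by
      rintro a b (⟨rfl, rfl⟩ | ⟨rfl, rfl⟩)
      · exact hD
      · rwa [swap_pq]
    have e : H.deleteEdges {s(u, v)} = H.deleteEdges {s(v, u)} := by rw [Sym2.eq_swap]
    rcases diamond w x huw hux hwv hxv hxw.symm with (h1 | h1) | (h1 | h1) | h1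
    · exact chipped_of_delete_side hc h hS huv.ne huw.ne' hwv hux.ne' hxv hxw (both _ _ h1)
    · exact chipped_of_delete_side hc h hSx huv.ne hux.ne' hxv huw.ne' hwv hxw.symm (both _ _ h1)
    · have := both _ _ h1
      rw [e] at this ⊢
      exact chipped_of_delete_side hc h hS' huv.ne' hwv huw.ne' hxv hux.ne' hxw this
    · have := both _ _ h1
      rw [e] at this ⊢
      exact chipped_of_delete_side hc h hSx' huv.ne' hxv hux.ne' hwv huw.ne' hxw.symm this
    · exact chipped_of_delete_middle hc h hS huv.ne huw.ne' hwv hux.ne' hxv hxw (both _ _ h1)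
  push Not at hy
  obtain ⟨y, huy, hyv, hyw, hyx⟩ := hy
  -- No edge belongs to all three diamonds on `u`, `v` and two of `w`, `x`, `y`.
  have d1 := diamond w x huw hux hwv hxv hxw.symm
  have d2 := diamond w y huw huy hwv hyv hyw.symm
  have d3 := diamond x y hux huy hxv hyv hyx.symm
  have n1 := huv.ne
  have n2 := huw.ne
  have n3 := hux.ne
  have n4 := huy.ne
  exfalso
  grind

theorem chipped_of_not_twoHamming [Finite V] {H : SimpleGraph V} (hH : H.Connected)
    (hn : ¬ TwoHamming H) {u v p q : V} (huv : u ≠ v) (nuv : ¬ H.Adj u v)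
    (h₁ : TwoHamming (H ⊔ SimpleGraph.edge u v)) (hpq : H.Adj p q)
    (h₂ : TwoHamming (H.deleteEdges {s(p, q)})) : Chipped H := by
  obtain ⟨F₁, F₂, hF⟩ := twoHamming_iff.1 h₁
  obtain ⟨D₁, D₂, hD⟩ := twoHamming_iff.1 h₂
  have hc : (H ⊔ SimpleGraph.edge u v).Connected := hH.mono le_sup_left
  have e : (H ⊔ SimpleGraph.edge u v).deleteEdges {s(u, v)} = H := deleteEdges_sup_edge nuv
  have hadj : (H ⊔ SimpleGraph.edge u v).Adj u v := by
    rw [sup_edge_adj]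
    tauto
  rw [← e] at hn hpq hD ⊢
  rcases (hF.adj_iff u v).1 hadj with h | h
  · exact chipped_of_decomp hc hF h hn hpq hD
  · exact chipped_of_decomp hc hF.swap h hn hpq hD

/-! ### Optimal decompositions of connected graphs -/

namespace IsTwoHammingDecomp

variable {H F₁ F₂ : SimpleGraph V}

theorem decompLE_iff (hH : H.Connected) (h : IsTwoHammingDecomp H F₁ F₂) {k : ℕ} :
    DecompLE k H ↔ numComp F₁ ≤ k ∧ numComp F₂ ≤ k := by
  constructor
  · rintro ⟨D₁, D₂, hD, h1, h2⟩
    rcases h.unique hH hD with ⟨rfl, rfl⟩ | ⟨rfl, rfl⟩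
    · exact ⟨h1, h2⟩
    · exact ⟨h2, h1⟩
  · exact fun hk => ⟨F₁, F₂, h, hk.1, hk.2⟩

/-- By uniqueness every decomposition of a connected graph attains the minimum. -/
theorem isOptimalDecomp [Finite V] (hH : H.Connected) (h : IsTwoHammingDecomp H F₁ F₂) :
    IsOptimalDecomp H F₁ F₂ := by
  refine ⟨h, ?_, ?_⟩
  · change H.IsIndContained _
    rw [isIndContained_cliqueSquare_iff, h.decompLE_iff hH]
    exact ⟨le_max_left _ _, le_max_right _ _⟩
  · intro k hk
    have hk' : H.IsIndContained (cliqueSquare k) := hk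
    rw [isIndContained_cliqueSquare_iff, h.decompLE_iff hH] at hk'
    exact max_le hk'.1 hk'.2

theorem not_balanced (hH : H.Connected) (h : IsTwoHammingDecomp H F₁ F₂)
    (hne : numComp F₂ < numComp F₁) : ¬ Balanced H := by
  rintro ⟨D₁, D₂, hD, he⟩
  rcases h.unique hH hD.1 with ⟨rfl, rfl⟩ | ⟨rfl, rfl⟩ <;> omega

end IsTwoHammingDecomp

theorem connected_deleteEdges {H : SimpleGraph V} (hH : H.Connected) {u v : V}
    (hr : (H.deleteEdges {s(u, v)}).Reachable u v) : (H.deleteEdges {s(u, v)}).Connected := by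
  have := hH.nonempty
  refine ⟨fun x y => ?_⟩
  obtain ⟨p⟩ := hH.preconnected x y
  induction p with
  | nil => rfl
  | @cons a b c hab q ih =>
    refine SimpleGraph.Reachable.trans ?_ ih
    by_cases h : a = u ∧ b = v ∨ a = v ∧ b = u
    · rcases h with ⟨rfl, rfl⟩ | ⟨rfl, rfl⟩
      · exact hr
      · exact hr.symm
    · exact (deleteEdges_pair_adj.2 ⟨hab, h⟩).reachable

theorem sdiff_cliqueOn_pair {H : SimpleGraph V} {u v : V} :
    H \ cliqueOn {u, v} = H.deleteEdges {s(u, v)} := by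
  ext x y
  rw [sdiff_cliqueOn_adj, deleteEdges_pair_adj]
  simp only [Set.mem_insert_iff, Set.mem_singleton_iff]
  constructor
  · tauto
  · rintro ⟨h1, h2⟩
    refine ⟨h1, ?_⟩
    rintro ⟨rfl | rfl, rfl | rfl⟩
    · exact h1.ne rfl
    · exact h2 (Or.inl ⟨rfl, rfl⟩)
    · exact h2 (Or.inr ⟨rfl, rfl⟩)
    · exact h1.ne rfl

theorem sup_cliqueOn_pair {H : SimpleGraph V} {u v : V} :
    H ⊔ cliqueOn {u, v} = H ⊔ SimpleGraph.edge u v := by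
  ext x y
  rw [sup_cliqueOn_adj, sup_edge_adj]
  simp only [Set.mem_insert_iff, Set.mem_singleton_iff]
  constructor
  · rintro (h | ⟨hne, rfl | rfl, rfl | rfl⟩)
    · exact Or.inl h
    · exact absurd rfl hne
    · exact Or.inr ⟨Or.inl ⟨rfl, rfl⟩, hne⟩
    · exact Or.inr ⟨Or.inr ⟨rfl, rfl⟩, hne⟩
    · exact absurd rfl hne
  · tauto

/-! ### Edges which are components of one part of a decomposition -/

section Pendant

variable {H F₁ F₂ : SimpleGraph V} {u v : V}

theorem IsTwoHammingDecomp.pendant_symm (h : IsTwoHammingDecomp H F₁ F₂) (huv : F₁.Adj u v)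
    (hu : ∀ y, F₁.Adj u y → y = v) : ∀ y, F₁.Adj v y → y = u := by
  intro y hvy
  by_contra hne
  exact hvy.ne' (hu y (h.trans₁ huv hvy (Ne.symm hne)))

theorem IsTwoHammingDecomp.sdiff_pendant (h : IsTwoHammingDecomp H F₁ F₂) (huv : F₁.Adj u v)
    (hu : ∀ y, F₁.Adj u y → y = v) :
    IsTwoHammingDecomp (H.deleteEdges {s(u, v)}) (F₁ \ cliqueOn {u, v}) F₂ := by
  have hv := h.pendant_symm huv hu
  rw [← sdiff_cliqueOn_pair]
  refine h.sdiff_cliqueOn ?_ ?_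
  · rintro a (rfl | rfl) b hab
    · exact Or.inr (hu b hab)
    · exact Or.inl (hv b hab)
  · rintro a (rfl | rfl) b (rfl | rfl) hab
    · exact hab.ne rfl
    · exact h.not_both huv hab
    · exact h.not_both huv hab.symm
    · exact hab.ne rfl

theorem IsTwoHammingDecomp.pendant_isolated (h : IsTwoHammingDecomp H F₁ F₂) (huv : F₁.Adj u v)
    (hu : ∀ y, F₁.Adj u y → y = v) : ∀ x ∈ ({u, v} : Set V), ∀ y,
    ¬ (F₁ \ cliqueOn {u, v}).Adj x y := by
  have hv := h.pendant_symm huv hu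
  rintro x (rfl | rfl) y hy
  · rw [sdiff_cliqueOn_adj] at hy
    exact hy.2 ⟨by simp, Or.inr (hu y hy.1)⟩
  · rw [sdiff_cliqueOn_adj] at hy
    exact hy.2 ⟨by simp, Or.inl (hv y hy.1)⟩

theorem sdiff_cliqueOn_pair_sup {F : SimpleGraph V} (huv : F.Adj u v) :
    F \ cliqueOn {u, v} ⊔ cliqueOn {u, v} = F := by
  refine sdiff_cliqueOn_sup ?_
  rintro x (rfl | rfl) y (rfl | rfl) hne
  · exact absurd rfl hne
  · exact huv
  · exact huv.symm
  · exact absurd rfl hne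

theorem IsTwoHammingDecomp.numComp_pendant [Finite V] (h : IsTwoHammingDecomp H F₁ F₂)
    (huv : F₁.Adj u v) (hu : ∀ y, F₁.Adj u y → y = v) :
    numComp (F₁ \ cliqueOn {u, v}) = numComp F₁ + 1 := by
  have hd := h.sdiff_pendant huv hu
  have e := sdiff_cliqueOn_pair_sup huv
  have h1 := hd.left.numComp_sup_cliqueOn (T := {u, v}) (by rw [e]; exact h.left)
    (h.pendant_isolated huv hu) ⟨u, by simp⟩
  rw [e, Set.ncard_pair huv.ne] at h1
  omega

/-- A bridge in `F₁` is a component of `F₁`. -/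
theorem IsTwoHammingDecomp.pendant_of_bridge (h : IsTwoHammingDecomp H F₁ F₂) (huv : F₁.Adj u v)
    (hb : ¬ (H.deleteEdges {s(u, v)}).Reachable u v) : ∀ y, F₁.Adj u y → y = v := by
  intro y hy
  by_contra hne
  have h1 := h.le₁ hy
  have h2 := h.le₁ (h.trans₁ hy.symm huv hne)
  have n := hy.ne'
  have a1 : (H.deleteEdges {s(u, v)}).Adj u y := deleteEdges_pair_adj.2 ⟨h1, by tauto⟩
  have a2 : (H.deleteEdges {s(u, v)}).Adj y v := deleteEdges_pair_adj.2 ⟨h2, by tauto⟩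
  exact hb (a1.reachable.trans a2.reachable)

/-- The numbers of components before and after flipping one side of a bridge. -/
theorem bridge_counts [Finite V] (h : IsTwoHammingDecomp H F₁ F₂)
    (huv : F₁.Adj u v) (hu : ∀ y, F₁.Adj u y → y = v) {B : Set V} (huB : u ∉ B) (hvB : v ∈ B)
    (hc : ∀ x y, (H.deleteEdges {s(u, v)}).Adj x y → (x ∈ B ↔ y ∈ B)) :
    IsTwoHammingDecomp (H.deleteEdges {s(u, v)}) (flip (F₁ \ cliqueOn {u, v}) F₂ B)
      (flip F₂ (F₁ \ cliqueOn {u, v}) B) ∧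
    numComp F₁ = numCompIn F₁ Bᶜ + numCompIn F₁ B + 1 ∧
    numComp F₂ = numCompIn F₂ Bᶜ + numCompIn F₂ B ∧
    numComp (flip (F₁ \ cliqueOn {u, v}) F₂ B) = numCompIn F₁ Bᶜ + 1 + numCompIn F₂ B ∧
    numComp (flip F₂ (F₁ \ cliqueOn {u, v}) B) = numCompIn F₂ Bᶜ + (numCompIn F₁ B + 1) := by
  have hd := h.sdiff_pendant huv hu
  have hfl := hd.flip hc
  have hiso := h.pendant_isolated huv hu
  have e := sdiff_cliqueOn_pair_sup huv
  have hsplit : ∀ G, G ≤ H.deleteEdges {s(u, v)} →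
      numComp G = numCompIn G Bᶜ + numCompIn G B := by
    intro G hG
    rw [numComp_eq_numCompIn_univ, ← Set.compl_union_self B]
    refine numCompIn_union G disjoint_compl_left fun x y hxy _ => ?_
    exact not_congr (hc x y (hG hxy))
  have c1 := fun x y hxy => hc x y (hd.le₁ hxy)
  have c2 := fun x y hxy => hc x y (hd.le₂ hxy)
  have hrest : ∀ x, x ≠ u → x ≠ v → ∀ y, (F₁ \ cliqueOn {u, v}).Adj x y ↔ F₁.Adj x y := by
    intro x hxu hxv y
    rw [sdiff_cliqueOn_adj]
    simp only [Set.mem_insert_iff, Set.mem_singleton_iff]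
    tauto
  have hA : numCompIn (F₁ \ cliqueOn {u, v}) Bᶜ = numCompIn F₁ Bᶜ + 1 :=
    hd.left.numCompIn_attach h.left huB (hiso u (by simp)) (not_not.2 hvB) huv
      fun x hx hxu => hrest x hxu (fun e => hx (e ▸ hvB))
  have hB : numCompIn (F₁ \ cliqueOn {u, v}) B = numCompIn F₁ B + 1 :=
    hd.left.numCompIn_attach h.left hvB (hiso v (by simp)) huB huv.symm
      fun x hx hxv => hrest x (fun e => huB (e ▸ hx)) hxv
  have f1A : numCompIn (flip (F₁ \ cliqueOn {u, v}) F₂ B) Bᶜ =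
      numCompIn (F₁ \ cliqueOn {u, v}) Bᶜ :=
    hfl.left.numCompIn_congr hd.left fun x hx _ => flip_adj_of_notMem c1 hx
  have f1B : numCompIn (flip (F₁ \ cliqueOn {u, v}) F₂ B) B = numCompIn F₂ B :=
    hfl.left.numCompIn_congr hd.right fun x hx _ => flip_adj_of_mem c2 hx
  have f2A : numCompIn (flip F₂ (F₁ \ cliqueOn {u, v}) B) Bᶜ = numCompIn F₂ Bᶜ :=
    hfl.right.numCompIn_congr hd.right fun x hx _ => flip_adj_of_notMem c2 hx
  have f2B : numCompIn (flip F₂ (F₁ \ cliqueOn {u, v}) B) B =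
      numCompIn (F₁ \ cliqueOn {u, v}) B :=
    hfl.right.numCompIn_congr hd.left fun x hx _ => flip_adj_of_mem c1 hx
  have s1 := hsplit _ hd.le₁
  have s2 := hsplit _ hd.le₂
  have s3 := hsplit _ hfl.le₁
  have s4 := hsplit _ hfl.le₂
  have s5 := h.numComp_pendant huv hu
  refine ⟨hfl, ?_, s2, ?_, ?_⟩ <;> omega

end Pendant

/-! ### The three components around a vertex of degree two -/

theorem Hinge.mem_of_reachable {J E₁ E₂ : SimpleGraph V} {A B : Set V} {u v w : V}
    (h : Hinge J E₁ E₂ A B u v w) {x y : V} (hr : J.Reachable x y) :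
    (x ∈ A ↔ y ∈ A) ∧ (x ∈ B ↔ y ∈ B) := by
  obtain ⟨p⟩ := hr
  induction p with
  | nil => exact ⟨Iff.rfl, Iff.rfl⟩
  | cons hab _ ih => exact ⟨(h.closed_left _ _ hab).trans ih.1, (h.closed_right _ _ hab).trans ih.2⟩

/-- Every vertex reaches `u`, `v` or `w` off the triple and no edge crosses between the sides, so
the sides of a hinge are exactly the components that `SplitsAt` speaks of. -/
theorem Hinge.supp_eq {H E₁ E₂ : SimpleGraph V} {A B : Set V} {u v w : V} (hH : H.Connected)
    (h : Hinge (H \ cliqueOn {u, v, w}) E₁ E₂ A B u v w) :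
    ((H \ cliqueOn {u, v, w}).connectedComponentMk u).supp = A ∧
    ((H \ cliqueOn {u, v, w}).connectedComponentMk v).supp = B ∧
    ((H \ cliqueOn {u, v, w}).connectedComponentMk w).supp = {w} := by
  have hv : v ∉ A := fun hv => h.disj v hv h.mem_right
  have hu : u ∉ B := h.disj u h.mem_left
  refine ⟨?_, ?_, ?_⟩ <;> ext x <;>
    rw [SimpleGraph.ConnectedComponent.mem_supp_iff, SimpleGraph.ConnectedComponent.eq]
  · refine ⟨fun hr => ((h.mem_of_reachable hr).1).2 h.mem_left, fun hx => ?_⟩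
    obtain ⟨t, rfl | rfl | rfl, ht⟩ :=
      exists_reachable_sdiff_cliqueOn hH (S := {u, v, w}) ⟨u, by simp⟩ x
    · exact ht
    · exact absurd ((h.mem_of_reachable ht).1.1 hx) hv
    · exact absurd ((h.mem_of_reachable ht).1.1 hx) h.notMem_left
  · refine ⟨fun hr => ((h.mem_of_reachable hr).2).2 h.mem_right, fun hx => ?_⟩
    obtain ⟨t, rfl | rfl | rfl, ht⟩ :=
      exists_reachable_sdiff_cliqueOn hH (S := {u, v, w}) ⟨u, by simp⟩ x
    · exact absurd ((h.mem_of_reachable ht).2.1 hx) hu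
    · exact ht
    · exact absurd ((h.mem_of_reachable ht).2.1 hx) h.notMem_right
  · constructor
    · exact fun hr => eq_of_reachable_of_isolated hr.symm h.isolated
    · rintro rfl
      exact SimpleGraph.Reachable.refl _

theorem Hinge.splitsAt {H E₁ E₂ F₁ F₂ : SimpleGraph V} {A B : Set V} {u v w : V}
    (hH : H.Connected) (h : Hinge (H \ cliqueOn {u, v, w}) E₁ E₂ A B u v w)
    (hA : numCompIn F₂ A < numCompIn F₁ A) (hB : numCompIn F₂ B < numCompIn F₁ B) :
    SplitsAt (H \ cliqueOn {u, v, w}) F₁ F₂ w := by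
  obtain ⟨e1, e2, e3⟩ := h.supp_eq hH
  refine ⟨_, _, _, ?_, ?_, ?_, ?_, e1 ▸ hA, e2 ▸ hB, e3⟩
  · intro e
    rw [e, e2] at e1
    exact h.disj u h.mem_left (e1 ▸ h.mem_left)
  · intro e
    rw [e, e3] at e1
    exact h.notMem_left (e1 ▸ rfl)
  · intro e
    rw [e, e3] at e2
    exact h.notMem_right (e2 ▸ rfl)
  · intro C
    obtain ⟨x, rfl⟩ : ∃ x, (H \ cliqueOn {u, v, w}).connectedComponentMk x = C := C.exists_rep
    obtain ⟨t, rfl | rfl | rfl, ht⟩ :=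
      exists_reachable_sdiff_cliqueOn hH (S := {u, v, w}) ⟨u, by simp⟩ x
    · exact Or.inl (SimpleGraph.ConnectedComponent.sound ht)
    · exact Or.inr (Or.inl (SimpleGraph.ConnectedComponent.sound ht))
    · exact Or.inr (Or.inr (SimpleGraph.ConnectedComponent.sound ht))

theorem mem_supp_iff_of_adj {G : SimpleGraph V} (C : G.ConnectedComponent) {x y : V}
    (h : G.Adj x y) : x ∈ C.supp ↔ y ∈ C.supp := by
  rw [SimpleGraph.ConnectedComponent.mem_supp_iff, SimpleGraph.ConnectedComponent.mem_supp_iff,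
    SimpleGraph.ConnectedComponent.sound h.reachable]

/-- Each component meets `{u, v, w}`, so the two components other than `{w}` are those of `u` and
`v`, in one order or the other. That `{w}` is a component also forces `w` to have degree two. -/
theorem exists_sides_of_splitsAt {H F₁ F₂ : SimpleGraph V} {u v w : V} (hH : H.Connected)
    (hs : SplitsAt (H \ cliqueOn {u, v, w}) F₁ F₂ w) (huw : u ≠ w) (hvw : v ≠ w) :
    ∃ A B : Set V, (∀ x, x ∈ A ∨ x ∈ B ∨ x = w) ∧ (∀ x, x ∈ A → x ∉ B) ∧ w ∉ A ∧ w ∉ B ∧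
      u ∈ A ∧ v ∈ B ∧
      (∀ x y, (H \ cliqueOn {u, v, w}).Adj x y → (x ∈ A ↔ y ∈ A)) ∧
      (∀ x y, (H \ cliqueOn {u, v, w}).Adj x y → (x ∈ B ↔ y ∈ B)) ∧
      numCompIn F₂ A < numCompIn F₁ A ∧ numCompIn F₂ B < numCompIn F₁ B ∧
      ∀ y, H.Adj w y → y = u ∨ y = v := by
  obtain ⟨C₁, C₂, C₃, h12, h13, h23, hall, hlt1, hlt2, h3⟩ := hs
  have hw3 : (H \ cliqueOn {u, v, w}).connectedComponentMk w = C₃ := by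
    have : w ∈ C₃.supp := by rw [h3]; rfl
    exact this
  have hne3 : ∀ x, x ≠ w → (H \ cliqueOn {u, v, w}).connectedComponentMk x ≠ C₃ := by
    intro x hx e
    have : x ∈ C₃.supp := e
    rw [h3] at this
    exact hx this
  have hrep : ∀ C, C ≠ C₃ → C = (H \ cliqueOn {u, v, w}).connectedComponentMk u ∨
      C = (H \ cliqueOn {u, v, w}).connectedComponentMk v := by
    intro C hC
    obtain ⟨x, rfl⟩ : ∃ x, (H \ cliqueOn {u, v, w}).connectedComponentMk x = C := C.exists_rep
    obtain ⟨t, rfl | rfl | rfl, ht⟩ :=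
      exists_reachable_sdiff_cliqueOn hH (S := {u, v, w}) ⟨u, by simp⟩ x
    · exact Or.inl (SimpleGraph.ConnectedComponent.sound ht)
    · exact Or.inr (SimpleGraph.ConnectedComponent.sound ht)
    · exact absurd ((SimpleGraph.ConnectedComponent.sound ht).trans hw3) hC
  have hw : ∀ y, H.Adj w y → y = u ∨ y = v := by
    intro y hy
    by_contra hne
    have hJ : (H \ cliqueOn {u, v, w}).Adj w y := by
      rw [sdiff_cliqueOn_adj]
      refine ⟨hy, ?_⟩
      rintro ⟨-, rfl | rfl | rfl⟩
      · exact hne (Or.inl rfl)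
      · exact hne (Or.inr rfl)
      · exact hy.ne rfl
    exact hne3 y hy.ne' ((SimpleGraph.ConnectedComponent.sound hJ.symm.reachable).trans hw3)
  have hD : ∃ D₁ D₂, (∀ C, C = D₁ ∨ C = D₂ ∨ C = C₃) ∧ D₁ ≠ D₂ ∧ D₁ ≠ C₃ ∧ D₂ ≠ C₃ ∧
      numCompIn F₂ D₁.supp < numCompIn F₁ D₁.supp ∧ numCompIn F₂ D₂.supp < numCompIn F₁ D₂.supp ∧
      (H \ cliqueOn {u, v, w}).connectedComponentMk u = D₁ ∧
      (H \ cliqueOn {u, v, w}).connectedComponentMk v = D₂ := by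
    rcases hrep C₁ h13 with e1 | e1 <;> rcases hrep C₂ h23 with e2 | e2
    · exact absurd (e1.trans e2.symm) h12
    · exact ⟨C₁, C₂, hall, h12, h13, h23, hlt1, hlt2, e1.symm, e2.symm⟩
    · exact ⟨C₂, C₁, fun C => by have := hall C; tauto, h12.symm, h23, h13, hlt2, hlt1, e2.symm,
        e1.symm⟩
    · exact absurd (e1.trans e2.symm) h12
  obtain ⟨D₁, D₂, hall, n12, n13, n23, l1, l2, hu, hv⟩ := hD
  refine ⟨D₁.supp, D₂.supp, fun x => ?_, fun x hx hx' => n12 (hx.symm.trans hx'),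
    fun hx => n13 (hx.symm.trans hw3), fun hx => n23 (hx.symm.trans hw3), hu, hv,
    fun x y => mem_supp_iff_of_adj _, fun x y => mem_supp_iff_of_adj _, l1, l2, hw⟩
  rcases hall ((H \ cliqueOn {u, v, w}).connectedComponentMk x) with e | e | e
  · exact Or.inl e
  · exact Or.inr (Or.inl e)
  · by_contra hne
    exact hne3 x (fun e => hne (Or.inr (Or.inr e))) e

theorem deleteEdges_path_eq {H : SimpleGraph V} {u v w : V} (huv : ¬ H.Adj u v) :
    H.deleteEdges {s(u, w), s(w, v)} = H \ cliqueOn {u, v, w} := by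
  have hvu : ¬ H.Adj v u := fun h => huv h.symm
  ext x y
  rw [SimpleGraph.deleteEdges_adj, sdiff_cliqueOn_adj]
  simp only [Set.mem_insert_iff, Set.mem_singleton_iff, Sym2.eq_iff]
  constructor
  · rintro ⟨h1, h2⟩
    refine ⟨h1, ?_⟩
    have := h1.ne
    rintro ⟨rfl | rfl | rfl, rfl | rfl | rfl⟩ <;> simp_all
  · tauto

theorem deleteEdges_triangle_eq {H : SimpleGraph V} {u v w : V} :
    H.deleteEdges {s(u, v), s(u, w), s(v, w)} = H \ cliqueOn {u, v, w} := by
  ext x y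
  rw [SimpleGraph.deleteEdges_adj, sdiff_cliqueOn_adj]
  simp only [Set.mem_insert_iff, Set.mem_singleton_iff, Sym2.eq_iff]
  constructor
  · rintro ⟨h1, h2⟩
    refine ⟨h1, ?_⟩
    have := h1.ne
    rintro ⟨rfl | rfl | rfl, rfl | rfl | rfl⟩ <;> simp_all
  · tauto

theorem sup_edge_sdiff_cliqueOn {H : SimpleGraph V} {u v w : V} :
    (H ⊔ SimpleGraph.edge u v) \ cliqueOn {u, v, w} = H \ cliqueOn {u, v, w} := by
  ext x y
  rw [sdiff_cliqueOn_adj, sdiff_cliqueOn_adj, sup_edge_adj]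
  simp only [Set.mem_insert_iff, Set.mem_singleton_iff]
  tauto

theorem sdiff_cliqueOn_sup_triangle {H : SimpleGraph V} {u v w : V} (huv : u ≠ v)
    (huw : H.Adj u w) (hvw : H.Adj v w) :
    H \ cliqueOn {u, v, w} ⊔ cliqueOn {u, v, w} = H ⊔ SimpleGraph.edge u v := by
  rw [← sup_edge_sdiff_cliqueOn]
  refine sdiff_cliqueOn_sup ?_
  rintro x (rfl | rfl | rfl) y (rfl | rfl | rfl) hne
  all_goals
    first
    | exact absurd rfl hne
    | exact Or.inl huw
    | exact Or.inl huw.symm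
    | exact Or.inl hvw
    | exact Or.inl hvw.symm
    | (rw [sup_edge_adj]; tauto)

theorem IsOptimalDecomp.unique_max {H F₁ F₂ : SimpleGraph V} (h : IsOptimalDecomp H F₁ F₂) {D₁ D₂ : SimpleGraph V}
    (hD : IsOptimalDecomp H D₁ D₂) :
    max (numComp F₁) (numComp F₂) = max (numComp D₁) (numComp D₂) := h.2.unique hD.2

/-! ### Adding an edge -/

section Main

variable [Finite V] {H F₁ F₂ : SimpleGraph V} {u v : V} {k : ℕ}

theorem deg_eq_zero_iff {F : SimpleGraph V} {x : V} : deg F x = 0 ↔ ∀ y, ¬ F.Adj x y := by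
  rw [deg, Set.ncard_eq_zero, Set.eq_empty_iff_forall_notMem]
  rfl

/-- `pendant_or_hinge` is applied to `H + uv`. An isolated edge makes `u` and `v` isolated in the
first part of `H`; in a hinge, `H` is the graph containing the path. -/
theorem classA_of_decomp (hH : H.Connected) (hTH : TwoHamming H) (hk : ¬ DecompLE k H)
    (huv : u ≠ v) (nuv : ¬ H.Adj u v)
    (hF : IsTwoHammingDecomp (H ⊔ SimpleGraph.edge u v) F₁ F₂) (h1 : numComp F₁ ≤ k)
    (h2 : numComp F₂ ≤ k) (hF1 : F₁.Adj u v) : ClassA H := by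
  obtain ⟨D₁, D₂, hD⟩ := twoHamming_iff.1 hTH
  have hc : (H ⊔ SimpleGraph.edge u v).Connected := hH.mono le_sup_left
  have e := deleteEdges_sup_edge nuv
  have of_decomp : ∀ G₁ G₂, IsTwoHammingDecomp H G₁ G₂ → numComp G₂ < numComp G₁ →
      (∃ w, H.Adj u w ∧ H.Adj v w ∧ SplitsAt (H \ cliqueOn {u, v, w}) G₁ G₂ w) → ClassA H := by
    rintro G₁ G₂ hG hlt ⟨w, huw, hvw, hs⟩
    refine ⟨hH, hTH, hG.not_balanced hH hlt, G₁, G₂, hG.isOptimalDecomp hH, hlt, u, v, huv, nuv,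
      Or.inr ⟨w, huw, hvw, ?_⟩⟩
    rwa [deleteEdges_path_eq nuv]
  rcases hF.pendant_or_hinge hc hF1 (e.symm ▸ hD) with hp | ⟨w, A, B, -, hh, eF, -⟩
  · have hG := hF.sdiff_pendant hF1 hp
    rw [e] at hG
    have hn := hF.numComp_pendant hF1 hp
    rw [hG.decompLE_iff hH] at hk
    have hlt : numComp F₂ < numComp (F₁ \ cliqueOn {u, v}) := by omega
    have hiso := hF.pendant_isolated hF1 hp
    exact ⟨hH, hTH, hG.not_balanced hH hlt, _, _, hG.isOptimalDecomp hH, hlt, u, v, huv, nuv,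
      Or.inl ⟨deg_eq_zero_iff.2 (hiso u (by simp)), deg_eq_zero_iff.2 (hiso v (by simp))⟩⟩
  · have huw : F₁.Adj u w := by
      rw [← eF]
      exact Or.inr ⟨hh.left_ne, by simp, by simp⟩
    have hvw : F₁.Adj v w := hF.trans₁ hF1.symm huw hh.right_ne
    have hP := hh.path
    have eP := sdiff_cliqueOn_sup_path (hF.le₁ huw) (hF.le₁ hvw)
    rw [eP, e] at hP
    rw [hP.decompLE_iff hH] at hk
    have t1 := hh.numComp_triangle₁
    rw [eF] at t1
    have t2 := hh.numComp_triangle₂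
    have p1 := hh.numComp_path₁
    have p2 := hh.numComp_path₂
    have a1 := hh.numCompIn_path₁_left
    have a2 := hh.numCompIn_path₂_left
    have b1 := hh.numCompIn_path₁_right
    have b2 := hh.numCompIn_path₂_right
    have hadj : H.Adj u w ∧ H.Adj v w := by
      have n1 := huw.ne
      have n2 := hvw.ne
      have g1 := hF.le₁ huw
      have g2 := hF.le₁ hvw
      rw [sup_edge_adj] at g1 g2
      tauto
    rw [sup_edge_sdiff_cliqueOn] at *
    -- The path counts have the same sum as the triangle counts, hence at most `2 * k`, so exactly
    -- one of them exceeds `k`. That part is taken as the larger one.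
    by_cases hbig : k < numComp (flip (F₁ \ cliqueOn {u, v, w}) F₂ B ⊔ cliqueOn {u, w})
    · exact of_decomp _ _ hP (by omega) ⟨w, hadj.1, hadj.2, hh.splitsAt hH (by omega) (by omega)⟩
    · exact of_decomp _ _ hP.swap (by omega)
        ⟨w, hadj.1, hadj.2, hh.splitsAt hH (by omega) (by omega)⟩

theorem classA_of_decompLE (hH : H.Connected) (hTH : TwoHamming H) (hk : ¬ DecompLE k H)
    (huv : u ≠ v) (nuv : ¬ H.Adj u v) (h : DecompLE k (H ⊔ SimpleGraph.edge u v)) : ClassA H := by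
  obtain ⟨F₁, F₂, hF, h1, h2⟩ := h
  have hadj : (H ⊔ SimpleGraph.edge u v).Adj u v := by
    rw [sup_edge_adj]
    tauto
  rcases (hF.adj_iff u v).1 hadj with h | h
  · exact classA_of_decomp hH hTH hk huv nuv hF h1 h2 h
  · exact classA_of_decomp hH hTH hk huv nuv hF.swap h2 h1 h

theorem decompLE_of_path (hF : IsTwoHammingDecomp H F₁ F₂) {w : V} {A B : Set V}
    (nuv : ¬ H.Adj u v) (huw : F₁.Adj u w) (hvw : F₂.Adj v w)
    (hw : ∀ y, H.Adj w y → y = u ∨ y = v)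
    (cover : ∀ x, x ∈ A ∨ x ∈ B ∨ x = w) (disj : ∀ x, x ∈ A → x ∉ B) (hwA : w ∉ A) (hwB : w ∉ B)
    (hu : u ∈ A) (hv : v ∈ B)
    (cA : ∀ x y, (H \ cliqueOn {u, v, w}).Adj x y → (x ∈ A ↔ y ∈ A))
    (cB : ∀ x y, (H \ cliqueOn {u, v, w}).Adj x y → (x ∈ B ↔ y ∈ B))
    (hA : numCompIn F₂ A < numCompIn F₁ A) (hB : numCompIn F₂ B < numCompIn F₁ B)
    (hk : numComp F₁ ≤ k + 1) : DecompLE k (H ⊔ SimpleGraph.edge u v) := by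
  obtain ⟨E₁, E₂, hh, rfl, rfl⟩ :=
    Hinge.of_path hF nuv huw hvw hw cover disj hwA hwB hu hv cA cB
  have hT := hh.triangle
  rw [sdiff_cliqueOn_sup_triangle hh.ends_ne (hF.le₁ huw) (hF.le₂ hvw)] at hT
  have t1 := hh.numComp_triangle₁
  have t2 := hh.numComp_triangle₂
  have p1 := hh.numComp_path₁
  have a1 := hh.numCompIn_path₁_left
  have a2 := hh.numCompIn_path₂_left
  have b1 := hh.numCompIn_path₁_right
  have b2 := hh.numCompIn_path₂_right
  exact ⟨_, _, hT, by omega, by omega⟩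

theorem exists_sup_edge_of_classA (h : ClassA H) : ∃ F₁ F₂, IsOptimalDecomp H F₁ F₂ ∧
    numComp F₂ < numComp F₁ ∧ ∃ u v, u ≠ v ∧ ¬ H.Adj u v ∧
      ∀ k, numComp F₁ = k + 1 → DecompLE k (H ⊔ SimpleGraph.edge u v) := by
  obtain ⟨hH, -, -, F₁, F₂, hopt, hlt, u, v, huv, nuv, hcase⟩ := h
  refine ⟨F₁, F₂, hopt, hlt, u, v, huv, nuv, fun k hk => ?_⟩
  have hF := hopt.1
  rcases hcase with ⟨h1, h2⟩ | ⟨w, huw, hvw, hs⟩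
  · rw [deg_eq_zero_iff] at h1 h2
    have hiso : ∀ x ∈ ({u, v} : Set V), ∀ y, ¬ F₁.Adj x y := by
      rintro x (rfl | rfl)
      · exact h1
      · exact h2
    have hD := hF.sup_cliqueOn hiso (by
      rintro x (rfl | rfl) y (rfl | rfl) hxy
      · exact hxy.ne rfl
      · exact nuv (hF.le₂ hxy)
      · exact nuv (hF.le₂ hxy.symm)
      · exact hxy.ne rfl)
    have hn := hF.left.numComp_sup_cliqueOn hD.left hiso ⟨u, by simp⟩
    rw [Set.ncard_pair huv] at hn
    rw [sup_cliqueOn_pair] at hD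
    exact ⟨_, _, hD, by omega, by omega⟩
  · rw [deleteEdges_path_eq nuv] at hs
    obtain ⟨A, B, cover, disj, hwA, hwB, hu, hv, cA, cB, hA, hB, hw⟩ :=
      exists_sides_of_splitsAt hH hs huw.ne hvw.ne
    -- Since `u` and `v` are not adjacent, `uw` and `vw` have different colours; in the second case
    -- `u` and `v` exchange roles.
    rcases (hF.adj_iff u w).1 huw with g1 | g1
    · have g2 : F₂.Adj v w := ((hF.adj_iff v w).1 hvw).resolve_left fun g =>
        nuv (hF.le₁ (hF.trans₁ g1 g.symm huv))
      exact decompLE_of_path hF nuv g1 g2 hw cover disj hwA hwB hu hv cA cB hA hB hk.le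
    · have g2 : F₁.Adj v w := ((hF.adj_iff v w).1 hvw).resolve_right fun g =>
        nuv (hF.le₂ (hF.trans₂ g1 g.symm huv))
      rw [SimpleGraph.edge_comm]
      rw [Set.insert_comm] at cA cB
      exact decompLE_of_path hF (fun h => nuv h.symm) g2 g1 (fun y hy => (hw y hy).symm)
        (fun x => by have := cover x; tauto) (fun x hx hx' => disj x hx' hx) hwB hwA hv hu cB cA
        hB hA hk.le

/-! ### Deleting an edge -/

theorem classB_of_decomp (hH : H.Connected) (hk : ¬ DecompLE k H)
    (hF : IsTwoHammingDecomp H F₁ F₂) (huv : F₁.Adj u v)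
    (hdel : DecompLE k (H.deleteEdges {s(u, v)})) : ClassB H := by
  have hTH := hF.twoHamming
  rw [hF.decompLE_iff hH] at hk
  obtain ⟨D₁, D₂, hD, d1, d2⟩ := hdel
  rcases hF.pendant_or_hinge hH huv hD with hp | ⟨w, A, B, -, hh, eF, -⟩
  · have hE := hF.sdiff_pendant huv hp
    have hn := hF.numComp_pendant huv hp
    -- Were `H - uv` connected, its only decomposition would be `F₁` without `uv` together with
    -- `F₂`, which has even more components.
    have hbridge : ¬ (H.deleteEdges {s(u, v)}).Reachable u v := by
      intro hr
      have hconn := connected_deleteEdges hH hr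
      have := (hE.decompLE_iff hconn (k := k)).1 ⟨D₁, D₂, hD, d1, d2⟩
      omega
    have huB : u ∉ {x | (H.deleteEdges {s(u, v)}).Reachable v x} := fun h =>
      hbridge (SimpleGraph.Reachable.symm h)
    have hvB : v ∈ {x | (H.deleteEdges {s(u, v)}).Reachable v x} := SimpleGraph.Reachable.refl _
    have hcl : ∀ x y, (H.deleteEdges {s(u, v)}).Adj x y →
        (x ∈ {x | (H.deleteEdges {s(u, v)}).Reachable v x} ↔
          y ∈ {x | (H.deleteEdges {s(u, v)}).Reachable v x}) := fun x y hxy =>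
      ⟨fun hx => SimpleGraph.Reachable.trans hx hxy.reachable,
        fun hx => SimpleGraph.Reachable.trans hx hxy.symm.reachable⟩
    have hA : ∀ x, x ∉ {x | (H.deleteEdges {s(u, v)}).Reachable v x} →
        (H.deleteEdges {s(u, v)}).Reachable u x := by
      intro x hx
      obtain ⟨t, ht, hr⟩ := exists_reachable_sdiff_cliqueOn hH (S := {u, v}) ⟨u, by simp⟩ x
      rw [sdiff_cliqueOn_pair] at hr
      rcases ht with rfl | rfl
      · exact hr.symm
      · exact absurd hr.symm hx
    obtain ⟨hfl, n1, n2, n3, n4⟩ := bridge_counts hF huv hp huB hvB hcl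
    have c1 := fun x y hxy => hcl x y (hE.le₁ hxy)
    have c2 := fun x y hxy => hcl x y (hE.le₂ hxy)
    -- A decomposition agreeing with the old one on the side of `u` cannot agree on the side of `v`
    -- too, as the counts would be too large. So it is the one with the side of `v` exchanged.
    have core : ∀ D₁ D₂, IsTwoHammingDecomp (H.deleteEdges {s(u, v)}) D₁ D₂ →
        numComp D₁ ≤ k → numComp D₂ ≤ k →
        (∀ x y, (H.deleteEdges {s(u, v)}).Reachable u x →
          ((F₁ \ cliqueOn {u, v}).Adj x y ↔ D₁.Adj x y) ∧ (F₂.Adj x y ↔ D₂.Adj x y)) →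
        numComp (flip (F₁ \ cliqueOn {u, v}) F₂
          {x | (H.deleteEdges {s(u, v)}).Reachable v x}) ≤ k ∧
        numComp (flip F₂ (F₁ \ cliqueOn {u, v})
          {x | (H.deleteEdges {s(u, v)}).Reachable v x}) ≤ k := by
      intro D₁ D₂ hD d1 d2 hagree
      rcases hE.eq_or_flip hD v with hv | hv
      · exfalso
        have e1 : D₁ = F₁ \ cliqueOn {u, v} := by
          ext x y
          by_cases hx : x ∈ {x | (H.deleteEdges {s(u, v)}).Reachable v x}
          · exact (hv x y hx).1.symm
          · exact (hagree x y (hA x hx)).1.symm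
        have e2 : D₂ = F₂ := by
          ext x y
          by_cases hx : x ∈ {x | (H.deleteEdges {s(u, v)}).Reachable v x}
          · exact (hv x y hx).2.symm
          · exact (hagree x y (hA x hx)).2.symm
        rw [e1] at d1
        rw [e2] at d2
        omega
      · have e1 : D₁ = flip (F₁ \ cliqueOn {u, v}) F₂
            {x | (H.deleteEdges {s(u, v)}).Reachable v x} := by
          ext x y
          by_cases hx : x ∈ {x | (H.deleteEdges {s(u, v)}).Reachable v x}
          · rw [flip_adj_of_mem c2 hx]
            exact (hv x y hx).2.symm
          · rw [flip_adj_of_notMem c1 hx]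
            exact (hagree x y (hA x hx)).1.symm
        have e2 : D₂ = flip F₂ (F₁ \ cliqueOn {u, v})
            {x | (H.deleteEdges {s(u, v)}).Reachable v x} := by
          ext x y
          by_cases hx : x ∈ {x | (H.deleteEdges {s(u, v)}).Reachable v x}
          · rw [flip_adj_of_mem c1 hx]
            exact (hv x y hx).1.symm
          · rw [flip_adj_of_notMem c2 hx]
            exact (hagree x y (hA x hx)).2.symm
        rw [← e1, ← e2]
        exact ⟨d1, d2⟩
    have hle := (hE.eq_or_flip hD u).elim (fun h => core D₁ D₂ hD d1 d2 h)
      (fun h => core D₂ D₁ hD.swap d2 d1 h)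
    have hcomp : ∀ C : (H.deleteEdges {s(u, v)}).ConnectedComponent,
        C.supp = {x | (H.deleteEdges {s(u, v)}).Reachable v x}ᶜ ∨
        C.supp = {x | (H.deleteEdges {s(u, v)}).Reachable v x} := by
      intro C
      obtain ⟨z, rfl⟩ : ∃ z, (H.deleteEdges {s(u, v)}).connectedComponentMk z = C := C.exists_rep
      by_cases hz : z ∈ {x | (H.deleteEdges {s(u, v)}).Reachable v x}
      · right
        ext x
        rw [SimpleGraph.ConnectedComponent.mem_supp_iff, SimpleGraph.ConnectedComponent.eq]
        exact ⟨fun hx => SimpleGraph.Reachable.trans hz hx.symm,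
          fun hx => SimpleGraph.Reachable.trans (SimpleGraph.Reachable.symm hx) hz⟩
      · left
        ext x
        rw [SimpleGraph.ConnectedComponent.mem_supp_iff, SimpleGraph.ConnectedComponent.eq]
        exact ⟨fun hx hx' => hz (SimpleGraph.Reachable.trans hx' hx),
          fun hx => (hA x hx).symm.trans (hA z hz)⟩
    -- The surplus required on each side depends on the part holding the bridge: the split adds a
    -- component on each side to that part, and the bridge itself lies in neither side. This gives 1
    -- if that part is the larger one and 2 otherwise.
    by_cases hbig : k < numComp F₁
    · refine ⟨hH, hTH, hF.not_balanced hH (by omega), F₁, F₂, hF.isOptimalDecomp hH, by omega,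
        u, v, hF.le₁ huv, Or.inl ⟨hbridge, 1, Or.inl ⟨rfl, huv⟩, fun C => ?_⟩⟩
      rcases hcomp C with e | e <;> rw [e] <;> omega
    · refine ⟨hH, hTH, hF.swap.not_balanced hH (by omega), F₂, F₁, hF.swap.isOptimalDecomp hH,
        by omega, u, v, hF.le₁ huv, Or.inl ⟨hbridge, 2, Or.inr ⟨rfl, huv⟩, fun C => ?_⟩⟩
      rcases hcomp C with e | e <;> rw [e] <;> omega
  · have huw : F₁.Adj u w := by
      rw [← eF]
      exact Or.inr ⟨hh.left_ne, by simp, by simp⟩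
    have hvw : F₁.Adj v w := hF.trans₁ huv.symm huw hh.right_ne
    have hP := hh.path
    rw [sdiff_cliqueOn_sup_path (hF.le₁ huw) (hF.le₁ hvw)] at hP
    have hr : (H.deleteEdges {s(u, v)}).Reachable u v := by
      have n1 := huw.ne
      have n2 := hvw.ne
      have a1 : (H.deleteEdges {s(u, v)}).Adj u w :=
        deleteEdges_pair_adj.2 ⟨hF.le₁ huw, by tauto⟩
      have a2 : (H.deleteEdges {s(u, v)}).Adj v w :=
        deleteEdges_pair_adj.2 ⟨hF.le₁ hvw, by tauto⟩
      exact a1.reachable.trans a2.symm.reachable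
    have hPk := (hP.decompLE_iff (connected_deleteEdges hH hr) (k := k)).1 ⟨D₁, D₂, hD, d1, d2⟩
    have t1 := hh.numComp_triangle₁
    have t2 := hh.numComp_triangle₂
    have p1 := hh.numComp_path₁
    have p2 := hh.numComp_path₂
    have a1 := hh.numCompIn_triangle_left
    have b1 := hh.numCompIn_triangle_right
    rw [eF] at t1 a1 b1
    have of_decomp : ∀ G₁ G₂, IsTwoHammingDecomp H G₁ G₂ → numComp G₂ < numComp G₁ →
        SplitsAt (H \ cliqueOn {u, v, w}) G₁ G₂ w → ClassB H := by
      intro G₁ G₂ hG hlt hs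
      refine ⟨hH, hTH, hG.not_balanced hH hlt, G₁, G₂, hG.isOptimalDecomp hH, hlt, u, v,
        hF.le₁ huv, Or.inr ⟨w, hF.le₁ huw, hF.le₁ hvw, ?_⟩⟩
      rwa [deleteEdges_triangle_eq]
    by_cases hbig : k < numComp F₁
    · exact of_decomp _ _ hF (by omega) (hh.splitsAt hH (by omega) (by omega))
    · exact of_decomp _ _ hF.swap (by omega) (hh.splitsAt hH (by omega) (by omega))

theorem classB_of_decompLE (hH : H.Connected) (hTH : TwoHamming H) (hk : ¬ DecompLE k H)
    (huv : H.Adj u v) (h : DecompLE k (H.deleteEdges {s(u, v)})) : ClassB H := by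
  obtain ⟨F₁, F₂, hF⟩ := twoHamming_iff.1 hTH
  rcases (hF.adj_iff u v).1 huv with h1 | h1
  · exact classB_of_decomp hH hk hF h1 h
  · exact classB_of_decomp hH hk hF.swap h1 h

theorem exists_bridge_flip (hF : IsTwoHammingDecomp H F₁ F₂) (huv : F₁.Adj u v)
    (hb : ¬ (H.deleteEdges {s(u, v)}).Reachable u v) (hH : H.Connected) :
    ∃ C C' : (H.deleteEdges {s(u, v)}).ConnectedComponent,
      numComp F₁ = numCompIn F₁ C.supp + numCompIn F₁ C'.supp + 1 ∧
      numComp F₂ = numCompIn F₂ C.supp + numCompIn F₂ C'.supp ∧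
      ∀ k, numCompIn F₁ C.supp + 1 + numCompIn F₂ C'.supp ≤ k →
        numCompIn F₂ C.supp + (numCompIn F₁ C'.supp + 1) ≤ k →
        DecompLE k (H.deleteEdges {s(u, v)}) := by
  refine ⟨(H.deleteEdges {s(u, v)}).connectedComponentMk u,
    (H.deleteEdges {s(u, v)}).connectedComponentMk v, ?_⟩
  have huB : u ∉ ((H.deleteEdges {s(u, v)}).connectedComponentMk v).supp := fun h =>
    hb (SimpleGraph.ConnectedComponent.exact h)
  obtain ⟨hfl, n1, n2, n3, n4⟩ := bridge_counts hF huv (hF.pendant_of_bridge huv hb) huB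
    rfl fun x y hxy => mem_supp_iff_of_adj _ hxy
  have e : ((H.deleteEdges {s(u, v)}).connectedComponentMk v).suppᶜ =
      ((H.deleteEdges {s(u, v)}).connectedComponentMk u).supp := by
    ext x
    constructor
    · intro hx
      obtain ⟨t, ht, hr⟩ := exists_reachable_sdiff_cliqueOn hH (S := {u, v}) ⟨u, by simp⟩ x
      rw [sdiff_cliqueOn_pair] at hr
      rcases ht with rfl | rfl
      · exact SimpleGraph.ConnectedComponent.sound hr
      · exact absurd (SimpleGraph.ConnectedComponent.sound hr) hx
    · intro hx hx'
      exact hb (SimpleGraph.ConnectedComponent.exact (Eq.trans (Eq.symm hx) hx'))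
  rw [e] at n1 n2 n3 n4
  exact ⟨n1, n2, fun k k1 k2 => ⟨_, _, hfl, by omega, by omega⟩⟩

theorem exists_triangle_flip (hF : IsTwoHammingDecomp H F₁ F₂) {w : V} {A B : Set V}
    (huv : F₁.Adj u v) (huw : H.Adj u w) (hw : ∀ y, H.Adj w y → y = u ∨ y = v)
    (cover : ∀ x, x ∈ A ∨ x ∈ B ∨ x = w) (disj : ∀ x, x ∈ A → x ∉ B) (hwA : w ∉ A) (hwB : w ∉ B)
    (hvw : H.Adj v w) (hu : u ∈ A) (hv : v ∈ B)
    (cA : ∀ x y, (H \ cliqueOn {u, v, w}).Adj x y → (x ∈ A ↔ y ∈ A))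
    (cB : ∀ x y, (H \ cliqueOn {u, v, w}).Adj x y → (x ∈ B ↔ y ∈ B)) :
    numComp F₁ = numCompIn F₁ A + numCompIn F₁ B + 1 ∧
    numComp F₂ = numCompIn F₂ A + numCompIn F₂ B + 1 ∧
    ∀ k, numCompIn F₁ A + 1 + numCompIn F₂ B ≤ k → numCompIn F₂ A + (numCompIn F₁ B + 1) ≤ k →
      DecompLE k (H.deleteEdges {s(u, v)}) := by
  have huw₁ : F₁.Adj u w := by
    have h2 := hF.adj_iff_same (hF.le₁ huv) hvw huw.ne
    exact hF.trans₁ huv ((h2.1 huw).1 huv) huw.ne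
  obtain ⟨hh, eF, -⟩ := Hinge.of_triangle hF huv huw₁ hw cover disj hwA hwB hu hv cA cB
  have hP := hh.path
  rw [sdiff_cliqueOn_sup_path huw hvw] at hP
  have t1 := hh.numComp_triangle₁
  have t2 := hh.numComp_triangle₂
  have p1 := hh.numComp_path₁
  have p2 := hh.numComp_path₂
  have a1 := hh.numCompIn_triangle_left
  have b1 := hh.numCompIn_triangle_right
  rw [eF] at t1 a1 b1
  exact ⟨by omega, by omega, fun k k1 k2 => ⟨_, _, hP, by omega, by omega⟩⟩

theorem exists_deleteEdges_of_classB (h : ClassB H) : ∃ F₁ F₂, IsOptimalDecomp H F₁ F₂ ∧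
    numComp F₂ < numComp F₁ ∧ ∃ u v, H.Adj u v ∧
      ∀ k, numComp F₁ = k + 1 → DecompLE k (H.deleteEdges {s(u, v)}) := by
  obtain ⟨hH, -, -, F₁, F₂, hopt, hlt, u, v, huv, hcase⟩ := h
  refine ⟨F₁, F₂, hopt, hlt, u, v, huv, fun k hk => ?_⟩
  have hF := hopt.1
  rcases hcase with ⟨hb, i, hi, hC⟩ | ⟨w, huw, hvw, hs⟩
  · rcases hi with ⟨rfl, h1⟩ | ⟨rfl, h1⟩
    · obtain ⟨C, C', n1, n2, hfl⟩ := exists_bridge_flip hF h1 hb hH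
      have := hC C
      have := hC C'
      exact hfl k (by omega) (by omega)
    · obtain ⟨C, C', n1, n2, hfl⟩ := exists_bridge_flip hF.swap h1 hb hH
      have := hC C
      have := hC C'
      exact hfl k (by omega) (by omega)
  · rw [deleteEdges_triangle_eq] at hs
    obtain ⟨A, B, cover, disj, hwA, hwB, hu, hv, cA, cB, hA, hB, hw⟩ :=
      exists_sides_of_splitsAt hH hs huw.ne hvw.ne
    rcases (hF.adj_iff u v).1 huv with g | g
    · obtain ⟨n1, n2, hP⟩ := exists_triangle_flip hF g huw hw cover disj hwA hwB hvw hu hv cA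
        cB
      exact hP k (by omega) (by omega)
    · obtain ⟨n1, n2, hP⟩ := exists_triangle_flip hF.swap g huw hw cover disj hwA hwB hvw hu hv cA
        cB
      exact hP k (by omega) (by omega)

/-! ### The main theorem -/

theorem adj_of_numComp_le_one (hF : IsTwoHammingDecomp H F₁ F₂) (huv : u ≠ v)
    (h : numComp F₂ ≤ 1) : H.Adj u v := by
  have hs : Subsingleton F₂.ConnectedComponent := Finite.card_le_one_iff_subsingleton.1 h
  have hr := SimpleGraph.ConnectedComponent.exact
    (Subsingleton.elim (F₂.connectedComponentMk u) (F₂.connectedComponentMk v))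
  exact hF.le₂ (hF.right u v hr huv)

theorem exists_saturated_iff_chipped (hH : H.Connected) (hn : ¬ TwoHamming H) :
    (∃ k, 2 ≤ k ∧ InducedSaturated (cliqueSquare k) H) ↔ Chipped H := by
  constructor
  · rintro ⟨k, hk, hs⟩
    obtain ⟨-, ⟨u, v, huv, nuv, F₁, F₂, hF, -⟩, ⟨p, q, hpq, D₁, D₂, hD, -⟩⟩ :=
      (inducedSaturated_cliqueSquare_iff hk).1 hs
    exact chipped_of_not_twoHamming hH hn huv nuv hF.twoHamming hpq hD.twoHamming
  · intro hc
    obtain ⟨p, q, hpq, hD⟩ := exists_deleteEdges_of_chipped hc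
    obtain ⟨D₁, D₂, hD⟩ := twoHamming_iff.1 hD
    obtain ⟨H', F₁, F₂, u, v, -, -, hF, huv, rfl, -⟩ := chipped_iff_exists_block.1 hc
    -- No part has more than `Nat.card V` components; the summand 2 only guarantees `2 ≤ k`.
    refine ⟨Nat.card V + 2, by omega, (inducedSaturated_cliqueSquare_iff (by omega)).2
      ⟨?_, ⟨u, v, huv.ne, by simp, ?_⟩, ⟨p, q, hpq, hD.decompLE (by omega)⟩⟩⟩
    · rintro ⟨G₁, G₂, hG, -⟩
      exact hn hG.twoHamming
    · rw [sup_edge_deleteEdges (hF.le₁ huv)]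
      exact hF.decompLE (by omega)

theorem exists_saturated_iff_classes (hH : H.Connected) (hTH : TwoHamming H) :
    (∃ k, 2 ≤ k ∧ InducedSaturated (cliqueSquare k) H) ↔ ClassA H ∧ ClassB H := by
  constructor
  · rintro ⟨k, hk, hs⟩
    obtain ⟨hn, ⟨u, v, huv, nuv, hA⟩, ⟨p, q, hpq, hB⟩⟩ :=
      (inducedSaturated_cliqueSquare_iff hk).1 hs
    exact ⟨classA_of_decompLE hH hTH hn huv nuv hA, classB_of_decompLE hH hTH hn hpq hB⟩
  · rintro ⟨hA, hB⟩
    obtain ⟨F₁, F₂, hF, hlt, u, v, huv, nuv, hA⟩ := exists_sup_edge_of_classA hA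
    obtain ⟨D₁, D₂, hD, hlt', p, q, hpq, hB⟩ := exists_deleteEdges_of_classB hB
    -- The decompositions supplied by the two classes may differ, but their larger counts agree, so
    -- one `k` serves for both edges.
    have he := hF.unique_max hD
    rw [max_eq_left hlt.le, max_eq_left hlt'.le] at he
    -- A nonedge forces the smaller part to have at least two components, and the larger has
    -- strictly more; this yields `2 ≤ k`.
    have h3 : 3 ≤ numComp F₁ := by
      by_contra hlt3
      exact nuv (adj_of_numComp_le_one hF.1 huv (by omega))
    obtain ⟨k, hk⟩ : ∃ k, numComp F₁ = k + 1 := ⟨numComp F₁ - 1, by omega⟩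
    refine ⟨k, by omega, (inducedSaturated_cliqueSquare_iff (by omega)).2
      ⟨?_, ⟨u, v, huv, nuv, hA k hk⟩, ⟨p, q, hpq, hB k (by omega)⟩⟩⟩
    rw [hF.1.decompLE_iff hH]
    omega

end Main

end InducedSaturation

theorem theorem12 {V : Type*} [Finite V] (H : SimpleGraph V) (hH : H.Connected) :
    ((∃ k : ℕ, 2 ≤ k ∧
        InducedSaturation.InducedSaturated (InducedSaturation.cliqueSquare k) H) ↔
      (InducedSaturation.Chipped H ∨
        (InducedSaturation.ClassA H ∧ InducedSaturation.ClassB H))) ∧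
    (2 < InducedSaturation.dim H →
      ((∃ k : ℕ, 2 ≤ k ∧
          InducedSaturation.InducedSaturated (InducedSaturation.cliqueSquare k) H) ↔
        InducedSaturation.Chipped H)) ∧
    (InducedSaturation.dim H ≤ 2 →
      ((∃ k : ℕ, 2 ≤ k ∧
          InducedSaturation.InducedSaturated (InducedSaturation.cliqueSquare k) H) ↔
        (InducedSaturation.ClassA H ∧ InducedSaturation.ClassB H))) := by
  refine ⟨?_, fun h => ?_, fun h => ?_⟩
  · by_cases hTH : InducedSaturation.TwoHamming H
    · rw [InducedSaturation.exists_saturated_iff_classes hH hTH]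
      exact (or_iff_right fun hc => InducedSaturation.not_twoHamming_of_chipped hc hTH).symm
    · rw [InducedSaturation.exists_saturated_iff_chipped hH hTH]
      exact (or_iff_left fun hA => hTH hA.1.2.1).symm
  · rw [← not_le, InducedSaturation.dim_le_two_iff] at h
    exact InducedSaturation.exists_saturated_iff_chipped hH h
  · exact InducedSaturation.exists_saturated_iff_classes hH
      (InducedSaturation.dim_le_two_iff.1 h)
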